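/- Let $(N,h,J_N)$ be a nonempty Kähler manifold of positive dimension with Kähler form $\Omega_N(X,Y)=h(J_NX,Y)$, let $s\neq 0$ be a real number, and let $p:P\to N$ be a smooth principal circle bundle with a connection form $\theta$ (a circle-invariant real one-form with $\theta(\xi)=1$, where $\xi$ is the fundamental vector field with flow $y\mapsto e^{it}\cdot y$) such that $d\theta=s\,p^*\Omega_N$; thus the class $\{\frac{s}{2\pi}\Omega_N\}$ is integral, i.e. $N$ is a Hodge manifold. Let $L>0$ and let $f,r$ be smooth functions on $(0,L)$ with $f$ nowhere zero and $r>0$. On $(0,L)\times P$ consider the metric $$g=dt^2+f(t)^2\theta^2+r(t)^2p^*h$$ and the almost complex structure $J$ given by $JH=\frac1f\xi$ and $JX=(J_NX_*)^*$ for the horizontal lift $X=(X_*)^*$ of a tangent vector $X_*$ of $N$, where $H=\frac{d}{dt}$ (so $J\xi=-fH$). Let $\Delta=\mathrm{span}\{H,\xi\}$, the distribution tangent to the fibres of $(0,L)\times P\to N$. Then $(g,J)$ is Kähler (that is, $g$ is a $J$-Hermitian Riemannian metric whose Levi-Civita connection $\nabla$ satisfies $\nabla J=0$) if and only if $f=\frac{2rr'}{s}$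 on $(0,L)$. In that case: (a) $\Delta$ is totally geodesic, i.e. $\nabla_YZ$ is a section of $\Delta$ for all local sections $Y,Z$ of $\Delta$; (b) $\Delta$ is an eigendistribution of the Ricci tensor $\rho$ of $g$ (at each point there is $\lambda$ with $\rho(v,\cdot)=\lambda g(v,\cdot)$ for all $v\in\Delta$); in particular $\rho(v,w)=0$ for $v\in\Delta$, $w\in\Delta^\perp$; (c) $\tau=\frac{r^2}{s}$ is a special Kähler potential, with $J\nabla\tau=\xi$; that is, $\tau$ is smooth and nonconstant, $J\nabla\tau$ is a Killing vector field, and at every point with $d\tau\ne0$ all nonzero tangent vectors orthogonal to $J\nabla\tau$ and $\nabla\tau$ are eigenvectors of the Hessian $\nabla d\tau$. -/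

import Mathlib

open scoped Manifold ContDiff Topology Bundle

/-! ### Riemannian and Kähler geometry on a manifold -/

section Geometry

variable {E : Type*} [NormedAddCommGroup E] [NormedSpace ℝ E]
  {H : Type*} [TopologicalSpace H] (I : ModelWithCorners ℝ E H)
  {M : Type*} [TopologicalSpace M] [ChartedSpace H M]

/-- Tensor fields of type `(0,2)`, not necessarily smooth. -/
abbrev TwoTensor (M : Type*) [TopologicalSpace M] [ChartedSpace H M] :=
  ∀ x : M, TangentSpace I x →L[ℝ] TangentSpace I x →L[ℝ] ℝ

/-- Fields of endomorphisms of the tangent spaces, not necessarily smooth. -/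
abbrev EndField (M : Type*) [TopologicalSpace M] [ChartedSpace H M] :=
  ∀ x : M, TangentSpace I x →L[ℝ] TangentSpace I x

/-- One-forms, not necessarily smooth. -/
abbrev OneForm (M : Type*) [TopologicalSpace M] [ChartedSpace H M] :=
  ∀ x : M, TangentSpace I x →L[ℝ] ℝ

/-- `g` is a smooth Riemannian metric. -/
structure IsRiemannianMetric [IsManifold I ∞ M] (g : TwoTensor I M) : Prop where
  smooth : ContMDiff I (I.prod 𝓘(ℝ, E →L[ℝ] E →L[ℝ] ℝ)) ∞
    (fun x ↦ Bundle.TotalSpace.mk' (E →L[ℝ] E →L[ℝ] ℝ)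
      (E := fun x : M ↦ TangentSpace I x →L[ℝ] TangentSpace I x →L[ℝ] ℝ) x (g x))
  symm : ∀ (x : M) (v w : TangentSpace I x), g x v w = g x w v
  pos : ∀ (x : M) (v : TangentSpace I x), v ≠ 0 → 0 < g x v v

/-- `∇` is the Levi-Civita connection of `g`: it is smooth, torsion free and metric. Recall that
`∇ Y x v` is the derivative of the vector field `Y` at `x` in the direction `v`. -/
structure IsLeviCivita [FiniteDimensional ℝ E] [IsManifold I ∞ M]
    (g : TwoTensor I M)
    (cov : CovariantDerivative I E (TangentSpace I : M → Type _)) : Prop where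
  smooth : cov.ContMDiffCovariantDerivative ∞
  torsion_eq_zero : cov.torsion = 0
  metric : ∀ (x : M) (Y Z : ∀ x : M, TangentSpace I x),
    MDifferentiableAt I I.tangent (T% Y) x → MDifferentiableAt I I.tangent (T% Z) x →
    ∀ v : TangentSpace I x,
      mvfderiv I (fun z ↦ g z (Y z) (Z z)) x v = g x (cov Y x v) (Z x) + g x (Y x) (cov Z x v)

/-- The field of endomorphisms `J` is parallel: `∇_v (J Y) = J (∇_v Y)`. -/
def IsParallelEnd [IsManifold I ∞ M] (cov : CovariantDerivative I E (TangentSpace I : M → Type _))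
    (J : EndField I M) : Prop :=
  ∀ (x : M) (Y : ∀ x : M, TangentSpace I x), MDifferentiableAt I I.tangent (T% Y) x →
    ∀ v : TangentSpace I x, cov (fun z ↦ J z (Y z)) x v = J x (cov Y x v)

/-- `J` is a smooth almost complex structure and `g` is a Riemannian metric that is Hermitian
for `J`. -/
structure IsAlmostHermitian [IsManifold I ∞ M] (g : TwoTensor I M) (J : EndField I M) : Prop where
  metric : IsRiemannianMetric I g
  smooth : ContMDiff I (I.prod 𝓘(ℝ, E →L[ℝ] E)) ∞
    (fun x ↦ Bundle.TotalSpace.mk' (E →L[ℝ] E)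
      (E := fun x : M ↦ TangentSpace I x →L[ℝ] TangentSpace I x) x (J x))
  sq : ∀ (x : M) (v : TangentSpace I x), J x (J x v) = -v
  compat : ∀ (x : M) (v w : TangentSpace I x), g x (J x v) (J x w) = g x v w

/-- `(g, J)` is a Kähler structure: it is almost Hermitian and `J` is parallel for the Levi-Civita
connection of `g`. -/
structure IsKahler [FiniteDimensional ℝ E] [IsManifold I ∞ M]
    (g : TwoTensor I M) (J : EndField I M) : Prop extends IsAlmostHermitian I g J where
  parallel : ∃ cov : CovariantDerivative I E (TangentSpace I : M → Type _),
    IsLeviCivita I g cov ∧ IsParallelEnd I cov J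

/-- The Kähler form `Ω(v, w) = g(J v, w)`. -/
noncomputable def kahlerForm (g : TwoTensor I M) (J : EndField I M) (x : M) (v w : TangentSpace I x) : ℝ :=
  g x (J x v) w

/-- The gradient of `τ` for the metric `g`, i.e. `g(∇τ, w) = dτ(w)`. -/
noncomputable def gradField (g : TwoTensor I M) (τ : M → ℝ) (x : M) : TangentSpace I x :=
  (g x).inverse (mvfderiv I τ x)

/-- The curvature `R(X, Y) Z = ∇_X ∇_Y Z - ∇_Y ∇_X Z - ∇_[X, Y] Z`. -/
noncomputable def curvatureField [IsManifold I ∞ M]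
    (cov : CovariantDerivative I E (TangentSpace I : M → Type _))
    (X Y Z : ∀ x : M, TangentSpace I x) (x : M) : TangentSpace I x :=
  cov (fun z ↦ cov Z z (Y z)) x (X x) - cov (fun z ↦ cov Z z (X z)) x (Y x)
    - cov Z x (VectorField.mlieBracket I X Y x)

/-- The curvature `R(u, v) w` on tangent vectors at `x`; as it is tensorial, it may be computed
on any vector fields with values `u`, `v`, `w` at `x` that are smooth near `x`. -/
noncomputable def curvatureAt [IsManifold I ∞ M]
    (cov : CovariantDerivative I E (TangentSpace I : M → Type _)) (x : M)
    (u v w : TangentSpace I x) : TangentSpace I x :=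
  curvatureField I cov (FiberBundle.extend E u) (FiberBundle.extend E v) (FiberBundle.extend E w) x

/-- The Ricci tensor `ρ(v, w)`, the trace of `u ↦ R(u, v) w`, computed in a basis. -/
noncomputable def ricci [FiniteDimensional ℝ E] [IsManifold I ∞ M]
    (cov : CovariantDerivative I E (TangentSpace I : M → Type _)) (x : M)
    (v w : TangentSpace I x) : ℝ :=
  let b : Module.Basis (Fin (Module.finrank ℝ E)) ℝ (TangentSpace I x) := Module.finBasis ℝ E
  ∑ i, b.repr (curvatureAt I cov x (b i) v w) i

/-- `X` is a (smooth) Killing vector field: `L_X g = 0`. -/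
structure IsKilling [IsManifold I ∞ M] (g : TwoTensor I M) (X : ∀ x : M, TangentSpace I x) :
    Prop where
  smooth : ContMDiff I I.tangent ∞ (T% X)
  lie : ∀ (x : M) (Y Z : ∀ x : M, TangentSpace I x),
    MDifferentiableAt I I.tangent (T% Y) x → MDifferentiableAt I I.tangent (T% Z) x →
      mvfderiv I (fun z ↦ g z (Y z) (Z z)) x (X x) =
        g x (VectorField.mlieBracket I X Y x) (Z x) + g x (Y x) (VectorField.mlieBracket I X Z x)

/-- `τ` is a special Kähler potential for `(g, J)`, where `∇` is the Levi-Civita connection of `g`: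
`τ` is smooth and not constant, `X = J ∇τ` is a Killing field, and where `dτ ≠ 0` all vectors
orthogonal to `X` and `J X` are eigenvectors of the Hessian `∇dτ(v, w) = g(∇_v ∇τ, w)`. -/
structure IsSpecialKahlerPotential [IsManifold I ∞ M] (g : TwoTensor I M) (J : EndField I M)
    (cov : CovariantDerivative I E (TangentSpace I : M → Type _)) (τ : M → ℝ) : Prop where
  smooth : ContMDiff I 𝓘(ℝ, ℝ) ∞ τ
  nonconstant : ¬ ∃ c : ℝ, ∀ x, τ x = c
  killing : IsKilling I g (fun x ↦ J x (gradField I g τ x))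
  hessian : ∀ x, mvfderiv I τ x ≠ 0 → ∀ v : TangentSpace I x,
    g x v (J x (gradField I g τ x)) = 0 → g x v (J x (J x (gradField I g τ x))) = 0 →
      ∃ μ : ℝ, ∀ w : TangentSpace I x, g x (cov (gradField I g τ) x v) w = μ * g x v w

/-- The distribution `D` is totally geodesic: `∇_Y Z` is a section of `D` for all local sections
`Y`, `Z` of `D`. -/
def IsTotallyGeodesic [IsManifold I ∞ M]
    (cov : CovariantDerivative I E (TangentSpace I : M → Type _))
    (D : ∀ x : M, Submodule ℝ (TangentSpace I x)) : Prop :=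
  ∀ (x : M) (Z : ∀ x : M, TangentSpace I x), MDifferentiableAt I I.tangent (T% Z) x →
    (∀ᶠ z in 𝓝 x, Z z ∈ D z) → ∀ v ∈ D x, cov Z x v ∈ D x

/-- `β` is the exterior derivative of the one-form `θ`, with the convention
`dθ(X, Y) = X(θ(Y)) - Y(θ(X)) - θ([X, Y])`. -/
def IsExteriorDerivative [IsManifold I ∞ M] (θ : OneForm I M)
    (β : ∀ x : M, TangentSpace I x → TangentSpace I x → ℝ) : Prop :=
  ∀ (x : M) (X Y : ∀ x : M, TangentSpace I x),
    MDifferentiableAt I I.tangent (T% X) x → MDifferentiableAt I I.tangent (T% Y) x →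
      mvfderiv I (fun z ↦ θ z (Y z)) x (X x) - mvfderiv I (fun z ↦ θ z (X z)) x (Y x)
        - θ x (VectorField.mlieBracket I X Y x) = β x (X x) (Y x)

end Geometry

/-! ### Circle bundles and the metric on `(0, L) × P` -/

section Bundles

variable {F : Type*} [NormedAddCommGroup F] [NormedSpace ℝ F]
  {N : Type*} [TopologicalSpace N] [ChartedSpace F N]
  {G : Type*} [NormedAddCommGroup G] [NormedSpace ℝ G]
  {P : Type*} [TopologicalSpace P] [ChartedSpace G P] [MulAction Circle P]

/-- `p : P → N` is a smooth principal circle bundle. -/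
structure IsPrincipalCircleBundle (p : P → N) : Prop where
  smooth_action : ContMDiff ((𝓡 1).prod 𝓘(ℝ, G)) 𝓘(ℝ, G) ∞ (fun q : Circle × P ↦ q.1 • q.2)
  smooth_proj : ContMDiff 𝓘(ℝ, G) 𝓘(ℝ, F) ∞ p
  proj_smul : ∀ (z : Circle) (y : P), p (z • y) = p y
  trivial_nhds : ∀ x : N, ∃ (U : Set N) (e : OpenPartialHomeomorph P (N × Circle)),
    IsOpen U ∧ x ∈ U ∧ e.source = p ⁻¹' U ∧ e.target = U ×ˢ Set.univ ∧
    ContMDiffOn 𝓘(ℝ, G) (𝓘(ℝ, F).prod (𝓡 1)) ∞ e e.source ∧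
    ContMDiffOn (𝓘(ℝ, F).prod (𝓡 1)) 𝓘(ℝ, G) ∞ e.symm e.target ∧
    (∀ y ∈ e.source, (e y).1 = p y) ∧
    ∀ y ∈ e.source, ∀ z : Circle, (e (z • y)).2 = z * (e y).2

variable (G) in
/-- The fundamental vector field `ξ` of the circle action, whose flow is `y ↦ exp(i t) • y`. -/
noncomputable def fundamentalField (y : P) : TangentSpace 𝓘(ℝ, G) y :=
  mfderiv 𝓘(ℝ, ℝ) 𝓘(ℝ, G) (fun t : ℝ ↦ Circle.exp t • y) 0 (1 : ℝ)

/-- `θ` is a connection form: a smooth circle-invariant one-form on `P` with `θ(ξ) = 1`. -/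
structure IsConnectionForm [IsManifold 𝓘(ℝ, G) ∞ P] (θ : OneForm 𝓘(ℝ, G) P) : Prop where
  smooth : ContMDiff 𝓘(ℝ, G) (𝓘(ℝ, G).prod 𝓘(ℝ, G →L[ℝ] ℝ)) ∞
    (fun y ↦ Bundle.TotalSpace.mk' (G →L[ℝ] ℝ)
      (E := fun y : P ↦ TangentSpace 𝓘(ℝ, G) y →L[ℝ] Bundle.Trivial P ℝ y) y (θ y))
  fundamental : ∀ y : P, θ y (fundamentalField G y) = 1
  invariant : ∀ (z : Circle) (y : P) (v : TangentSpace 𝓘(ℝ, G) y),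
    θ (z • y) (mfderiv 𝓘(ℝ, G) 𝓘(ℝ, G) (fun y : P ↦ z • y) y v) = θ y v

end Bundles

section Construction

variable {F : Type*} [NormedAddCommGroup F] [NormedSpace ℝ F]
  {N : Type*} [TopologicalSpace N] [ChartedSpace F N]
  {G : Type*} [NormedAddCommGroup G] [NormedSpace ℝ G]
  {P : Type*} [TopologicalSpace P] [ChartedSpace G P]

/-- The horizontal lift at `y ∈ P` of tangent vectors of `N` at `p y`: the inverse of the
isomorphism `v ↦ (p_* v, θ v)`, applied to `(u, 0)`. -/
noncomputable def horizontalLift (p : P → N) (θ : OneForm 𝓘(ℝ, G) P) (y : P) :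
    TangentSpace 𝓘(ℝ, F) (p y) →L[ℝ] TangentSpace 𝓘(ℝ, G) y :=
  ((mfderiv 𝓘(ℝ, G) 𝓘(ℝ, F) p y).prod (θ y)).inverse ∘L
    ContinuousLinearMap.inl ℝ (TangentSpace 𝓘(ℝ, F) (p y)) ℝ

/-- The open interval `(0, L)`, as an open submanifold of `ℝ`. -/
def openInterval (L : ℝ) : TopologicalSpace.Opens ℝ := ⟨Set.Ioo 0 L, isOpen_Ioo⟩

/-- The manifold `(0, L) × P`. -/
abbrev IntervalProd (P : Type*) [TopologicalSpace P] (L : ℝ) := openInterval L × P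

/-- The model with corners of `(0, L) × P`. -/
noncomputable abbrev totalModel (G : Type*) [NormedAddCommGroup G] [NormedSpace ℝ G] :
    ModelWithCorners ℝ (ℝ × G) (ModelProd ℝ G) := 𝓘(ℝ, ℝ).prod 𝓘(ℝ, G)

variable (G P) in
/-- The one-form `dt` on `(0, L) × P`. -/
noncomputable def dtForm (L : ℝ) : OneForm (totalModel G) (IntervalProd P L) :=
  mvfderiv (totalModel G) (fun x : IntervalProd P L ↦ (x.1 : ℝ))

/-- The differential of the projection `(0, L) × P → P`. -/
noncomputable def dSnd (L : ℝ) (x : IntervalProd P L) :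
    TangentSpace (totalModel G) x →L[ℝ] TangentSpace 𝓘(ℝ, G) x.2 :=
  mfderiv (totalModel G) 𝓘(ℝ, G) (Prod.snd : IntervalProd P L → P) x

/-- The pull back of the one-form `θ` to `(0, L) × P`. -/
noncomputable def pullForm (θ : OneForm 𝓘(ℝ, G) P) (L : ℝ) : OneForm (totalModel G) (IntervalProd P L) :=
  fun x ↦ θ x.2 ∘L dSnd L x

/-- The differential of the projection `(0, L) × P → N`. -/
noncomputable def dProj (p : P → N) (L : ℝ) (x : IntervalProd P L) :
    TangentSpace (totalModel G) x →L[ℝ] TangentSpace 𝓘(ℝ, F) (p x.2) :=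
  mfderiv 𝓘(ℝ, G) 𝓘(ℝ, F) p x.2 ∘L dSnd L x

/-- The vector field `H = d/dt` on `(0, L) × P`. -/
noncomputable def fieldH (L : ℝ) (x : IntervalProd P L) : TangentSpace (totalModel G) x := ((1, 0) : ℝ × G)

/-- The inclusion of tangent vectors of `P` in the tangent spaces of `(0, L) × P`, as vectors
tangent to the slices `{t} × P`. -/
noncomputable def inclP (L : ℝ) (x : IntervalProd P L) :
    TangentSpace 𝓘(ℝ, G) x.2 →L[ℝ] TangentSpace (totalModel G) x :=
  mfderiv 𝓘(ℝ, G) (totalModel G) (fun y : P ↦ ((x.1, y) : IntervalProd P L)) x.2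

/-- The metric `g = dt² + f(t)² θ² + r(t)² p^* h` on `(0, L) × P`. -/
noncomputable def bundleMetric (p : P → N) (θ : OneForm 𝓘(ℝ, G) P) (h : TwoTensor 𝓘(ℝ, F) N)
    (L : ℝ) (f r : ℝ → ℝ) : TwoTensor (totalModel G) (IntervalProd P L) := fun x ↦
  (dtForm G P L x).smulRight (dtForm G P L x)
    + (f x.1) ^ 2 • (pullForm θ L x).smulRight (pullForm θ L x)
    + (r x.1) ^ 2 • (ContinuousLinearMap.precomp ℝ (dProj p L x) ∘L h (p x.2) ∘L dProj p L x)

variable [MulAction Circle P]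

/-- The fundamental vector field `ξ` of the circle action, on `(0, L) × P`. -/
noncomputable def fieldXi (L : ℝ) (x : IntervalProd P L) : TangentSpace (totalModel G) x :=
  inclP L x (fundamentalField G x.2)

/-- The almost complex structure on `(0, L) × P` with `J H = ξ / f` and `J X = (J_N X_*)^*` for
the horizontal lift `X` of `X_*`; thus `J ξ = - f H`. In terms of the decomposition
`v = dt(v) H + θ(v) ξ + (p_* v)^*`. -/
noncomputable def bundleJ (p : P → N) (θ : OneForm 𝓘(ℝ, G) P) (JN : EndField 𝓘(ℝ, F) N)
    (L : ℝ) (f : ℝ → ℝ) : EndField (totalModel G) (IntervalProd P L) := fun x ↦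
  (dtForm G P L x).smulRight ((1 / f x.1) • fieldXi L x)
    - (pullForm θ L x).smulRight (f x.1 • fieldH L x)
    + inclP L x ∘L horizontalLift p θ x.2 ∘L JN (p x.2) ∘L dProj p L x

variable (G P) in
/-- The distribution `Δ` spanned by `H` and `ξ`; it is tangent to the fibres of
`(0, L) × P → N`. -/
noncomputable def distributionDelta (L : ℝ) (x : IntervalProd P L) :
    Submodule ℝ (TangentSpace (totalModel G) x) :=
  Submodule.span ℝ {fieldH L x, fieldXi L x}

end Construction

/-! ### Lie brackets as commutators of derivations, and related vector fields -/

section Calculus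

variable {E : Type*} [NormedAddCommGroup E] [NormedSpace ℝ E]
  {H : Type*} [TopologicalSpace H] {I : ModelWithCorners ℝ E H}
  {M : Type*} [TopologicalSpace M] [ChartedSpace H M]
open VectorField
variable {F' : Type*} [NormedAddCommGroup F'] [NormedSpace ℝ F']

/-! The theorem is a calculation with the Levi-Civita connection in the splitting of the tangent
spaces by `dt`, `θ` and `dp`. All that it uses is isolated in `IsCalabiType`: a function `t`, a
one-form `Θ` with `dΘ = s q^*Ω` and a map `q` to a Kähler manifold, such that `(dt, Θ, dq)` is an
isomorphism on every tangent space. A vector is determined by these three components, and tensorial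
identities may be tested on the adapted fields `field a b X`, which have constant `dt` and `Θ`
components and are `q`-related to a field `X` on `N`. The bracket of two of them has components `0`,
`-s Ω(X, X')` and `[X, X']` (`mlieBracket_field`), so the Koszul formula yields `∇` explicitly
(`metric_cov_field`).

For horizontal vectors the `dt` component of `∇` is `-r r' h` and the `Θ` component is `-(s/2) Ω`.
As `J` exchanges the two up to the factor `f`, parallelism of `J` forces `f s = 2 r r'`; conversely
this equation and `∇J_N = 0` match all components (`isKahler_iff`).

Write `T = d/dt` and let `K` be the vertical field dual to `Θ`. Then `∇_v T = (f'/f) Θ(v) K + (r'/r)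
v^hor`, so `R(u, w) T` is found without the curvature of `N` (`curvatureAt_fieldT`). Taking the
trace and using `tr J_N = 0`, `ρ(w, T)` is a multiple of `dt(w)`. Since `J` is parallel, `R(u, w) K
= f J R(u, w) T`, and `ρ(w, K)` is a multiple of `Θ(w)`. With `n = dim N` the eigenvalues are
`-(f''/f + n r''/r)` and `-(f''/f + n (r'/r)(f'/f - r'/r))`, which agree by the derivative of `f s =
2 r r'`. Finally `d(r²/s) = f dt`, so `r²/s` has gradient `f T`, which `J` maps to `K = ξ`; `∇K` is
skew, and the Hessian is `f r'/r` times `g` on horizontal vectors.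

The foundations are the existence of the Levi-Civita connection, the symmetries of its curvature,
and the fact that `ξ` spans the kernel of `dp`. -/

theorem fderiv_lieBracket {f : E → F'} {V W : E → E} {x : E} (hf : ContDiffAt ℝ 2 f x)
    (hV : DifferentiableAt ℝ V x) (hW : DifferentiableAt ℝ W x) :
    fderiv ℝ f x (lieBracket ℝ V W x) =
      fderiv ℝ (fun z ↦ fderiv ℝ f z (W z)) x (V x)
        - fderiv ℝ (fun z ↦ fderiv ℝ f z (V z)) x (W x) := by
  have hd : DifferentiableAt ℝ (fderiv ℝ f) x :=
    (hf.fderiv_right (m := 1) (by norm_num)).differentiableAt (by norm_num)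
  -- Symmetry of the second derivative of `f` cancels everything except the terms with the
  -- derivatives of `V` and `W`, which form the bracket.
  have hs : IsSymmSndFDerivAt ℝ f x := hf.isSymmSndFDerivAt (by simp)
  rw [fderiv_clm_apply hd hW, fderiv_clm_apply hd hV]
  simp [lieBracket, hs.eq (V x) (W x)]

section Boundaryless

variable [I.Boundaryless]

theorem fderiv_comp_extChartAt_symm [IsManifold I ∞ M] {x : M} {y : E} (hy : y ∈ (extChartAt I x).target)
    {k : M → F'} (hk : MDifferentiableAt I 𝓘(ℝ, F') k ((extChartAt I x).symm y)) (w : E) :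
    fderiv ℝ (k ∘ (extChartAt I x).symm) y w =
      mvfderiv I k ((extChartAt I x).symm y)
        (mfderivWithin 𝓘(ℝ, E) I (extChartAt I x).symm (Set.range I) y w) := by
  have h1 : MDifferentiableAt 𝓘(ℝ, E) I (extChartAt I x).symm y := by
    have := mdifferentiableWithinAt_extChartAt_symm (I := I) hy
    rwa [I.range_eq_univ, mdifferentiableWithinAt_univ] at this
  rw [I.range_eq_univ, mfderivWithin_univ, ← mfderiv_eq_fderiv, mfderiv_comp y hk h1]
  rfl

theorem mvfderiv_eq_fderiv_comp_extChartAt_symm (x : M)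
    {k : M → F'} (hk : MDifferentiableAt I 𝓘(ℝ, F') k x) (v : TangentSpace I x) :
    mvfderiv I k x v =
      fderiv ℝ (k ∘ (extChartAt I x).symm) (extChartAt I x x) (show E from v) := by
  have h : mfderiv I 𝓘(ℝ, F') k x =
      fderiv ℝ (k ∘ (extChartAt I x).symm) (extChartAt I x x) := by
    rw [hk.mfderiv, I.range_eq_univ, fderivWithin_univ]; rfl
  exact congrArg (fun A : E →L[ℝ] F' ↦ A v) h

variable [CompleteSpace E] [IsManifold I ∞ M]

/-- The fields are pulled back to the chart at `x`, where `fderiv_lieBracket` applies; the chart and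
its inverse have derivative the identity at the base point, so nothing is transported there. Vector
values are allowed so that `f` may itself be a chart. -/
theorem mvfderiv_mlieBracket {f : M → F'} {X Y : ∀ x : M, TangentSpace I x} {x : M}
    (hf : ContMDiffAt I 𝓘(ℝ, F') 2 f x)
    (hX : MDifferentiableAt I I.tangent (T% X) x) (hY : MDifferentiableAt I I.tangent (T% Y) x) :
    mvfderiv I f x (mlieBracket I X Y x) =
      mvfderiv I (fun z ↦ mvfderiv I f z (Y z)) x (X x)
        - mvfderiv I (fun z ↦ mvfderiv I f z (X z)) x (Y x) := by
  set φ := extChartAt I x with hφ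
  let pull (X : ∀ x : M, TangentSpace I x) : E → E :=
    mpullbackWithin 𝓘(ℝ, E) I φ.symm X (Set.range I)
  have hpull {X : ∀ x : M, TangentSpace I x} (hX : MDifferentiableAt I I.tangent (T% X) x) :
      DifferentiableAt ℝ (pull X) (φ x) := by
    have : DifferentiableWithinAt ℝ (pull X) (φ.symm ⁻¹' Set.univ ∩ Set.range I) (φ x) :=
      (mdifferentiableWithinAt_univ.2 hX).differentiableWithinAt_mpullbackWithin_vectorField
    rwa [Set.preimage_univ, Set.univ_inter, I.range_eq_univ, differentiableWithinAt_univ] at this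
  have hF : ContDiffAt ℝ 2 (f ∘ φ.symm) (φ x) := by
    have := (contMDiffAt_iff.1 hf).2
    rwa [I.range_eq_univ, contDiffWithinAt_univ] at this
  have hfd : ∀ᶠ z in 𝓝 x, MDifferentiableAt I 𝓘(ℝ, F') f z :=
    ((contMDiffAt_iff_contMDiffAt_nhds (by simp)).1 hf).mono fun z hz ↦ hz.mdifferentiableAt two_ne_zero
  have htarget : ∀ᶠ y in 𝓝 (φ x), y ∈ φ.target := extChartAt_target_mem_nhds x
  have hsymm : Filter.Tendsto φ.symm (𝓝 (φ x)) (𝓝 x) := by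
    have := (continuousAt_extChartAt_symm (I := I) x).tendsto
    rwa [extChartAt_to_inv] at this
  have hpull_eq (X : ∀ x : M, TangentSpace I x) : ∀ᶠ y in 𝓝 (φ x),
      mvfderiv I f (φ.symm y) (X (φ.symm y)) = fderiv ℝ (f ∘ φ.symm) y (pull X y) := by
    filter_upwards [htarget, hsymm.eventually hfd] with y hy hfy
    rw [fderiv_comp_extChartAt_symm hy hfy]
    congr 1
    exact ((isInvertible_mfderivWithin_extChartAt_symm hy).self_apply_inverse (X (φ.symm y))).symm
  have hpull_x (X : ∀ x : M, TangentSpace I x) : pull X (φ x) = X x := by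
    let A : E →L[ℝ] E := mfderivWithin 𝓘(ℝ, E) I φ.symm (Set.range I) (φ x)
    have h1 : A = ContinuousLinearMap.id ℝ E := mfderivWithin_range_extChartAt_symm
    have h2 : pull X (φ x) = A.inverse (show E from X (φ.symm (φ x))) := rfl
    rw [h2, h1, ContinuousLinearMap.inverse_id, hφ, extChartAt_to_inv]
    rfl
  have hdiff {X : ∀ x : M, TangentSpace I x} (hX : MDifferentiableAt I I.tangent (T% X) x) :
      DifferentiableAt ℝ (fun y ↦ fderiv ℝ (f ∘ φ.symm) y (pull X y)) (φ x) :=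
    ((hF.fderiv_right (m := 1) (by norm_num)).differentiableAt (by norm_num)).clm_apply (hpull hX)
  have hmdiff {X : ∀ x : M, TangentSpace I x} (hX : MDifferentiableAt I I.tangent (T% X) x) :
      MDifferentiableAt I 𝓘(ℝ, F') (fun z ↦ mvfderiv I f z (X z)) x := by
    have h1 := (hdiff hX).mdifferentiableAt.comp x (mdifferentiableAt_extChartAt (mem_chart_source H x))
    refine h1.congr_of_eventuallyEq ?_
    filter_upwards [(continuousAt_extChartAt (I := I) x).tendsto.eventually (hpull_eq X),
      extChartAt_source_mem_nhds (I := I) x] with z hz hzs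
    rw [φ.left_inv hzs] at hz
    exact hz
  have hder {X : ∀ x : M, TangentSpace I x} (hX : MDifferentiableAt I I.tangent (T% X) x)
      (v : TangentSpace I x) : mvfderiv I (fun z ↦ mvfderiv I f z (X z)) x v =
      fderiv ℝ (fun y ↦ fderiv ℝ (f ∘ φ.symm) y (pull X y)) (φ x) (show E from v) := by
    rw [mvfderiv_eq_fderiv_comp_extChartAt_symm x (hmdiff hX)]
    congr 1
    exact Filter.EventuallyEq.fderiv_eq (hpull_eq X)
  have hbr : mlieBracket I X Y x = lieBracket ℝ (pull X) (pull Y) (φ x) := by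
    let A : E →L[ℝ] E := mfderiv I 𝓘(ℝ, E) (extChartAt I x) x
    have h : A = ContinuousLinearMap.id ℝ E := mfderiv_extChartAt_self
    have h2 : mlieBracket I X Y x = A.inverse
        (lieBracketWithin ℝ (pull X) (pull Y) (φ.symm ⁻¹' Set.univ ∩ Set.range I) (φ x)) := rfl
    rw [h2, h, ContinuousLinearMap.inverse_id, Set.preimage_univ, I.range_eq_univ,
      Set.univ_inter, lieBracketWithin_univ]
    rfl
  rw [mvfderiv_eq_fderiv_comp_extChartAt_symm x hfd.self_of_nhds, hder hX, hder hY, hbr]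
  have := fderiv_lieBracket hF (hpull hX) (hpull hY)
  rw [hpull_x, hpull_x] at this
  exact this

end Boundaryless

variable {E' : Type*} [NormedAddCommGroup E'] [NormedSpace ℝ E']
  {H' : Type*} [TopologicalSpace H'] {I' : ModelWithCorners ℝ E' H'}
  {M' : Type*} [TopologicalSpace M'] [ChartedSpace H' M']

/-! ### Derivatives of maps along vector fields. -/

section Smooth

variable [IsManifold I ∞ M] [IsManifold I' ∞ M'] {q : M → M'} {X : ∀ x : M, TangentSpace I x} {x : M}

theorem ContMDiffAt.mfderiv_vectorField {n m : ℕ∞ω}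
    (hq : ContMDiffAt I I' n q x) (hX : ContMDiffAt I I.tangent m (T% X) x) (hmn : m + 1 ≤ n) :
    ContMDiffAt I I'.tangent m
      (fun z ↦ (⟨q z, mfderiv I I' q z (X z)⟩ : TangentBundle I' M')) x := by
  have := hq.mfderiv_const hmn
  exact ContMDiffAt.clm_apply_of_inCoordinates (b₁ := id) (b₂ := q) (ϕ := mfderiv I I' q) this hX
    (hq.of_le (le_trans le_self_add hmn))

theorem MDifferentiableAt.mfderiv_vectorField
    (hq : ContMDiffAt I I' 2 q x) (hX : MDifferentiableAt I I.tangent (T% X) x) :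
    MDifferentiableAt I I'.tangent
      (fun z ↦ (⟨q z, mfderiv I I' q z (X z)⟩ : TangentBundle I' M')) x := by
  have := (hq.mfderiv_const (m := 1) (by norm_num)).mdifferentiableAt one_ne_zero
  exact MDifferentiableAt.clm_apply_of_inCoordinates (b₁ := id) (b₂ := q) (ϕ := mfderiv I I' q)
    this hX (hq.mdifferentiableAt two_ne_zero)

theorem ContMDiffAt.mvfderiv_vectorField {f : M → F'} {n m : ℕ∞ω}
    (hf : ContMDiffAt I 𝓘(ℝ, F') n f x) (hX : ContMDiffAt I I.tangent m (T% X) x)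
    (hmn : m + 1 ≤ n) :
    ContMDiffAt I 𝓘(ℝ, F') m (fun z ↦ mvfderiv I f z (X z)) x := by
  have := hf.mfderiv_vectorField hX hmn
  exact (contMDiff_snd_tangentBundle_modelSpace F' 𝓘(ℝ, F')).contMDiffAt.comp x this

theorem MDifferentiableAt.mvfderiv_vectorField {f : M → F'}
    (hf : ContMDiffAt I 𝓘(ℝ, F') 2 f x) (hX : MDifferentiableAt I I.tangent (T% X) x) :
    MDifferentiableAt I 𝓘(ℝ, F') (fun z ↦ mvfderiv I f z (X z)) x := by
  have := hX.mfderiv_vectorField hf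
  exact ((contMDiff_snd_tangentBundle_modelSpace F' 𝓘(ℝ, F')).contMDiffAt.mdifferentiableAt
    one_ne_zero).comp x this

theorem ContMDiffAt.eventually_mdifferentiableAt {f : M → M'} {n : ℕ∞ω} (hn : 1 ≤ n)
    (hf : ContMDiffAt I I' n f x) : ∀ᶠ z in 𝓝 x, MDifferentiableAt I I' f z :=
  ((contMDiffAt_iff_contMDiffAt_nhds (by simp)).1 (hf.of_le hn)).mono
    fun _ hz ↦ hz.mdifferentiableAt one_ne_zero

theorem ContMDiffAt.eventually_mdifferentiableAt_section {n : ℕ∞ω} (hn : 1 ≤ n)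
    (hX : ContMDiffAt I I.tangent n (T% X) x) :
    ∀ᶠ z in 𝓝 x, MDifferentiableAt I I.tangent (T% X) z :=
  ((contMDiffAt_iff_contMDiffAt_nhds (by simp)).1 (hX.of_le hn)).mono
    fun _ hz ↦ hz.mdifferentiableAt one_ne_zero

end Smooth

theorem mvfderiv_comp_mfderiv {k : M' → F'} {q : M → M'} {x : M}
    (hk : MDifferentiableAt I' 𝓘(ℝ, F') k (q x)) (hq : MDifferentiableAt I I' q x)
    (v : TangentSpace I x) :
    mvfderiv I (k ∘ q) x v = mvfderiv I' k (q x) (mfderiv I I' q x v) := by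
  unfold mvfderiv
  rw [mfderiv_comp x hk hq]
  rfl

theorem mvfderiv_congr_of_eventuallyEq {f f' : M → F'} {x : M} (h : f =ᶠ[𝓝 x] f') :
    mvfderiv I f x = mvfderiv I f' x := by
  unfold mvfderiv
  rw [h.mfderiv_eq, h.self_of_nhds]

/-- Brackets of `q`-related vector fields are `q`-related. -/
theorem mfderiv_mlieBracket_of_related [I.Boundaryless] [I'.Boundaryless] [CompleteSpace E]
    [CompleteSpace E'] [IsManifold I ∞ M] [IsManifold I' ∞ M'] {q : M → M'} {x : M}
    {X Y : ∀ x : M, TangentSpace I x} {X' Y' : ∀ x : M', TangentSpace I' x}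
    (hq : ContMDiffAt I I' 2 q x)
    (hX : MDifferentiableAt I I.tangent (T% X) x) (hY : MDifferentiableAt I I.tangent (T% Y) x)
    (hX' : MDifferentiableAt I' I'.tangent (T% X') (q x))
    (hY' : MDifferentiableAt I' I'.tangent (T% Y') (q x))
    (hXX' : ∀ᶠ z in 𝓝 x, mfderiv I I' q z (X z) = X' (q z))
    (hYY' : ∀ᶠ z in 𝓝 x, mfderiv I I' q z (Y z) = Y' (q z)) :
    mfderiv I I' q x (mlieBracket I X Y x) = mlieBracket I' X' Y' (q x) := by
  -- A chart at `q x` has injective derivative there, so it suffices to compare the two brackets as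
  -- derivations of `φ`. Relatedness near `x` identifies the derivatives of `φ ∘ q` upstairs with
  -- those of `φ` downstairs.
  set φ := extChartAt I' (q x)
  have hφ : ContMDiffAt I' 𝓘(ℝ, E') 2 φ (q x) := contMDiffAt_extChartAt
  have hφd := ContMDiffAt.eventually_mdifferentiableAt (by norm_num) hφ
  have hqd := ContMDiffAt.eventually_mdifferentiableAt (by norm_num) hq
  have hinj : Function.Injective (mvfderiv I' φ (q x)) :=
    (isInvertible_mfderiv_extChartAt (mem_extChartAt_source (I := I') (q x))).injective
  apply hinj
  have hcomp {v : TangentSpace I x} {k : M' → E'} (hk : MDifferentiableAt I' 𝓘(ℝ, E') k (q x)) :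
      mvfderiv I (k ∘ q) x v = mvfderiv I' k (q x) (mfderiv I I' q x v) :=
    mvfderiv_comp_mfderiv hk hqd.self_of_nhds v
  have hdiff {Z : ∀ x : M, TangentSpace I x} {Z' : ∀ x : M', TangentSpace I' x}
      (hZ : ∀ᶠ z in 𝓝 x, mfderiv I I' q z (Z z) = Z' (q z)) :
      (fun z ↦ mvfderiv I (φ ∘ q) z (Z z)) =ᶠ[𝓝 x] (fun z ↦ mvfderiv I' φ z (Z' z)) ∘ q := by
    filter_upwards [hZ, hqd, hq.continuousAt.eventually hφd] with z hz hqz hφz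
    rw [mvfderiv_comp_mfderiv hφz hqz, hz, Function.comp_apply]
  rw [← hcomp hφd.self_of_nhds, mvfderiv_mlieBracket (hφ.comp x hq) hX hY,
    mvfderiv_mlieBracket hφ hX' hY', mvfderiv_congr_of_eventuallyEq (hdiff hXX'),
    mvfderiv_congr_of_eventuallyEq (hdiff hYY'),
    hcomp (hX'.mvfderiv_vectorField hφ), hcomp (hY'.mvfderiv_vectorField hφ),
    hXX'.self_of_nhds, hYY'.self_of_nhds]

end Calculus

/-! ### Smoothness of sections of bundles of homomorphisms -/

section HomBundle

variable {E : Type*} [NormedAddCommGroup E] [NormedSpace ℝ E] [FiniteDimensional ℝ E]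
  {H : Type*} [TopologicalSpace H] {I : ModelWithCorners ℝ E H}
  {M : Type*} [TopologicalSpace M] [ChartedSpace H M] [IsManifold I ∞ M]
  {F₁ : Type*} [NormedAddCommGroup F₁] [NormedSpace ℝ F₁]
  {V : M → Type*} [TopologicalSpace (Bundle.TotalSpace F₁ V)]
  [∀ x, AddCommGroup (V x)] [∀ x, Module ℝ (V x)] [∀ x, TopologicalSpace (V x)]
  [∀ x, IsTopologicalAddGroup (V x)] [∀ x, ContinuousSMul ℝ (V x)]
  [FiberBundle F₁ V] [VectorBundle ℝ F₁ V] [ContMDiffVectorBundle ∞ F₁ V I]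

open Bundle

omit [ContMDiffVectorBundle ∞ F₁ V I] in
-- Read in trivialisations, the operator is the finite sum of its values on a smooth local frame
-- against the dual basis. The criterion reduces smoothness of metrics, complex structures and
-- connections to smoothness of their values on smooth fields.
theorem contMDiffAt_hom_of_forall_apply {ϕ : ∀ x : M, TangentSpace I x →L[ℝ] V x} {x : M}
    (h : ∀ X : ∀ x : M, TangentSpace I x, ContMDiffAt I I.tangent ∞ (T% X) x →
      ContMDiffAt I (I.prod 𝓘(ℝ, F₁)) ∞ (fun z ↦ TotalSpace.mk' F₁ z (ϕ z (X z))) x) :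
    ContMDiffAt I (I.prod 𝓘(ℝ, E →L[ℝ] F₁)) ∞
      (fun z ↦ TotalSpace.mk' (E →L[ℝ] F₁) (E := fun z ↦ TangentSpace I z →L[ℝ] V z) z (ϕ z))
      x := by
  rw [contMDiffAt_hom_bundle]
  refine ⟨contMDiffAt_id, ?_⟩
  let e := trivializationAt E (TangentSpace I : M → Type _) x
  let e' := trivializationAt F₁ V x
  have hx : x ∈ e.baseSet := FiberBundle.mem_baseSet_trivializationAt' x
  have hx' : x ∈ e'.baseSet := FiberBundle.mem_baseSet_trivializationAt' x
  let b := Module.finBasis ℝ E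
  have hs (i) : ContMDiffAt I I.tangent ∞ (T% (e.localFrame b i)) x :=
    contMDiffAt_localFrame_of_mem ∞ e b i hx
  have h1 (i) : ContMDiffAt I 𝓘(ℝ, F₁) ∞
      (fun z ↦ (e' ⟨z, ϕ z (e.localFrame b i z)⟩).2) x := by
    have := h _ (hs i)
    rw [contMDiffAt_section] at this
    exact this
  have h2 : ContMDiffAt I 𝓘(ℝ, E →L[ℝ] F₁) ∞ (fun z ↦ ∑ i,
      (b.coord i).toContinuousLinearMap.smulRight (e' ⟨z, ϕ z (e.localFrame b i z)⟩).2) x := by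
    refine contMDiffAt_finsetSum fun i _ ↦ ?_
    exact ((ContinuousLinearMap.smulRightL ℝ E F₁
      (b.coord i).toContinuousLinearMap).contDiff.contMDiff).contMDiffAt.comp x (h1 i)
  refine h2.congr_of_eventuallyEq ?_
  filter_upwards [e.open_baseSet.mem_nhds hx, e'.open_baseSet.mem_nhds hx'] with z hz hz'
  refine ContinuousLinearMap.coe_injective (b.ext fun j ↦ ?_)
  change ContinuousLinearMap.inCoordinates E (TangentSpace I) F₁ V x z x z (ϕ z) (b j) = _
  rw [ContinuousLinearMap.inCoordinates_eq hz hz']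
  simp [Finsupp.single_apply, Trivialization.localFrame_apply_of_mem_baseSet, hz]
  rfl

omit [ContMDiffVectorBundle ∞ F₁ V I] in
-- Inversion is smooth at an invertible operator, and `Y` is the inverse of `ϕ` applied to `ϕ Y`.
theorem contMDiffAt_of_hom_apply {ϕ : ∀ x : M, TangentSpace I x →L[ℝ] V x} {x : M}
    {Y : ∀ x : M, TangentSpace I x}
    (hϕ : ContMDiffAt I (I.prod 𝓘(ℝ, E →L[ℝ] F₁)) ∞
      (fun z ↦ TotalSpace.mk' (E →L[ℝ] F₁) (E := fun z ↦ TangentSpace I z →L[ℝ] V z) z (ϕ z)) x)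
    (hinj : Function.Bijective (ϕ x))
    (hY : ContMDiffAt I (I.prod 𝓘(ℝ, F₁)) ∞ (fun z ↦ TotalSpace.mk' F₁ z (ϕ z (Y z))) x) :
    ContMDiffAt I I.tangent ∞ (T% Y) x := by
  rw [contMDiffAt_hom_bundle] at hϕ
  rw [contMDiffAt_section] at hY ⊢
  replace hϕ := hϕ.2
  let e := trivializationAt E (TangentSpace I : M → Type _) x
  let e' := trivializationAt F₁ V x
  have hx : x ∈ e.baseSet := FiberBundle.mem_baseSet_trivializationAt' x
  have hx' : x ∈ e'.baseSet := FiberBundle.mem_baseSet_trivializationAt' x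
  let T : M → E →L[ℝ] F₁ := fun z ↦
    ContinuousLinearMap.inCoordinates E (TangentSpace I) F₁ V x z x z (ϕ z)
  have hT (z : M) (hz : z ∈ e.baseSet) (hz' : z ∈ e'.baseSet) (v : TangentSpace I z) :
      T z (e ⟨z, v⟩).2 = (e' ⟨z, ϕ z v⟩).2 := by
    change ContinuousLinearMap.inCoordinates E (TangentSpace I) F₁ V x z x z (ϕ z) _ = _
    rw [ContinuousLinearMap.inCoordinates_eq hz hz']
    simp only [ContinuousLinearMap.comp_apply, ContinuousLinearEquiv.coe_coe]
    have h1 : (e.continuousLinearEquivAt ℝ z hz).symm (e ⟨z, v⟩).2 = v :=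
      (e.continuousLinearEquivAt ℝ z hz).symm_apply_apply v
    rw [h1]
    rfl
  obtain ⟨T₀, hT₀⟩ : ∃ T₀ : E ≃L[ℝ] F₁, (T₀ : E →L[ℝ] F₁) = T x := by
    have hb : Function.Bijective (T x) := by
      change Function.Bijective
        (ContinuousLinearMap.inCoordinates E (TangentSpace I) F₁ V x x x x (ϕ x))
      rw [ContinuousLinearMap.inCoordinates_eq hx hx']
      exact ((e'.continuousLinearEquivAt ℝ x hx').bijective.comp hinj).comp
        (e.continuousLinearEquivAt ℝ x hx).symm.bijective
    let l := LinearEquiv.ofBijective (T x : E →ₗ[ℝ] F₁) hb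
    have := l.finiteDimensional
    exact ⟨l.toContinuousLinearEquiv, rfl⟩
  have hinv : ContMDiffAt I 𝓘(ℝ, F₁ →L[ℝ] E) ∞ (fun z ↦ (T z).inverse) x := by
    have := contDiffAt_map_inverse (n := ∞) T₀
    rw [hT₀] at this
    exact this.contMDiffAt.comp x hϕ
  refine (hinv.clm_apply hY).congr_of_eventuallyEq ?_
  -- Invertibility is an open condition, so near `x` the map `inverse` is a true inverse and not its
  -- default value `0`.
  have hnhds : ∀ᶠ z in 𝓝 x, T z ∈ Set.range ((↑) : (E ≃L[ℝ] F₁) → E →L[ℝ] F₁) := by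
    have := ContinuousLinearEquiv.nhds T₀
    rw [hT₀] at this
    exact hϕ.continuousAt this
  filter_upwards [hnhds, e.open_baseSet.mem_nhds hx, e'.open_baseSet.mem_nhds hx']
    with z ⟨T₁, hT₁⟩ hz hz'
  rw [← hT z hz hz', ← hT₁, ContinuousLinearMap.inverse_equiv]
  exact (T₁.symm_apply_apply _).symm

omit [FiniteDimensional ℝ E] in
theorem contMDiffAt_oneForm_apply {α : OneForm I M} {X : ∀ x : M, TangentSpace I x} {x : M} {n : ℕ∞ω}
    (hα : ContMDiffAt I (I.prod 𝓘(ℝ, E →L[ℝ] ℝ)) n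
      (fun y ↦ Bundle.TotalSpace.mk' (E →L[ℝ] ℝ)
      (E := fun y : M ↦ TangentSpace I y →L[ℝ] Bundle.Trivial M ℝ y) y (α y)) x)
    (hX : ContMDiffAt I I.tangent n (T% X) x) :
    ContMDiffAt I 𝓘(ℝ, ℝ) n (fun z ↦ α z (X z)) x := by
  have : ContMDiffAt I (I.prod 𝓘(ℝ)) n
      (fun z ↦ TotalSpace.mk' ℝ (E := Bundle.Trivial M ℝ) z (α z (X z))) x :=
    ContMDiffAt.clm_bundle_apply (F₁ := E) (E₁ := TangentSpace I) hα hX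
  rw [contMDiffAt_totalSpace] at this
  exact this.2

omit [FiniteDimensional ℝ E] in
theorem IsRiemannianMetric.eq_of_forall {g : TwoTensor I M} (hg : IsRiemannianMetric I g) {x : M}
    {v w : TangentSpace I x} (h : ∀ u, g x v u = g x w u) : v = w := by
  by_contra hne
  have := hg.pos x (v - w) (sub_ne_zero.2 hne)
  have h' : g x (v - w) = g x v - g x w := map_sub _ v w
  rw [h', sub_apply, h, sub_self] at this
  exact this.false

theorem IsRiemannianMetric.bijective {g : TwoTensor I M} (hg : IsRiemannianMetric I g) (x : M) :
    Function.Bijective (g x) := by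
  have hfin : FiniteDimensional ℝ (TangentSpace I x) := inferInstanceAs (FiniteDimensional ℝ E)
  have hinj : Function.Injective (g x) := fun v w h ↦
    hg.eq_of_forall fun u ↦ congrArg (fun A : TangentSpace I x →L[ℝ] ℝ ↦ A u) h
  refine ⟨hinj, ?_⟩
  have hd : Module.finrank ℝ (TangentSpace I x) =
      Module.finrank ℝ (TangentSpace I x →L[ℝ] ℝ) := by
    have h1 : Module.finrank ℝ (E →ₗ[ℝ] ℝ) = Module.finrank ℝ E := Subspace.dual_finrank_eq
    have h2 := (LinearMap.toContinuousLinearMap (𝕜 := ℝ) (E := E) (F' := ℝ)).finrank_eq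
    exact (h2.symm.trans h1).symm
  have hfin' : FiniteDimensional ℝ (TangentSpace I x →L[ℝ] ℝ) :=
    inferInstanceAs (FiniteDimensional ℝ (E →L[ℝ] ℝ))
  exact (LinearMap.injective_iff_surjective_of_finrank_eq_finrank
    (f := (g x : TangentSpace I x →ₗ[ℝ] TangentSpace I x →L[ℝ] ℝ)) hd).1 hinj

/-- `inverse` is `0` off the invertible maps; positivity and finite dimension make `g x` invertible,
so that gradients and Koszul duality have their usual meaning. -/
theorem IsRiemannianMetric.apply_inverse {g : TwoTensor I M} (hg : IsRiemannianMetric I g) (x : M)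
    (α : TangentSpace I x →L[ℝ] ℝ) : g x ((g x).inverse α) = α := by
  have hfin : FiniteDimensional ℝ (TangentSpace I x) := inferInstanceAs (FiniteDimensional ℝ E)
  have hfin' : FiniteDimensional ℝ (TangentSpace I x →L[ℝ] ℝ) :=
    inferInstanceAs (FiniteDimensional ℝ (E →L[ℝ] ℝ))
  have ht : T2Space (TangentSpace I x) := inferInstanceAs (T2Space E)
  have hinv : (g x).IsInvertible := ⟨(LinearEquiv.ofBijective
    (g x : TangentSpace I x →ₗ[ℝ] TangentSpace I x →L[ℝ] ℝ)
    (hg.bijective x)).toContinuousLinearEquiv, rfl⟩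
  exact hinv.self_apply_inverse α

theorem IsRiemannianMetric.apply_gradField {g : TwoTensor I M} (hg : IsRiemannianMetric I g)
    (τ : M → ℝ) (x : M) (w : TangentSpace I x) :
    g x (gradField I g τ x) w = mvfderiv I τ x w :=
  congrArg (fun A : TangentSpace I x →L[ℝ] ℝ ↦ A w) (hg.apply_inverse x _)

/-- A vector field is smooth as soon as its products with smooth vector fields are. -/
theorem IsRiemannianMetric.contMDiffAt_section {g : TwoTensor I M} (hg : IsRiemannianMetric I g)
    {Y : ∀ x : M, TangentSpace I x} {x : M}
    (h : ∀ X : ∀ x : M, TangentSpace I x, ContMDiffAt I I.tangent ∞ (T% X) x →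
      ContMDiffAt I 𝓘(ℝ, ℝ) ∞ (fun z ↦ g z (Y z) (X z)) x) :
    ContMDiffAt I I.tangent ∞ (T% Y) x := by
  refine contMDiffAt_of_hom_apply (F₁ := E →L[ℝ] ℝ)
    (V := fun x ↦ TangentSpace I x →L[ℝ] Bundle.Trivial M ℝ x) (hg.smooth x) ?_ ?_
  · exact hg.bijective x
  · refine contMDiffAt_hom_of_forall_apply (V := Bundle.Trivial M ℝ) fun X hX ↦ ?_
    rw [contMDiffAt_totalSpace]
    exact ⟨contMDiffAt_id, h X hX⟩

/-- A tensor field of type `(0,2)` is smooth as soon as its values on smooth vector fields are. -/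
theorem contMDiff_twoTensor_of_forall_apply {g : TwoTensor I M}
    (h : ∀ (x : M) (X Y : ∀ x : M, TangentSpace I x), ContMDiffAt I I.tangent ∞ (T% X) x →
      ContMDiffAt I I.tangent ∞ (T% Y) x →
      ContMDiffAt I 𝓘(ℝ, ℝ) ∞ (fun z ↦ g z (X z) (Y z)) x) :
    ContMDiff I (I.prod 𝓘(ℝ, E →L[ℝ] E →L[ℝ] ℝ)) ∞
    (fun x ↦ Bundle.TotalSpace.mk' (E →L[ℝ] E →L[ℝ] ℝ)
      (E := fun x : M ↦ TangentSpace I x →L[ℝ] TangentSpace I x →L[ℝ] ℝ) x (g x)) := by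
  intro x
  refine contMDiffAt_hom_of_forall_apply
    (V := fun x ↦ TangentSpace I x →L[ℝ] Bundle.Trivial M ℝ x) fun X hX ↦ ?_
  refine contMDiffAt_hom_of_forall_apply (V := Bundle.Trivial M ℝ) fun Y hY ↦ ?_
  rw [contMDiffAt_totalSpace]
  exact ⟨contMDiffAt_id, h x X Y hX hY⟩

omit [FiniteDimensional ℝ E] in
theorem IsRiemannianMetric.contMDiffAt_apply {g : TwoTensor I M} (hg : IsRiemannianMetric I g)
    {EM : Type*} [NormedAddCommGroup EM] [NormedSpace ℝ EM]
    {HM : Type*} [TopologicalSpace HM] {IM : ModelWithCorners ℝ EM HM}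
    {M' : Type*} [TopologicalSpace M'] [ChartedSpace HM M'] {b : M' → M} {y : M'}
    {v w : ∀ y, TangentSpace I (b y)} {n : ℕ∞ω} (hn : n ≤ ∞)
    (hv : ContMDiffAt IM I.tangent n (fun z ↦ (⟨b z, v z⟩ : TangentBundle I M)) y)
    (hw : ContMDiffAt IM I.tangent n (fun z ↦ (⟨b z, w z⟩ : TangentBundle I M)) y) :
    ContMDiffAt IM 𝓘(ℝ, ℝ) n (fun z ↦ g (b z) (v z) (w z)) y := by
  have hb : ContMDiffAt IM I n b y := (contMDiffAt_totalSpace.1 hv).1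
  have : ContMDiffAt IM (I.prod 𝓘(ℝ)) n
      (fun z ↦ TotalSpace.mk' ℝ (E := Bundle.Trivial M ℝ) (b z) (g (b z) (v z) (w z))) y := by
    apply ContMDiffAt.clm_bundle_apply₂ (F₁ := E) (F₂ := E)
    · exact ((hg.smooth (b y)).of_le hn).comp y hb
    · exact hv
    · exact hw
  rw [contMDiffAt_totalSpace] at this
  exact this.2

omit [FiniteDimensional ℝ E] in
theorem IsRiemannianMetric.mdifferentiableAt_apply {g : TwoTensor I M} (hg : IsRiemannianMetric I g)
    {EM : Type*} [NormedAddCommGroup EM] [NormedSpace ℝ EM]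
    {HM : Type*} [TopologicalSpace HM] {IM : ModelWithCorners ℝ EM HM}
    {M' : Type*} [TopologicalSpace M'] [ChartedSpace HM M'] {b : M' → M} {y : M'}
    {v w : ∀ y, TangentSpace I (b y)}
    (hv : MDifferentiableAt IM I.tangent (fun z ↦ (⟨b z, v z⟩ : TangentBundle I M)) y)
    (hw : MDifferentiableAt IM I.tangent (fun z ↦ (⟨b z, w z⟩ : TangentBundle I M)) y) :
    MDifferentiableAt IM 𝓘(ℝ, ℝ) (fun z ↦ g (b z) (v z) (w z)) y := by
  have hb : MDifferentiableAt IM I b y := ((mdifferentiableAt_totalSpace ..).1 hv).1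
  have : MDifferentiableAt IM (I.prod 𝓘(ℝ))
      (fun z ↦ TotalSpace.mk' ℝ (E := Bundle.Trivial M ℝ) (b z) (g (b z) (v z) (w z))) y := by
    apply MDifferentiableAt.clm_bundle_apply₂ (F₁ := E) (F₂ := E)
    · exact ((hg.smooth (b y)).mdifferentiableAt (by simp)).comp y hb
    · exact hv
    · exact hw
  rw [mdifferentiableAt_totalSpace] at this
  exact this.2

end HomBundle

/-! ### The Levi-Civita connection -/

section LeviCivita

variable {E : Type*} [NormedAddCommGroup E] [NormedSpace ℝ E] [FiniteDimensional ℝ E]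
  {H : Type*} [TopologicalSpace H] {I : ModelWithCorners ℝ E H}
  {M : Type*} [TopologicalSpace M] [ChartedSpace H M] [IsManifold I ∞ M]
  {g : TwoTensor I M} {X Y Z : ∀ x : M, TangentSpace I x} {x : M} {f : M → ℝ}

open Bundle VectorField

/-! ### Product rules for inner products of vector fields. -/

section MetricDeriv

omit [FiniteDimensional ℝ E]

theorem IsRiemannianMetric.mdifferentiableAt_section_apply (hg : IsRiemannianMetric I g)
    (hX : MDifferentiableAt I I.tangent (T% X) x) (hY : MDifferentiableAt I I.tangent (T% Y) x) :
    MDifferentiableAt I 𝓘(ℝ, ℝ) (fun z ↦ g z (X z) (Y z)) x :=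
  hg.mdifferentiableAt_apply (b := id) hX hY

theorem IsRiemannianMetric.contMDiffAt_section_apply (hg : IsRiemannianMetric I g)
    (hX : ContMDiffAt I I.tangent ∞ (T% X) x) (hY : ContMDiffAt I I.tangent ∞ (T% Y) x) :
    ContMDiffAt I 𝓘(ℝ, ℝ) ∞ (fun z ↦ g z (X z) (Y z)) x :=
  hg.contMDiffAt_apply (b := id) le_rfl hX hY

theorem IsRiemannianMetric.mvfderiv_smul_left (hg : IsRiemannianMetric I g)
    (hf : MDifferentiableAt I 𝓘(ℝ, ℝ) f x) (hX : MDifferentiableAt I I.tangent (T% X) x)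
    (hY : MDifferentiableAt I I.tangent (T% Y) x) (v : TangentSpace I x) :
    mvfderiv I (fun z ↦ g z ((f • X) z) (Y z)) x v =
      f x * mvfderiv I (fun z ↦ g z (X z) (Y z)) x v + mvfderiv I f x v * g x (X x) (Y x) := by
  have h : (fun z ↦ g z ((f • X) z) (Y z)) = fun z ↦ f z * g z (X z) (Y z) := by
    funext z
    simp
  rw [h, mvfderiv_fun_mul hf (hg.mdifferentiableAt_section_apply hX hY)]
  simp [mul_comm]

theorem IsRiemannianMetric.mvfderiv_smul_right (hg : IsRiemannianMetric I g)
    (hf : MDifferentiableAt I 𝓘(ℝ, ℝ) f x) (hX : MDifferentiableAt I I.tangent (T% X) x)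
    (hY : MDifferentiableAt I I.tangent (T% Y) x) (v : TangentSpace I x) :
    mvfderiv I (fun z ↦ g z (X z) ((f • Y) z)) x v =
      f x * mvfderiv I (fun z ↦ g z (X z) (Y z)) x v + mvfderiv I f x v * g x (X x) (Y x) := by
  simp only [hg.symm _ (X _)]
  exact hg.mvfderiv_smul_left hf hY hX v

theorem IsRiemannianMetric.mvfderiv_add_left (hg : IsRiemannianMetric I g)
    (hX : MDifferentiableAt I I.tangent (T% X) x) (hZ : MDifferentiableAt I I.tangent (T% Z) x)
    (hY : MDifferentiableAt I I.tangent (T% Y) x) (v : TangentSpace I x) :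
    mvfderiv I (fun z ↦ g z ((X + Z) z) (Y z)) x v =
      mvfderiv I (fun z ↦ g z (X z) (Y z)) x v + mvfderiv I (fun z ↦ g z (Z z) (Y z)) x v := by
  have h : (fun z ↦ g z ((X + Z) z) (Y z)) = fun z ↦ g z (X z) (Y z) + g z (Z z) (Y z) := by
    funext z
    simp
  rw [h, mvfderiv_fun_add (hg.mdifferentiableAt_section_apply hX hY)
    (hg.mdifferentiableAt_section_apply hZ hY)]
  rfl

theorem IsRiemannianMetric.mvfderiv_add_right (hg : IsRiemannianMetric I g)
    (hX : MDifferentiableAt I I.tangent (T% X) x) (hY : MDifferentiableAt I I.tangent (T% Y) x)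
    (hZ : MDifferentiableAt I I.tangent (T% Z) x) (v : TangentSpace I x) :
    mvfderiv I (fun z ↦ g z (X z) ((Y + Z) z)) x v =
      mvfderiv I (fun z ↦ g z (X z) (Y z)) x v + mvfderiv I (fun z ↦ g z (X z) (Z z)) x v := by
  simp only [hg.symm _ (X _)]
  exact hg.mvfderiv_add_left hY hZ hX v

end MetricDeriv

/-- The right-hand side of the Koszul formula for `2 g(∇_X Y, Z)`. -/
noncomputable def koszul (g : TwoTensor I M) (Y X Z : ∀ x : M, TangentSpace I x) (x : M) : ℝ :=
  mvfderiv I (fun z ↦ g z (Y z) (Z z)) x (X x) + mvfderiv I (fun z ↦ g z (X z) (Z z)) x (Y x)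
    - mvfderiv I (fun z ↦ g z (X z) (Y z)) x (Z x) + g x (mlieBracket I X Y x) (Z x)
    - g x (mlieBracket I X Z x) (Y x) - g x (mlieBracket I Y Z x) (X x)

/-- The derivatives of the factor produced by the first three terms cancel those produced by the
brackets. Tensoriality in `X` and `Z` is what lets the Koszul expression define a vector `∇_X Y` by
duality. -/
theorem koszul_tensorial_left (hg : IsRiemannianMetric I g)
    (hY : MDifferentiableAt I I.tangent (T% Y) x) (hZ : MDifferentiableAt I I.tangent (T% Z) x) :
    TensorialAt I E (fun X ↦ koszul g Y X Z x) x where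
  smul {f X} hf hX := by
    simp only [koszul, hg.mvfderiv_smul_left hf hX hY, hg.mvfderiv_smul_left hf hX hZ]
    simp only [mlieBracket_smul_left hf hX, Pi.smul_apply', map_smul, map_add, map_neg, smul_eq_mul,
      add_apply, smul_apply, neg_smul, neg_apply]
    ring
  add {X X'} hX hX' := by
    simp only [koszul, hg.mvfderiv_add_left hX hX' hY, hg.mvfderiv_add_left hX hX' hZ]
    simp only [mlieBracket_add_left hX hX', Pi.add_apply, map_add, add_apply]
    ring

theorem koszul_tensorial_right (hg : IsRiemannianMetric I g)
    (hX : MDifferentiableAt I I.tangent (T% X) x) (hY : MDifferentiableAt I I.tangent (T% Y) x) :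
    TensorialAt I E (fun Z ↦ koszul g Y X Z x) x where
  smul {f Z} hf hZ := by
    simp only [koszul, hg.mvfderiv_smul_right hf hX hZ, hg.mvfderiv_smul_right hf hY hZ]
    simp only [mlieBracket_smul_right hf hZ, Pi.smul_apply', map_smul, map_add, smul_eq_mul,
      add_apply, smul_apply, hg.symm x (Z x)]
    ring
  add {Z Z'} hZ hZ' := by
    simp only [koszul, hg.mvfderiv_add_right hX hZ hZ', hg.mvfderiv_add_right hY hZ hZ']
    simp only [mlieBracket_add_right hZ hZ', Pi.add_apply, map_add, add_apply]
    ring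

/-- In the slot of `Y` the derivatives of the factor do not all cancel: what is left is the Leibniz
term of a connection. -/
theorem koszul_smul (hg : IsRiemannianMetric I g) (hf : MDifferentiableAt I 𝓘(ℝ, ℝ) f x)
    (hX : MDifferentiableAt I I.tangent (T% X) x)
    (hY : MDifferentiableAt I I.tangent (T% Y) x) (hZ : MDifferentiableAt I I.tangent (T% Z) x) :
    koszul g (f • Y) X Z x =
      f x * koszul g Y X Z x + 2 * (mvfderiv I f x (X x) * g x (Y x) (Z x)) := by
  simp only [koszul, hg.mvfderiv_smul_left hf hY hZ, hg.mvfderiv_smul_right hf hX hY]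
  simp only [mlieBracket_smul_left hf hY, mlieBracket_smul_right hf hY, Pi.smul_apply', map_smul, map_add,
      map_neg, smul_eq_mul, add_apply, smul_apply, neg_smul, neg_apply, hg.symm x (Y x)]
  ring

theorem koszul_add (hg : IsRiemannianMetric I g) {Y' : ∀ x : M, TangentSpace I x}
    (hX : MDifferentiableAt I I.tangent (T% X) x)
    (hY : MDifferentiableAt I I.tangent (T% Y) x) (hY' : MDifferentiableAt I I.tangent (T% Y') x)
    (hZ : MDifferentiableAt I I.tangent (T% Z) x) :
    koszul g (Y + Y') X Z x = koszul g Y X Z x + koszul g Y' X Z x := by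
  simp only [koszul, hg.mvfderiv_add_left hY hY' hZ, hg.mvfderiv_add_right hX hY hY']
  simp only [mlieBracket_add_left hY hY', mlieBracket_add_right hY hY', Pi.add_apply, map_add, add_apply]
  ring

section Compatible

variable {cov : CovariantDerivative I E (TangentSpace I : M → Type _)}

theorem IsLeviCivita.mlieBracket_eq (h : IsLeviCivita I g cov)
    (hX : MDifferentiableAt I I.tangent (T% X) x) (hY : MDifferentiableAt I I.tangent (T% Y) x) :
    mlieBracket I X Y x = cov Y x (X x) - cov X x (Y x) :=
  (cov.torsion_eq_zero_iff.1 h.torsion_eq_zero hX hY).symm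

/-- This is the uniqueness of the Levi-Civita connection, and it makes any given one computable from
brackets and inner products. -/
theorem IsLeviCivita.koszul_eq (hg : IsRiemannianMetric I g) (h : IsLeviCivita I g cov)
    (hX : MDifferentiableAt I I.tangent (T% X) x) (hY : MDifferentiableAt I I.tangent (T% Y) x)
    (hZ : MDifferentiableAt I I.tangent (T% Z) x) :
    koszul g Y X Z x = 2 * g x (cov Y x (X x)) (Z x) := by
  rw [koszul, h.metric x Y Z hY hZ, h.metric x X Z hX hZ, h.metric x X Y hX hY,
    h.mlieBracket_eq hX hY, h.mlieBracket_eq hX hZ, h.mlieBracket_eq hY hZ]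
  simp only [map_sub, sub_apply, hg.symm x (X x), hg.symm x (Y x)]
  ring

end Compatible

/-- The Koszul form at a point, as a bilinear form in the two vectors. -/
noncomputable def koszulForm (hg : IsRiemannianMetric I g)
    (hY : MDifferentiableAt I I.tangent (T% Y) x) :
    TangentSpace I x →L[ℝ] TangentSpace I x →L[ℝ] ℝ :=
  TensorialAt.mkHom₂ (I := I) (F := E) (F' := E) (fun X Z ↦ koszul g Y X Z x) x
    (fun _ hZ ↦ koszul_tensorial_left hg hY hZ) (fun _ hX ↦ koszul_tensorial_right hg hX hY)

theorem koszulForm_apply (hg : IsRiemannianMetric I g)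
    (hX : MDifferentiableAt I I.tangent (T% X) x)
    (hY : MDifferentiableAt I I.tangent (T% Y) x) (hZ : MDifferentiableAt I I.tangent (T% Z) x) :
    koszulForm hg hY (X x) (Z x) = koszul g Y X Z x :=
  TensorialAt.mkHom₂_apply _ _ hX hZ

open Classical in
/-- The Levi-Civita derivative of a vector field, defined by the Koszul formula. -/
noncomputable def leviCivitaFun (hg : IsRiemannianMetric I g) (Y : ∀ x : M, TangentSpace I x)
    (x : M) : TangentSpace I x →L[ℝ] TangentSpace I x :=
  if hY : MDifferentiableAt I I.tangent (T% Y) x then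
    (g x).inverse ∘L ((1 / 2 : ℝ) • koszulForm hg hY)
  -- A covariant derivative is constrained only on differentiable fields, so any default value
  -- serves.
  else 0

theorem two_mul_leviCivitaFun (hg : IsRiemannianMetric I g)
    (hX : MDifferentiableAt I I.tangent (T% X) x)
    (hY : MDifferentiableAt I I.tangent (T% Y) x) (hZ : MDifferentiableAt I I.tangent (T% Z) x) :
    2 * g x (leviCivitaFun hg Y x (X x)) (Z x) = koszul g Y X Z x := by
  have h : g x (leviCivitaFun hg Y x (X x)) = (1 / 2 : ℝ) • koszulForm hg hY (X x) := by
    rw [leviCivitaFun, dif_pos hY]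
    exact hg.apply_inverse x _
  rw [h, smul_apply, koszulForm_apply hg hX hY hZ, smul_eq_mul]
  ring

omit [FiniteDimensional ℝ E] in
theorem IsRiemannianMetric.eq_of_forall_section (hg : IsRiemannianMetric I g)
    {v w : TangentSpace I x} (h : ∀ Z : ∀ x : M, TangentSpace I x,
      MDifferentiableAt I I.tangent (T% Z) x → 2 * g x v (Z x) = 2 * g x w (Z x)) : v = w := by
  refine hg.eq_of_forall fun u ↦ ?_
  have := h _ (FiberBundle.mdifferentiableAt_extend I E u)
  rw [FiberBundle.extend_apply_self] at this
  linarith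

omit [FiniteDimensional ℝ E] in
theorem hom_ext_of_forall_section {A B : TangentSpace I x →L[ℝ] TangentSpace I x}
    (h : ∀ X : ∀ x : M, TangentSpace I x,
      MDifferentiableAt I I.tangent (T% X) x → A (X x) = B (X x)) : A = B := by
  ext u
  have := h _ (FiberBundle.mdifferentiableAt_extend I E u)
  rwa [FiberBundle.extend_apply_self] at this

/-- The Levi-Civita connection of a Riemannian metric. -/
noncomputable def leviCivita (hg : IsRiemannianMetric I g) :
    CovariantDerivative I E (TangentSpace I : M → Type _) where
  toFun := leviCivitaFun hg
  isCovariantDerivativeOnUniv := {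
    add := fun {Y Y' x} hY hY' _ ↦ by
      refine hom_ext_of_forall_section fun X hX ↦ hg.eq_of_forall_section fun Z hZ ↦ ?_
      rw [two_mul_leviCivitaFun hg hX (mdifferentiableAt_add_section hY hY') hZ,
        koszul_add hg hX hY hY' hZ, ← two_mul_leviCivitaFun hg hX hY hZ,
        ← two_mul_leviCivitaFun hg hX hY' hZ, add_apply, map_add, add_apply]
      ring
    leibniz := fun {Y f x} hY hf _ ↦ by
      refine hom_ext_of_forall_section fun X hX ↦ hg.eq_of_forall_section fun Z hZ ↦ ?_
      rw [two_mul_leviCivitaFun hg hX (hf.smul_section hY) hZ,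
        koszul_smul hg hf hX hY hZ, ← two_mul_leviCivitaFun hg hX hY hZ]
      simp only [add_apply, smul_apply, map_add, map_smul, smul_eq_mul,
        ContinuousLinearMap.smulRight_apply]
      ring }

theorem ContMDiffAt.mlieBracket (hX : ContMDiffAt I I.tangent ∞ (T% X) x)
    (hY : ContMDiffAt I I.tangent ∞ (T% Y) x) :
    ContMDiffAt I I.tangent ∞ (T% (mlieBracket I X Y)) x := by
  have : IsManifold I (minSmoothness ℝ 2) M := by
    rw [minSmoothness_of_isRCLikeNormedField]
    infer_instance
  have : IsManifold I ((⊤ : ℕ∞) + 1) M := inferInstanceAs (IsManifold I ∞ M)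
  exact ContMDiffAt.mlieBracket_vectorField (n := ⊤) (m := ⊤) hX hY (by simp)

/-- The Koszul expression of smooth fields is smooth, and nondegeneracy of `g` passes this on to
`W`. It serves both the connection constructed here and an arbitrary Levi-Civita connection. -/
theorem contMDiffAt_of_forall_koszul_eq (hg : IsRiemannianMetric I g)
    {W : ∀ x : M, TangentSpace I x}
    (hX : ContMDiffAt I I.tangent ∞ (T% X) x) (hY : ContMDiffAt I I.tangent ∞ (T% Y) x)
    (h : ∀ Z : ∀ x : M, TangentSpace I x, ContMDiffAt I I.tangent ∞ (T% Z) x →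
      ∀ᶠ z in 𝓝 x, koszul g Y X Z z = 2 * g z (W z) (Z z)) :
    ContMDiffAt I I.tangent ∞ (T% W) x := by
  refine hg.contMDiffAt_section fun Z hZ ↦ ?_
  have hd {X Y Z : ∀ x : M, TangentSpace I x} (hX : ContMDiffAt I I.tangent ∞ (T% X) x)
      (hY : ContMDiffAt I I.tangent ∞ (T% Y) x) (hZ : ContMDiffAt I I.tangent ∞ (T% Z) x) :
      ContMDiffAt I 𝓘(ℝ, ℝ) ∞ (fun z ↦ mvfderiv I (fun z ↦ g z (X z) (Y z)) z (Z z)) x :=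
    (hg.contMDiffAt_section_apply hX hY).mvfderiv_vectorField hZ (by simp)
  have hb {X Y Z : ∀ x : M, TangentSpace I x} (hX : ContMDiffAt I I.tangent ∞ (T% X) x)
      (hY : ContMDiffAt I I.tangent ∞ (T% Y) x) (hZ : ContMDiffAt I I.tangent ∞ (T% Z) x) :
      ContMDiffAt I 𝓘(ℝ, ℝ) ∞ (fun z ↦ g z (mlieBracket I X Y z) (Z z)) x :=
    hg.contMDiffAt_section_apply (hX.mlieBracket hY) hZ
  have hk : ContMDiffAt I 𝓘(ℝ, ℝ) ∞ (fun z ↦ koszul g Y X Z z) x :=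
    (((((hd hY hZ hX).add (hd hX hZ hY)).sub (hd hX hY hZ)).add (hb hX hY hZ)).sub
      (hb hX hZ hY)).sub (hb hY hZ hX)
  have := (contMDiffAt_const (c := (1 / 2 : ℝ))).mul hk
  refine this.congr_of_eventuallyEq ((h Z hZ).mono fun z hz ↦ ?_)
  simp only [Pi.mul_apply, hz]
  ring

/-- Antisymmetrising the Koszul expression in `X` and `Y` leaves `2 g([X, Y], Z)`; symmetrising it
in `Y` and `Z` leaves twice the derivative of `g(Y, Z)`. -/
theorem isLeviCivita_leviCivita (hg : IsRiemannianMetric I g) :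
    IsLeviCivita I g (leviCivita hg) where
  smooth := ⟨⟨fun {σ} hσ x _ ↦ by
    refine ContMDiffAt.contMDiffWithinAt ?_
    refine contMDiffAt_hom_of_forall_apply (V := TangentSpace I) fun X hX ↦ ?_
    have hσ : ContMDiffAt I I.tangent ∞ (T% σ) x :=
      ((hσ x trivial).contMDiffAt Filter.univ_mem).of_le (by simp)
    refine contMDiffAt_of_forall_koszul_eq hg hX hσ fun Z hZ ↦ ?_
    filter_upwards [hX.eventually_mdifferentiableAt_section (by simp),
      hσ.eventually_mdifferentiableAt_section (by simp),
      hZ.eventually_mdifferentiableAt_section (by simp)] with z hXz hσz hZz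
    exact (two_mul_leviCivitaFun hg hXz hσz hZz).symm⟩⟩
  torsion_eq_zero := (CovariantDerivative.torsion_eq_zero_iff _).2 fun {X Y x} hX hY ↦ by
    refine hg.eq_of_forall_section fun Z hZ ↦ ?_
    have h1 := two_mul_leviCivitaFun hg hX hY hZ
    have h2 := two_mul_leviCivitaFun hg hY hX hZ
    rw [koszul] at h1 h2
    simp only [fun z ↦ hg.symm z (Y z) (X z), mlieBracket_swap_apply (V := Y) (W := X), map_neg,
      neg_apply] at h2
    rw [map_sub, sub_apply]
    change 2 * (g x (leviCivitaFun hg Y x (X x)) (Z x) - g x (leviCivitaFun hg X x (Y x)) (Z x)) = _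
    linarith
  metric x Y Z hY hZ v := by
    have hv := FiberBundle.mdifferentiableAt_extend I E v
    have h1 := two_mul_leviCivitaFun hg hv hY hZ
    have h2 := two_mul_leviCivitaFun hg hv hZ hY
    rw [FiberBundle.extend_apply_self] at h1 h2
    change _ = g x (leviCivitaFun hg Y x v) (Z x) + g x (Y x) (leviCivitaFun hg Z x v)
    rw [hg.symm x (Y x)]
    rw [koszul] at h1 h2
    simp only [fun z ↦ hg.symm z (Z z) (Y z), mlieBracket_swap_apply (V := Z) (W := Y), map_neg,
      neg_apply, FiberBundle.extend_apply_self] at h1 h2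
    linarith

end LeviCivita

/-! ### Symmetries of the curvature of a Levi-Civita connection -/

section Trace

/-- Conjugation by `G` turns `φ` into minus its transpose, and the trace is invariant under
conjugation and transposition. It yields the symmetry of the Ricci tensor and the vanishing of the
trace of `J_N`. -/
theorem LinearMap.trace_eq_zero_of_skew {V : Type*} [AddCommGroup V] [Module ℝ V]
    [FiniteDimensional ℝ V] (G : V ≃ₗ[ℝ] Module.Dual ℝ V) (φ : V →ₗ[ℝ] V)
    (h : ∀ u w, G (φ u) w = -G u (φ w)) : LinearMap.trace ℝ V φ = 0 := by
  have h1 : G.conj φ = (-1 : ℝ) • Module.Dual.transpose (R := ℝ) φ := by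
    refine LinearMap.ext fun α ↦ LinearMap.ext fun w ↦ ?_
    rw [LinearEquiv.conj_apply_apply, h]
    simp [Module.Dual.transpose_apply]
  have h2 := LinearMap.trace_conj' φ G
  rw [h1, map_smul, LinearMap.trace_transpose', smul_eq_mul] at h2
  linarith

end Trace

section Curvature

variable {E : Type*} [NormedAddCommGroup E] [NormedSpace ℝ E] [FiniteDimensional ℝ E]
  {H : Type*} [TopologicalSpace H] {I : ModelWithCorners ℝ E H}
  {M : Type*} [TopologicalSpace M] [ChartedSpace H M] [IsManifold I ∞ M]
  {g : TwoTensor I M} {X Y Z W : ∀ x : M, TangentSpace I x} {x : M} {f : M → ℝ}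
  {cov : CovariantDerivative I E (TangentSpace I : M → Type _)}

open Bundle VectorField

namespace CovariantDerivative

omit [FiniteDimensional ℝ E]

theorem cov_add (hX : MDifferentiableAt I I.tangent (T% X) x)
    (hY : MDifferentiableAt I I.tangent (T% Y) x) (v : TangentSpace I x) :
    cov (fun z ↦ X z + Y z) x v = cov X x v + cov Y x v := by
  have := cov.isCovariantDerivativeOnUniv.add hX hY
  exact congrArg (fun A : TangentSpace I x →L[ℝ] TangentSpace I x ↦ A v) this

theorem cov_sub (hX : MDifferentiableAt I I.tangent (T% X) x)
    (hY : MDifferentiableAt I I.tangent (T% Y) x) (v : TangentSpace I x) :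
    cov (fun z ↦ X z - Y z) x v = cov X x v - cov Y x v := by
  have h := cov_add (cov := cov) (mdifferentiableAt_sub_section hX hY) hY v
  simp only [Pi.sub_apply, sub_add_cancel] at h
  exact eq_sub_of_add_eq h.symm

theorem cov_smul (hf : MDifferentiableAt I 𝓘(ℝ, ℝ) f x)
    (hX : MDifferentiableAt I I.tangent (T% X) x) (v : TangentSpace I x) :
    cov (fun z ↦ f z • X z) x v = f x • cov X x v + mvfderiv I f x v • X x := by
  have := cov.isCovariantDerivativeOnUniv.leibniz hX hf
  exact congrArg (fun A : TangentSpace I x →L[ℝ] TangentSpace I x ↦ A v) this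

theorem cov_congr (hX : MDifferentiableAt I I.tangent (T% X) x)
    (hY : MDifferentiableAt I I.tangent (T% Y) x) (h : ∀ᶠ z in 𝓝 x, X z = Y z) :
    cov X x = cov Y x :=
  cov.isCovariantDerivativeOnUniv.congr_of_eventuallyEq hX hY Filter.univ_mem h

end CovariantDerivative

open CovariantDerivative

namespace IsLeviCivita

variable (hg : IsRiemannianMetric I g) (h : IsLeviCivita I g cov)
include hg h

theorem contMDiffAt_cov (hX : ContMDiffAt I I.tangent ∞ (T% X) x)
    (hY : ContMDiffAt I I.tangent ∞ (T% Y) x) :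
    ContMDiffAt I I.tangent ∞ (T% (fun z ↦ cov Y z (X z))) x := by
  refine contMDiffAt_of_forall_koszul_eq hg hX hY fun Z hZ ↦ ?_
  filter_upwards [hX.eventually_mdifferentiableAt_section (by simp),
    hY.eventually_mdifferentiableAt_section (by simp),
    hZ.eventually_mdifferentiableAt_section (by simp)] with z hXz hYz hZz
  exact h.koszul_eq hg hXz hYz hZz

theorem mdifferentiableAt_cov (hX : ContMDiffAt I I.tangent ∞ (T% X) x)
    (hY : ContMDiffAt I I.tangent ∞ (T% Y) x) :
    MDifferentiableAt I I.tangent (T% (fun z ↦ cov Y z (X z))) x :=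
  (h.contMDiffAt_cov hg hX hY).mdifferentiableAt (by simp)

/-- The torsion-free identity holds in a neighbourhood, so it can be differentiated once more. -/
theorem cov_cov_sub (hX : ContMDiffAt I I.tangent ∞ (T% X) x)
    (hY : ContMDiffAt I I.tangent ∞ (T% Y) x) (v : TangentSpace I x) :
    cov (fun z ↦ cov Y z (X z)) x v - cov (fun z ↦ cov X z (Y z)) x v =
      cov (mlieBracket I X Y) x v := by
  have h1 := h.mdifferentiableAt_cov hg hX hY
  have h2 := h.mdifferentiableAt_cov hg hY hX
  rw [← cov_sub h1 h2]
  refine congrArg (fun A : TangentSpace I x →L[ℝ] TangentSpace I x ↦ A v)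
    (cov_congr (mdifferentiableAt_sub_section h1 h2)
      ((hX.mlieBracket hY).mdifferentiableAt (by simp)) ?_)
  filter_upwards [hX.eventually_mdifferentiableAt_section (by simp),
    hY.eventually_mdifferentiableAt_section (by simp)] with z hXz hYz
  exact (h.mlieBracket_eq hXz hYz).symm

/-- The first Bianchi identity. -/
theorem bianchi (hX : ContMDiffAt I I.tangent ∞ (T% X) x)
    (hY : ContMDiffAt I I.tangent ∞ (T% Y) x) (hZ : ContMDiffAt I I.tangent ∞ (T% Z) x) :
    curvatureField I cov X Y Z x + curvatureField I cov Y Z X x + curvatureField I cov Z X Y x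
      = 0 := by
  have hm {X : ∀ x : M, TangentSpace I x} (hX : ContMDiffAt I I.tangent ∞ (T% X) x) :=
    hX.mdifferentiableAt (by simp)
  have h1 := h.cov_cov_sub hg hY hZ (X x)
  have h2 := h.cov_cov_sub hg hZ hX (Y x)
  have h3 := h.cov_cov_sub hg hX hY (Z x)
  have e1 := h.mlieBracket_eq (hm hX) (hm (hY.mlieBracket hZ))
  have e2 := h.mlieBracket_eq (hm hY) (hm (hZ.mlieBracket hX))
  have e3 := h.mlieBracket_eq (hm hZ) (hm (hX.mlieBracket hY))
  -- Torsion freeness rewrites the cyclic sum of curvatures as the cyclic sum of double brackets,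
  -- which the Jacobi identity annihilates.
  have hjac : mlieBracket I X (mlieBracket I Y Z) x + mlieBracket I Y (mlieBracket I Z X) x
      + mlieBracket I Z (mlieBracket I X Y) x = 0 := by
    have h3 : minSmoothness ℝ 3 = 3 := minSmoothness_of_isRCLikeNormedField
    have h2 : minSmoothness ℝ 2 = 2 := minSmoothness_of_isRCLikeNormedField
    have : IsManifold I (minSmoothness ℝ 3) M := by
      rw [h3]
      infer_instance
    have hle {X : ∀ x : M, TangentSpace I x} (hX : ContMDiffAt I I.tangent ∞ (T% X) x) :
        ContMDiffAt I I.tangent (minSmoothness ℝ 2) (T% X) x := hX.of_le (by rw [h2]; exact ENat.LEInfty.out)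
    rw [leibniz_identity_mlieBracket_apply (hle hX) (hle hY) (hle hZ),
      mlieBracket_swap_apply (V := mlieBracket I X Y) (W := Z),
      mlieBracket_swap (V := Z) (W := X)]
    rw [← neg_one_smul ℝ (mlieBracket I X Z), mlieBracket_const_smul_right (hm (hX.mlieBracket hZ))]
    module
  rw [e1, e2, e3, ← h1, ← h2, ← h3] at hjac
  simp only [curvatureField]
  rw [← hjac]
  abel

omit hg h [FiniteDimensional ℝ E] in
theorem curvatureField_swap : curvatureField I cov X Y Z x = -curvatureField I cov Y X Z x := by
  simp only [curvatureField, mlieBracket_swap_apply (V := Y) (W := X), map_neg]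
  abel

variable [I.Boundaryless]

/-- The curvature operators are skew-adjoint. -/
theorem curvatureField_skew (hX : ContMDiffAt I I.tangent ∞ (T% X) x)
    (hY : ContMDiffAt I I.tangent ∞ (T% Y) x) (hZ : ContMDiffAt I I.tangent ∞ (T% Z) x)
    (hW : ContMDiffAt I I.tangent ∞ (T% W) x) :
    g x (curvatureField I cov X Y Z x) (W x) = -g x (Z x) (curvatureField I cov X Y W x) := by
  have hm {X : ∀ x : M, TangentSpace I x} (hX : ContMDiffAt I I.tangent ∞ (T% X) x) :=
    hX.mdifferentiableAt (n := ∞) (by simp)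
  -- The bracket acts on `g(Z, W)` as a commutator. When both sides are expanded by the metric
  -- condition, the terms with one derivative on each of `Z` and `W` are symmetric in `X` and `Y`
  -- and drop out.
  have hbr := mvfderiv_mlieBracket ((hg.contMDiffAt_section_apply hZ hW).of_le ENat.LEInfty.out) (hm hX)
    (hm hY)
  have hder {X : ∀ x : M, TangentSpace I x} (hX : ContMDiffAt I I.tangent ∞ (T% X) x)
      (v : TangentSpace I x) :
      mvfderiv I (fun z ↦ mvfderiv I (fun z ↦ g z (Z z) (W z)) z (X z)) x v =
      g x (cov (fun z ↦ cov Z z (X z)) x v) (W x) + g x (cov Z x (X x)) (cov W x v) +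
      (g x (cov Z x v) (cov W x (X x)) + g x (Z x) (cov (fun z ↦ cov W z (X z)) x v)) := by
    have hev : (fun z ↦ mvfderiv I (fun z ↦ g z (Z z) (W z)) z (X z)) =ᶠ[𝓝 x]
        fun z ↦ g z (cov Z z (X z)) (W z) + g z (Z z) (cov W z (X z)) := by
      filter_upwards [hZ.eventually_mdifferentiableAt_section (by simp),
        hW.eventually_mdifferentiableAt_section (by simp)] with z hz hw
      exact h.metric z Z W hz hw (X z)
    have hcz := h.mdifferentiableAt_cov hg hX hZ
    have hcw := h.mdifferentiableAt_cov hg hX hW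
    rw [mvfderiv_congr_of_eventuallyEq hev, mvfderiv_fun_add
      (hg.mdifferentiableAt_section_apply hcz (hm hW))
      (hg.mdifferentiableAt_section_apply (hm hZ) hcw), add_apply,
      h.metric x _ _ hcz (hm hW), h.metric x _ _ (hm hZ) hcw]
  rw [hder hX, hder hY, h.metric x Z W (hm hZ) (hm hW)] at hbr
  simp only [curvatureField, map_sub, sub_apply]
  linarith

/-- Skew-adjointness moves `Z` out of the differentiated slot, so only its value at `x` matters; no
separate expansion by the Leibniz rule is needed. -/
theorem curvatureField_congr_right {Z' : ∀ x : M, TangentSpace I x}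
    (hX : ContMDiffAt I I.tangent ∞ (T% X) x)
    (hY : ContMDiffAt I I.tangent ∞ (T% Y) x) (hZ : ContMDiffAt I I.tangent ∞ (T% Z) x)
    (hZ' : ContMDiffAt I I.tangent ∞ (T% Z') x) (hZZ' : Z x = Z' x) :
    curvatureField I cov X Y Z x = curvatureField I cov X Y Z' x := by
  refine hg.eq_of_forall fun u ↦ ?_
  have hu : ContMDiffAt I I.tangent ∞ (T% (FiberBundle.extend E u)) x :=
    FiberBundle.contMDiffAt_extend I E u
  have h1 := h.curvatureField_skew hg hX hY hZ hu
  have h2 := h.curvatureField_skew hg hX hY hZ' hu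
  rw [FiberBundle.extend_apply_self] at h1 h2
  rw [h1, h2, hZZ']

omit hg h [FiniteDimensional ℝ E] [I.Boundaryless] in
theorem contMDiffAt_extend (u : TangentSpace I x) :
    ContMDiffAt I I.tangent ∞ (T% (FiberBundle.extend E u)) x :=
  FiberBundle.contMDiffAt_extend I E u

theorem curvatureAt_skew (u v w w' : TangentSpace I x) :
    g x (curvatureAt I cov x u v w) w' = -g x w (curvatureAt I cov x u v w') := by
  have := h.curvatureField_skew hg (contMDiffAt_extend u) (contMDiffAt_extend v)
    (contMDiffAt_extend w) (contMDiffAt_extend w')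
  rwa [FiberBundle.extend_apply_self, FiberBundle.extend_apply_self] at this

omit [I.Boundaryless] in
theorem curvatureAt_eq_zero_sum (u v w : TangentSpace I x) :
    curvatureAt I cov x u v w + curvatureAt I cov x v w u + curvatureAt I cov x w u v = 0 := by
  have := h.bianchi hg (contMDiffAt_extend u) (contMDiffAt_extend v) (contMDiffAt_extend w)
  exact this

/-- The curvature operator `R(v, w)` as a linear map. -/
noncomputable def curvatureLinear (v w : TangentSpace I x) :
    TangentSpace I x →ₗ[ℝ] TangentSpace I x where
  toFun u := curvatureAt I cov x v w u
  map_add' u u' := hg.eq_of_forall fun z ↦ by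
    rw [h.curvatureAt_skew hg, map_add, map_add, add_apply, add_apply, h.curvatureAt_skew hg,
      h.curvatureAt_skew hg]
    ring
  map_smul' c u := hg.eq_of_forall fun z ↦ by
    rw [h.curvatureAt_skew hg, RingHom.id_apply, map_smul, map_smul, smul_apply, smul_apply,
      h.curvatureAt_skew hg]
    simp

omit h [I.Boundaryless] in
theorem sum_repr_eq_zero_of_skew {ι : Type*} [Fintype ι]
    (b : Module.Basis ι ℝ (TangentSpace I x)) (φ : TangentSpace I x →ₗ[ℝ] TangentSpace I x)
    (hφ : ∀ u w, g x (φ u) w = -g x u (φ w)) : ∑ i, b.repr (φ (b i)) i = 0 := by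
  classical
  have hfin : FiniteDimensional ℝ (TangentSpace I x) := inferInstanceAs (FiniteDimensional ℝ E)
  have ht : T2Space (TangentSpace I x) := inferInstanceAs (T2Space E)
  let G₀ : TangentSpace I x →ₗ[ℝ] Module.Dual ℝ (TangentSpace I x) :=
    { toFun := fun u ↦ (g x u).toLinearMap
      map_add' := fun u v ↦ by rw [map_add]; rfl
      map_smul' := fun c v ↦ by rw [map_smul]; rfl }
  have hinj : Function.Injective G₀ := fun u v huv ↦ hg.eq_of_forall fun w ↦
    congrArg (fun α : Module.Dual ℝ (TangentSpace I x) ↦ α w) huv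
  let G := G₀.linearEquivOfInjective hinj (Subspace.dual_finrank_eq).symm
  have := LinearMap.trace_eq_zero_of_skew G φ hφ
  rw [LinearMap.trace_eq_matrix_trace ℝ b] at this
  rw [← this, Matrix.trace]
  exact Finset.sum_congr rfl fun i _ ↦ by rw [Matrix.diag_apply, LinearMap.toMatrix_apply]

/-- By the Bianchi identity the difference of the two sides is the trace of `u ↦ R(w, v) u`, which
is skew for `g`. -/
theorem ricci_symm (v w : TangentSpace I x) : ricci I cov x v w = ricci I cov x w v := by
  rw [ricci, ricci, ← sub_eq_zero, ← Finset.sum_sub_distrib]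
  have := sum_repr_eq_zero_of_skew hg (Module.finBasis ℝ E : Module.Basis _ ℝ (TangentSpace I x))
    (h.curvatureLinear hg w v) fun u u' ↦ h.curvatureAt_skew hg _ _ _ _
  rw [← this]
  refine Finset.sum_congr rfl fun i _ ↦ ?_
  set b : Module.Basis (Fin (Module.finrank ℝ E)) ℝ (TangentSpace I x) := Module.finBasis ℝ E
  rw [← Finsupp.sub_apply, ← map_sub]
  congr 2
  have h1 := h.curvatureAt_eq_zero_sum hg (b i) v w
  have h2 : curvatureAt I cov x w (b i) v = -curvatureAt I cov x (b i) w v := curvatureField_swap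
  have h3 : curvatureAt I cov x v w (b i) = -curvatureAt I cov x w v (b i) := curvatureField_swap
  rw [h2, h3] at h1
  change _ = curvatureAt I cov x w v (b i)
  rw [← sub_eq_zero, ← h1]
  abel

end IsLeviCivita

end Curvature

/-! ### Pair symmetry and tensoriality of the curvature. -/

section Pair

variable {E : Type*} [NormedAddCommGroup E] [NormedSpace ℝ E] [FiniteDimensional ℝ E]
  {H : Type*} [TopologicalSpace H] {I : ModelWithCorners ℝ E H}
  {M : Type*} [TopologicalSpace M] [ChartedSpace H M] [IsManifold I ∞ M] [I.Boundaryless]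
  {g : TwoTensor I M} {X Y Z W : ∀ x : M, TangentSpace I x} {x : M}
  {cov : CovariantDerivative I E (TangentSpace I : M → Type _)}

/-- The pair symmetry of the curvature. -/
theorem IsLeviCivita.curvatureField_pair_symm (hg : IsRiemannianMetric I g)
    (h : IsLeviCivita I g cov) (hX : ContMDiffAt I I.tangent ∞ (T% X) x)
    (hY : ContMDiffAt I I.tangent ∞ (T% Y) x) (hZ : ContMDiffAt I I.tangent ∞ (T% Z) x)
    (hW : ContMDiffAt I I.tangent ∞ (T% W) x) :
    g x (curvatureField I cov X Y Z x) (W x) = g x (curvatureField I cov Z W X x) (Y x) := by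
  have hb {X Y Z : ∀ x : M, TangentSpace I x} (hX : ContMDiffAt I I.tangent ∞ (T% X) x)
      (hY : ContMDiffAt I I.tangent ∞ (T% Y) x) (hZ : ContMDiffAt I I.tangent ∞ (T% Z) x)
      (W : ∀ x : M, TangentSpace I x) :
      g x (curvatureField I cov X Y Z x) (W x) + g x (curvatureField I cov Y Z X x) (W x)
        + g x (curvatureField I cov Z X Y x) (W x) = 0 := by
    rw [← add_apply, ← map_add, ← add_apply, ← map_add, h.bianchi hg hX hY hZ, map_zero]
    rfl
  have hs {X Y Z W : ∀ x : M, TangentSpace I x} (hX : ContMDiffAt I I.tangent ∞ (T% X) x)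
      (hY : ContMDiffAt I I.tangent ∞ (T% Y) x) (hZ : ContMDiffAt I I.tangent ∞ (T% Z) x)
      (hW : ContMDiffAt I I.tangent ∞ (T% W) x) :
      g x (curvatureField I cov X Y Z x) (W x) = -g x (curvatureField I cov X Y W x) (Z x) := by
    rw [h.curvatureField_skew hg hX hY hZ hW, hg.symm]
  have ha (X Y Z W : ∀ x : M, TangentSpace I x) :
      g x (curvatureField I cov X Y Z x) (W x) = -g x (curvatureField I cov Y X Z x) (W x) := by
    rw [IsLeviCivita.curvatureField_swap, map_neg]
    rfl
  -- The four Bianchi identities for the cyclic rotations of `X, Y, Z, W`, combined with the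
  -- skew-symmetries in the first and in the last pair.
  linarith [hb hX hY hZ W, hb hY hZ hW X, hb hZ hW hX Y, hb hW hX hY Z,
    hs hX hY hZ hW, hs hY hZ hX hW, hs hZ hX hY hW, hs hY hZ hW hX, hs hZ hW hY hX,
    hs hW hY hZ hX, hs hZ hW hX hY, hs hW hX hZ hY, hs hX hZ hW hY, hs hW hX hY hZ,
    hs hX hY hW hZ, hs hY hW hX hZ, ha X Y Z W, ha Y Z X W, ha Z X Y W, ha W Y X Z, ha W X Y Z,
    ha Z W X Y, ha Y W X Z, ha W Y Z X, ha X Z W Y, ha X Y W Z, ha Y Z W X, ha Z W Y X, ha Z X W Y]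

/-- Pair symmetry puts `X` into the third slot, where dependence on the value alone is known. -/
theorem IsLeviCivita.curvatureField_congr_left {X' : ∀ x : M, TangentSpace I x}
    (hg : IsRiemannianMetric I g)
    (h : IsLeviCivita I g cov) (hX : ContMDiffAt I I.tangent ∞ (T% X) x)
    (hX' : ContMDiffAt I I.tangent ∞ (T% X') x)
    (hY : ContMDiffAt I I.tangent ∞ (T% Y) x) (hZ : ContMDiffAt I I.tangent ∞ (T% Z) x)
    (hXX' : X x = X' x) :
    curvatureField I cov X Y Z x = curvatureField I cov X' Y Z x := by
  refine hg.eq_of_forall fun u ↦ ?_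
  have hu : ContMDiffAt I I.tangent ∞ (T% (FiberBundle.extend E u)) x :=
    FiberBundle.contMDiffAt_extend I E u
  have h1 := h.curvatureField_pair_symm hg hX hY hZ hu
  have h2 := h.curvatureField_pair_symm hg hX' hY hZ hu
  rw [FiberBundle.extend_apply_self] at h1 h2
  rw [h1, h2, h.curvatureField_congr_right hg hZ hu hX hX' hXX']

/-- Frees the pointwise curvature from the particular extensions in its definition, so that adapted
fields can be used instead. -/
theorem IsLeviCivita.curvatureAt_eq (hg : IsRiemannianMetric I g)
    (h : IsLeviCivita I g cov) (hX : ContMDiffAt I I.tangent ∞ (T% X) x)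
    (hY : ContMDiffAt I I.tangent ∞ (T% Y) x) (hZ : ContMDiffAt I I.tangent ∞ (T% Z) x) :
    curvatureAt I cov x (X x) (Y x) (Z x) = curvatureField I cov X Y Z x := by
  have he (u : TangentSpace I x) := IsLeviCivita.contMDiffAt_extend u
  rw [curvatureAt, h.curvatureField_congr_left hg (he _) hX (he _) (he _)
    (FiberBundle.extend_apply_self _ _), IsLeviCivita.curvatureField_swap,
    h.curvatureField_congr_left hg (he _) hY hX (he _) (FiberBundle.extend_apply_self _ _),
    ← IsLeviCivita.curvatureField_swap,
    h.curvatureField_congr_right hg hX hY (he _) hZ (FiberBundle.extend_apply_self _ _)]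

end Pair

/-! ### Metrics of Calabi type -/

section Calabi

variable {E : Type*} [NormedAddCommGroup E] [NormedSpace ℝ E] [FiniteDimensional ℝ E]
  {H : Type*} [TopologicalSpace H] {I : ModelWithCorners ℝ E H}
  {M : Type*} [TopologicalSpace M] [ChartedSpace H M] [IsManifold I ∞ M]
  {F : Type*} [NormedAddCommGroup F] [NormedSpace ℝ F] [FiniteDimensional ℝ F]
  {N : Type*} [TopologicalSpace N] [ChartedSpace F N] [IsManifold 𝓘(ℝ, F) ∞ N]

open Bundle VectorField

variable (I) in
/-- `g = dt² + f(t)² Θ² + r(t)² q^* h` on a manifold whose tangent spaces are split by `dt`, `Θ`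
and `dq`, with `dΘ = s q^* Ω` for the Kähler form `Ω` of `(h, JN)`, and `J` is the corresponding
almost complex structure. -/
structure IsCalabiType (g : TwoTensor I M) (J : EndField I M) (t : M → ℝ) (Θ : OneForm I M)
    (q : M → N) (h : TwoTensor 𝓘(ℝ, F) N) (JN : EndField 𝓘(ℝ, F) N) (s : ℝ) (f r : ℝ → ℝ) :
    Prop where
  kahler : IsKahler 𝓘(ℝ, F) h JN
  contMDiff_t : ContMDiff I 𝓘(ℝ, ℝ) ∞ t
  contMDiff_Θ : ContMDiff I (I.prod 𝓘(ℝ, E →L[ℝ] ℝ)) ∞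
    (fun y ↦ Bundle.TotalSpace.mk' (E →L[ℝ] ℝ)
      (E := fun y : M ↦ TangentSpace I y →L[ℝ] Bundle.Trivial M ℝ y) y (Θ y))
  contMDiff_q : ContMDiff I 𝓘(ℝ, F) ∞ q
  injective : ∀ (x : M) (v w : TangentSpace I x), mvfderiv I t x v = mvfderiv I t x w →
    Θ x v = Θ x w → mfderiv I 𝓘(ℝ, F) q x v = mfderiv I 𝓘(ℝ, F) q x w → v = w
  surjective : ∀ (x : M) (a b : ℝ) (u : TangentSpace 𝓘(ℝ, F) (q x)), ∃ v : TangentSpace I x,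
    mvfderiv I t x v = a ∧ Θ x v = b ∧ mfderiv I 𝓘(ℝ, F) q x v = u
  extDeriv : IsExteriorDerivative I Θ (fun x v w ↦
    s * kahlerForm 𝓘(ℝ, F) h JN (q x) (mfderiv I 𝓘(ℝ, F) q x v) (mfderiv I 𝓘(ℝ, F) q x w))
  contDiffAt_f : ∀ x, ContDiffAt ℝ ∞ f (t x)
  f_ne_zero : ∀ x, f (t x) ≠ 0
  contDiffAt_r : ∀ x, ContDiffAt ℝ ∞ r (t x)
  r_pos : ∀ x, 0 < r (t x)
  metric_apply : ∀ (x : M) (v w : TangentSpace I x), g x v w =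
    mvfderiv I t x v * mvfderiv I t x w + f (t x) ^ 2 * (Θ x v * Θ x w)
      + r (t x) ^ 2 * h (q x) (mfderiv I 𝓘(ℝ, F) q x v) (mfderiv I 𝓘(ℝ, F) q x w)
  mvfderiv_J : ∀ (x : M) (v : TangentSpace I x), mvfderiv I t x (J x v) = -f (t x) * Θ x v
  Θ_J : ∀ (x : M) (v : TangentSpace I x), Θ x (J x v) = mvfderiv I t x v / f (t x)
  mfderiv_J : ∀ (x : M) (v : TangentSpace I x),
    mfderiv I 𝓘(ℝ, F) q x (J x v) = JN (q x) (mfderiv I 𝓘(ℝ, F) q x v)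

namespace IsCalabiType

variable {g : TwoTensor I M} {J : EndField I M} {t : M → ℝ} {Θ : OneForm I M}
    {q : M → N} {h : TwoTensor 𝓘(ℝ, F) N} {JN : EndField 𝓘(ℝ, F) N} {s : ℝ} {f r : ℝ → ℝ}
    (D : IsCalabiType I g J t Θ q h JN s f r)
include D

omit [FiniteDimensional ℝ E] in
theorem contMDiffAt_mvfderiv_t {X : ∀ x : M, TangentSpace I x} {x : M}
    (hX : ContMDiffAt I I.tangent ∞ (T% X) x) :
    ContMDiffAt I 𝓘(ℝ, ℝ) ∞ (fun z ↦ mvfderiv I t z (X z)) x :=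
  D.contMDiff_t.contMDiffAt.mvfderiv_vectorField hX le_rfl

omit [FiniteDimensional ℝ E] in
theorem contMDiffAt_Θ {X : ∀ x : M, TangentSpace I x} {x : M}
    (hX : ContMDiffAt I I.tangent ∞ (T% X) x) :
    ContMDiffAt I 𝓘(ℝ, ℝ) ∞ (fun z ↦ Θ z (X z)) x :=
  contMDiffAt_oneForm_apply D.contMDiff_Θ.contMDiffAt hX

omit [FiniteDimensional ℝ E] in
theorem contMDiffAt_mfderiv_q {X : ∀ x : M, TangentSpace I x} {x : M}
    (hX : ContMDiffAt I I.tangent ∞ (T% X) x) :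
    ContMDiffAt I 𝓘(ℝ, F).tangent ∞
      (fun z ↦ (⟨q z, mfderiv I 𝓘(ℝ, F) q z (X z)⟩ : TangentBundle 𝓘(ℝ, F) N)) x :=
  D.contMDiff_q.contMDiffAt.mfderiv_vectorField hX le_rfl

omit [FiniteDimensional ℝ E] in
theorem contMDiffAt_f_comp (x : M) : ContMDiffAt I 𝓘(ℝ, ℝ) ∞ (fun z ↦ f (t z)) x :=
  (D.contDiffAt_f x).contMDiffAt.comp x D.contMDiff_t.contMDiffAt

omit [FiniteDimensional ℝ E] in
theorem contMDiffAt_r_comp (x : M) : ContMDiffAt I 𝓘(ℝ, ℝ) ∞ (fun z ↦ r (t z)) x :=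
  (D.contDiffAt_r x).contMDiffAt.comp x D.contMDiff_t.contMDiffAt

theorem isRiemannianMetric : IsRiemannianMetric I g where
  smooth := by
    refine contMDiff_twoTensor_of_forall_apply fun x X Y hX hY ↦ ?_
    simp only [D.metric_apply]
    exact (((D.contMDiffAt_mvfderiv_t hX).mul (D.contMDiffAt_mvfderiv_t hY)).add
      (((D.contMDiffAt_f_comp x).pow 2).mul ((D.contMDiffAt_Θ hX).mul (D.contMDiffAt_Θ hY)))).add
      (((D.contMDiffAt_r_comp x).pow 2).mul
        (D.kahler.metric.contMDiffAt_apply le_rfl (D.contMDiffAt_mfderiv_q hX)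
          (D.contMDiffAt_mfderiv_q hY)))
  symm x v w := by
    rw [D.metric_apply, D.metric_apply, D.kahler.metric.symm]
    ring
  pos x v hv := by
    rw [D.metric_apply]
    have hf := D.f_ne_zero x
    have hr := D.r_pos x
    by_cases hq : mfderiv I 𝓘(ℝ, F) q x v = 0
    · rw [hq, map_zero, mul_zero, add_zero]
      by_cases ht : mvfderiv I t x v = 0
      · have hΘ : Θ x v ≠ 0 := fun hΘ ↦ hv (D.injective x v 0 (by simp [ht]) (by simp [hΘ])
          (by simp [hq]))
        have := mul_self_pos.2 hΘ
        rw [ht]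
        positivity
      · have := mul_self_pos.2 ht
        have := mul_self_nonneg (Θ x v)
        positivity
    · have := D.kahler.metric.pos (q x) _ hq
      have h1 := mul_self_nonneg (mvfderiv I t x v)
      have h2 := mul_self_nonneg (Θ x v)
      positivity

theorem contMDiff_J : ContMDiff I (I.prod 𝓘(ℝ, E →L[ℝ] E)) ∞
    (fun x ↦ Bundle.TotalSpace.mk' (E →L[ℝ] E)
      (E := fun x : M ↦ TangentSpace I x →L[ℝ] TangentSpace I x) x (J x)) := fun x ↦ by
  refine contMDiffAt_hom_of_forall_apply (V := fun x : M ↦ TangentSpace I x) fun X hX ↦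
    D.isRiemannianMetric.contMDiffAt_section fun Y hY ↦ ?_
  simp only [D.metric_apply, D.mvfderiv_J, D.Θ_J, D.mfderiv_J]
  refine (((((D.contMDiffAt_f_comp x).neg).mul (D.contMDiffAt_Θ hX)).mul
    (D.contMDiffAt_mvfderiv_t hY)).add (((D.contMDiffAt_f_comp x).pow 2).mul
    (((D.contMDiffAt_mvfderiv_t hX).div₀ (D.contMDiffAt_f_comp x) (D.f_ne_zero x)).mul
      (D.contMDiffAt_Θ hY)))).add
      (((D.contMDiffAt_r_comp x).pow 2).mul
        (D.kahler.metric.contMDiffAt_apply le_rfl ?_ (D.contMDiffAt_mfderiv_q hY)))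
  exact ContMDiffAt.clm_bundle_apply (b := q)
    ((D.kahler.smooth (q x)).comp x D.contMDiff_q.contMDiffAt) (D.contMDiffAt_mfderiv_q hX)

theorem isAlmostHermitian : IsAlmostHermitian I g J where
  metric := D.isRiemannianMetric
  smooth := D.contMDiff_J
  sq x v := by
    have hf := D.f_ne_zero x
    refine D.injective x _ _ ?_ ?_ ?_
    · rw [D.mvfderiv_J, D.Θ_J, map_neg]
      field_simp
    · rw [D.Θ_J, D.mvfderiv_J, map_neg]
      field_simp
    · rw [D.mfderiv_J, D.mfderiv_J, D.kahler.sq, map_neg]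
  compat x v w := by
    have hf := D.f_ne_zero x
    rw [D.metric_apply, D.metric_apply, D.mvfderiv_J, D.mvfderiv_J, D.Θ_J, D.Θ_J, D.mfderiv_J,
      D.mfderiv_J, D.kahler.compat]
    field_simp
    ring

/-- The tangent vector with given components `dt`, `Θ` and `dq`. -/
noncomputable def vec (x : M) (a b : ℝ) (u : TangentSpace 𝓘(ℝ, F) (q x)) : TangentSpace I x :=
  (D.surjective x a b u).choose

omit [FiniteDimensional ℝ E] in
@[simp] theorem mvfderiv_vec (x : M) (a b : ℝ) (u : TangentSpace 𝓘(ℝ, F) (q x)) :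
    mvfderiv I t x (D.vec x a b u) = a := (D.surjective x a b u).choose_spec.1

omit [FiniteDimensional ℝ E] in
@[simp] theorem Θ_vec (x : M) (a b : ℝ) (u : TangentSpace 𝓘(ℝ, F) (q x)) :
    Θ x (D.vec x a b u) = b := (D.surjective x a b u).choose_spec.2.1

omit [FiniteDimensional ℝ E] in
@[simp] theorem mfderiv_vec (x : M) (a b : ℝ) (u : TangentSpace 𝓘(ℝ, F) (q x)) :
    mfderiv I 𝓘(ℝ, F) q x (D.vec x a b u) = u := (D.surjective x a b u).choose_spec.2.2

theorem vec_eq (x : M) (v : TangentSpace I x) :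
    D.vec x (mvfderiv I t x v) (Θ x v) (mfderiv I 𝓘(ℝ, F) q x v) = v :=
  D.injective x _ _ (by simp) (by simp) (by simp)

/-- The vector field with constant components `dt` and `Θ`, and `q`-related to `X`. -/
noncomputable def field (a b : ℝ) (X : ∀ y : N, TangentSpace 𝓘(ℝ, F) y) (x : M) :
    TangentSpace I x := D.vec x a b (X (q x))

variable {X X' X'' : ∀ y : N, TangentSpace 𝓘(ℝ, F) y} {x : M}

/-- `vec` is chosen point by point, yet the products with smooth fields depend only on the
components, which vary smoothly; this is enough by duality. -/
theorem contMDiffAt_field (a b : ℝ) (hX : ContMDiffAt 𝓘(ℝ, F) 𝓘(ℝ, F).tangent ∞ (T% X) (q x)) :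
    ContMDiffAt I I.tangent ∞ (T% (D.field a b X)) x := by
  refine D.isRiemannianMetric.contMDiffAt_section fun Y hY ↦ ?_
  simp only [D.metric_apply, field, D.mvfderiv_vec, D.Θ_vec, D.mfderiv_vec]
  refine ((contMDiffAt_const.mul (D.contMDiffAt_mvfderiv_t hY)).add
    (((D.contMDiffAt_f_comp x).pow 2).mul (contMDiffAt_const.mul (D.contMDiffAt_Θ hY)))).add
      (((D.contMDiffAt_r_comp x).pow 2).mul
        (D.kahler.metric.contMDiffAt_apply le_rfl ?_ (D.contMDiffAt_mfderiv_q hY)))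
  exact hX.comp x D.contMDiff_q.contMDiffAt

theorem mdifferentiableAt_field (a b : ℝ)
    (hX : ContMDiffAt 𝓘(ℝ, F) 𝓘(ℝ, F).tangent ∞ (T% X) (q x)) :
    MDifferentiableAt I I.tangent (T% (D.field a b X)) x :=
  (D.contMDiffAt_field a b hX).mdifferentiableAt (by simp)

omit [FiniteDimensional ℝ E] in
theorem mvfderiv_comp_t {k : ℝ → ℝ} (hk : DifferentiableAt ℝ k (t x)) (v : TangentSpace I x) :
    mvfderiv I (fun z ↦ k (t z)) x v = mvfderiv I t x v * deriv k (t x) := by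
  have := mvfderiv_comp_mfderiv (I := I) (I' := 𝓘(ℝ, ℝ)) (k := k) (q := t) (x := x)
    hk.mdifferentiableAt ((D.contMDiff_t x).mdifferentiableAt (by simp)) v
  refine this.trans ?_
  change mfderiv 𝓘(ℝ, ℝ) 𝓘(ℝ, ℝ) k (t x) _ = _
  rw [mfderiv_eq_fderiv]
  exact fderiv_eq_smul_deriv _

/-- The components of the bracket of adapted fields. -/
theorem mlieBracket_field [I.Boundaryless] (a b a' b' : ℝ)
    (hX : ContMDiffAt 𝓘(ℝ, F) 𝓘(ℝ, F).tangent ∞ (T% X) (q x))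
    (hX' : ContMDiffAt 𝓘(ℝ, F) 𝓘(ℝ, F).tangent ∞ (T% X') (q x)) :
    mvfderiv I t x (mlieBracket I (D.field a b X) (D.field a' b' X') x) = 0 ∧
    Θ x (mlieBracket I (D.field a b X) (D.field a' b' X') x) =
      -(s * h (q x) (JN (q x) (X (q x))) (X' (q x))) ∧
    mfderiv I 𝓘(ℝ, F) q x (mlieBracket I (D.field a b X) (D.field a' b' X') x) =
      mlieBracket 𝓘(ℝ, F) X X' (q x) := by
  have h1 := D.mdifferentiableAt_field a b hX
  have h2 := D.mdifferentiableAt_field a' b' hX'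
  refine ⟨?_, ?_, ?_⟩
  · rw [mvfderiv_mlieBracket ((D.contMDiff_t x).of_le ENat.LEInfty.out) h1 h2]
    simp [field, mvfderiv_const]
  -- The functions obtained by applying `Θ` to adapted fields are constant, so only the bracket term
  -- of `dΘ` survives.
  · have := D.extDeriv x _ _ h1 h2
    simp only [field, D.Θ_vec, D.mfderiv_vec, kahlerForm] at this
    rw [← this]
    simp [mvfderiv_const]
  · refine mfderiv_mlieBracket_of_related ((D.contMDiff_q x).of_le ENat.LEInfty.out) h1 h2
      (hX.mdifferentiableAt (by simp)) (hX'.mdifferentiableAt (by simp)) ?_ ?_ <;>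
    simp [field]

theorem metric_field (a b a' b' : ℝ) (z : M) : g z (D.field a b X z) (D.field a' b' X' z) =
    a * a' + f (t z) ^ 2 * (b * b') + r (t z) ^ 2 * h (q z) (X (q z)) (X' (q z)) := by
  simp only [D.metric_apply, field, D.mvfderiv_vec, D.Θ_vec, D.mfderiv_vec]

theorem mvfderiv_metric_field (a b a' b' : ℝ)
    (hX : ContMDiffAt 𝓘(ℝ, F) 𝓘(ℝ, F).tangent ∞ (T% X) (q x))
    (hX' : ContMDiffAt 𝓘(ℝ, F) 𝓘(ℝ, F).tangent ∞ (T% X') (q x)) (v : TangentSpace I x) :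
    mvfderiv I (fun z ↦ g z (D.field a b X z) (D.field a' b' X' z)) x v =
      mvfderiv I t x v * (2 * f (t x) * deriv f (t x) * (b * b')
        + 2 * r (t x) * deriv r (t x) * h (q x) (X (q x)) (X' (q x)))
      + r (t x) ^ 2 * mvfderiv 𝓘(ℝ, F) (fun y ↦ h y (X y) (X' y)) (q x)
          (mfderiv I 𝓘(ℝ, F) q x v) := by
  have hk : MDifferentiableAt 𝓘(ℝ, F) 𝓘(ℝ, ℝ) (fun y ↦ h y (X y) (X' y)) (q x) :=
    D.kahler.metric.mdifferentiableAt_section_apply (hX.mdifferentiableAt (by simp))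
      (hX'.mdifferentiableAt (by simp))
  have hq := (D.contMDiff_q x).mdifferentiableAt (by simp : (∞ : ℕ∞ω) ≠ 0)
  have hdf := (D.contDiffAt_f x).differentiableAt (by simp)
  have hdr := (D.contDiffAt_r x).differentiableAt (by simp)
  have hF := D.mvfderiv_comp_t (k := fun t ↦ f t ^ 2 * (b * b') + a * a')
    (((hdf.pow 2).mul_const _).add_const _) v
  have hR := D.mvfderiv_comp_t (k := fun t ↦ r t ^ 2) (hdr.pow 2) v
  have hF' : deriv (fun t ↦ f t ^ 2 * (b * b') + a * a') (t x) =
      2 * f (t x) * deriv f (t x) * (b * b') := by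
    rw [deriv_add_const, deriv_mul_const (hdf.fun_pow 2), deriv_fun_pow hdf]
    simp
  have hR' : deriv (fun t ↦ r t ^ 2) (t x) = 2 * r (t x) * deriv r (t x) := by
    rw [deriv_fun_pow hdr]
    simp
  have hC := mvfderiv_comp_mfderiv hk hq v
  have hmF : MDifferentiableAt I 𝓘(ℝ, ℝ) (fun z ↦ f (t z) ^ 2 * (b * b') + a * a') x :=
    (((D.contMDiffAt_f_comp x).pow 2).mul contMDiffAt_const |>.add
      contMDiffAt_const).mdifferentiableAt (by simp : (∞ : ℕ∞ω) ≠ 0)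
  have hmR : MDifferentiableAt I 𝓘(ℝ, ℝ) (fun z ↦ r (t z) ^ 2) x :=
    ((D.contMDiffAt_r_comp x).pow 2).mdifferentiableAt (by simp : (∞ : ℕ∞ω) ≠ 0)
  have hmC : MDifferentiableAt I 𝓘(ℝ, ℝ) (fun z ↦ h (q z) (X (q z)) (X' (q z))) x :=
    hk.comp x hq
  have hfun : (fun z ↦ g z (D.field a b X z) (D.field a' b' X' z)) =
      fun z ↦ (f (t z) ^ 2 * (b * b') + a * a') +
        r (t z) ^ 2 * h (q z) (X (q z)) (X' (q z)) := by
    funext z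
    rw [D.metric_field]
    ring
  have hmRC : MDifferentiableAt I 𝓘(ℝ, ℝ)
      (fun z ↦ r (t z) ^ 2 * h (q z) (X (q z)) (X' (q z))) x := hmR.mul hmC
  rw [hfun, mvfderiv_fun_add hmF hmRC, add_apply, hF, hF', mvfderiv_fun_mul hmR hmC,
    add_apply, smul_apply, smul_apply, hR, hR']
  have hC' : mvfderiv I (fun z ↦ h (q z) (X (q z)) (X' (q z))) x v = _ := hC
  rw [hC']
  simp only [smul_eq_mul]
  ring

/-! ### Components of the Levi-Civita derivative of adapted fields. -/

section Connection

variable [I.Boundaryless] {cov : CovariantDerivative I E (TangentSpace I : M → Type _)}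
  (hc : IsLeviCivita I g cov)
  {covN : CovariantDerivative 𝓘(ℝ, F) F (TangentSpace 𝓘(ℝ, F) : N → Type _)}
  (hcN : IsLeviCivita 𝓘(ℝ, F) h covN)
include hc hcN

/-- In the Koszul formula the terms from `N` collect to `r²` times the Koszul formula of `h`. The
rest comes from the derivatives of `f` and `r` along `dt` and from the `Θ` components of the three
brackets. -/
theorem metric_cov_field (a b a' b' a'' b'' : ℝ)
    (hX : ContMDiffAt 𝓘(ℝ, F) 𝓘(ℝ, F).tangent ∞ (T% X) (q x))
    (hX' : ContMDiffAt 𝓘(ℝ, F) 𝓘(ℝ, F).tangent ∞ (T% X') (q x))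
    (hX'' : ContMDiffAt 𝓘(ℝ, F) 𝓘(ℝ, F).tangent ∞ (T% X'') (q x)) :
    2 * g x (cov (D.field a' b' X') x (D.field a b X x)) (D.field a'' b'' X'' x) =
      2 * r (t x) ^ 2 * h (q x) (covN X' (q x) (X (q x))) (X'' (q x))
      + a * (2 * f (t x) * deriv f (t x) * (b' * b'')
        + 2 * r (t x) * deriv r (t x) * h (q x) (X' (q x)) (X'' (q x)))
      + a' * (2 * f (t x) * deriv f (t x) * (b * b'')
        + 2 * r (t x) * deriv r (t x) * h (q x) (X (q x)) (X'' (q x)))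
      - a'' * (2 * f (t x) * deriv f (t x) * (b * b')
        + 2 * r (t x) * deriv r (t x) * h (q x) (X (q x)) (X' (q x)))
      - s * f (t x) ^ 2 * (b'' * h (q x) (JN (q x) (X (q x))) (X' (q x))
        - b' * h (q x) (JN (q x) (X (q x))) (X'' (q x))
        - b * h (q x) (JN (q x) (X' (q x))) (X'' (q x))) := by
  have hm {X : ∀ y : N, TangentSpace 𝓘(ℝ, F) y}
    (hX : ContMDiffAt 𝓘(ℝ, F) 𝓘(ℝ, F).tangent ∞ (T% X) (q x)) :=
    hX.mdifferentiableAt (n := ∞) (by simp)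
  rw [← hc.koszul_eq D.isRiemannianMetric (D.mdifferentiableAt_field a b hX)
    (D.mdifferentiableAt_field a' b' hX') (D.mdifferentiableAt_field a'' b'' hX'')]
  have hN := hcN.koszul_eq D.kahler.metric (hm hX) (hm hX') (hm hX'')
  rw [koszul] at hN ⊢
  obtain ⟨e1, e2, e3⟩ := D.mlieBracket_field a b a' b' hX hX'
  obtain ⟨e4, e5, e6⟩ := D.mlieBracket_field a b a'' b'' hX hX''
  obtain ⟨e7, e8, e9⟩ := D.mlieBracket_field a' b' a'' b'' hX' hX''
  rw [D.mvfderiv_metric_field _ _ _ _ hX' hX'', D.mvfderiv_metric_field _ _ _ _ hX hX'',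
    D.mvfderiv_metric_field _ _ _ _ hX hX', D.metric_apply, D.metric_apply, D.metric_apply,
    e1, e2, e3, e4, e5, e6, e7, e8, e9]
  simp only [field, D.mvfderiv_vec, D.Θ_vec, D.mfderiv_vec]
  linear_combination r (t x) ^ 2 * hN

theorem mvfderiv_cov_field (a' b' : ℝ) (v : TangentSpace I x)
    (hX' : ContMDiffAt 𝓘(ℝ, F) 𝓘(ℝ, F).tangent ∞ (T% X') (q x)) :
    mvfderiv I t x (cov (D.field a' b' X') x v) =
      -(f (t x) * deriv f (t x) * (Θ x v * b') + r (t x) * deriv r (t x) *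
        h (q x) (mfderiv I 𝓘(ℝ, F) q x v) (X' (q x))) := by
  -- Pairing with the test components `(1, 0, 0)` isolates the `dt` component; `(0, 1, 0)` and `(0,
  -- 0, u)` do the same for `Θ` and `dq` below.
  have := D.metric_cov_field hc hcN (mvfderiv I t x v) (Θ x v) a' b' 1 0
    (IsLeviCivita.contMDiffAt_extend (mfderiv I 𝓘(ℝ, F) q x v)) hX'
    (IsLeviCivita.contMDiffAt_extend 0)
  simp only [field] at this
  simp only [FiberBundle.extend_apply_self, D.vec_eq, D.metric_apply, D.mvfderiv_vec, D.Θ_vec,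
    D.mfderiv_vec, map_zero, mul_zero] at this
  linarith

theorem Θ_cov_field (a' b' : ℝ) (v : TangentSpace I x)
    (hX' : ContMDiffAt 𝓘(ℝ, F) 𝓘(ℝ, F).tangent ∞ (T% X') (q x)) :
    Θ x (cov (D.field a' b' X') x v) =
      deriv f (t x) / f (t x) * (mvfderiv I t x v * b' + a' * Θ x v)
        - s / 2 * h (q x) (JN (q x) (mfderiv I 𝓘(ℝ, F) q x v)) (X' (q x)) := by
  have := D.metric_cov_field hc hcN (mvfderiv I t x v) (Θ x v) a' b' 0 1
    (IsLeviCivita.contMDiffAt_extend (mfderiv I 𝓘(ℝ, F) q x v)) hX'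
    (IsLeviCivita.contMDiffAt_extend 0)
  simp only [field] at this
  simp only [FiberBundle.extend_apply_self, D.vec_eq, D.metric_apply, D.mvfderiv_vec, D.Θ_vec,
    D.mfderiv_vec, map_zero, mul_zero] at this
  have hf := D.f_ne_zero x
  field_simp
  apply mul_left_cancel₀ hf
  linarith

theorem mfderiv_cov_field (a' b' : ℝ) (v : TangentSpace I x)
    (hX' : ContMDiffAt 𝓘(ℝ, F) 𝓘(ℝ, F).tangent ∞ (T% X') (q x)) :
    mfderiv I 𝓘(ℝ, F) q x (cov (D.field a' b' X') x v) =
      covN X' (q x) (mfderiv I 𝓘(ℝ, F) q x v)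
      + (deriv r (t x) / r (t x)) •
        (mvfderiv I t x v • X' (q x) + a' • mfderiv I 𝓘(ℝ, F) q x v)
      + (s * f (t x) ^ 2 / (2 * r (t x) ^ 2)) •
        (b' • JN (q x) (mfderiv I 𝓘(ℝ, F) q x v) + Θ x v • JN (q x) (X' (q x))) := by
  refine D.kahler.metric.eq_of_forall fun u ↦ ?_
  have := D.metric_cov_field hc hcN (mvfderiv I t x v) (Θ x v) a' b' 0 0
    (IsLeviCivita.contMDiffAt_extend (mfderiv I 𝓘(ℝ, F) q x v)) hX'
    (IsLeviCivita.contMDiffAt_extend u)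
  simp only [field] at this
  simp only [FiberBundle.extend_apply_self, D.vec_eq, D.metric_apply, D.mvfderiv_vec, D.Θ_vec,
    D.mfderiv_vec, mul_zero] at this
  have hr := (D.r_pos x).ne'
  simp only [map_add, map_smul, add_apply, smul_apply, smul_eq_mul]
  field_simp
  linarith

end Connection

end IsCalabiType

end Calabi

/-! ### The Kähler condition for metrics of Calabi type -/

section CalabiKahler

variable {E : Type*} [NormedAddCommGroup E] [NormedSpace ℝ E] [FiniteDimensional ℝ E]
  {H : Type*} [TopologicalSpace H] {I : ModelWithCorners ℝ E H} [I.Boundaryless]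
  {M : Type*} [TopologicalSpace M] [ChartedSpace H M] [IsManifold I ∞ M]
  {F : Type*} [NormedAddCommGroup F] [NormedSpace ℝ F] [FiniteDimensional ℝ F]
  {N : Type*} [TopologicalSpace N] [ChartedSpace F N] [IsManifold 𝓘(ℝ, F) ∞ N]
  {g : TwoTensor I M} {J : EndField I M} {t : M → ℝ} {Θ : OneForm I M}
  {q : M → N} {h : TwoTensor 𝓘(ℝ, F) N} {JN : EndField 𝓘(ℝ, F) N} {s : ℝ} {f r : ℝ → ℝ}
  {cov : CovariantDerivative I E (TangentSpace I : M → Type _)}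
  {covN : CovariantDerivative 𝓘(ℝ, F) F (TangentSpace 𝓘(ℝ, F) : N → Type _)}

open Bundle VectorField CovariantDerivative

omit [FiniteDimensional ℝ E] [I.Boundaryless] in
theorem IsAlmostHermitian.apply_left (hJ : IsAlmostHermitian I g J) (x : M)
    (v w : TangentSpace I x) : g x (J x v) w = -g x v (J x w) := by
  have := hJ.compat x v (J x w)
  rw [hJ.sq, map_neg] at this
  linarith

omit [FiniteDimensional ℝ E] [I.Boundaryless] in
theorem contMDiffAt_zero_tangent (x : M) :
    ContMDiffAt I I.tangent ∞ (T% (0 : ∀ x : M, TangentSpace I x)) x :=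
  Bundle.contMDiff_zeroSection ℝ (TangentSpace I : M → Type _) x

omit [FiniteDimensional ℝ E] [I.Boundaryless] in
theorem IsAlmostHermitian.contMDiffAt_apply (hJ : IsAlmostHermitian I g J)
    {X : ∀ x : M, TangentSpace I x} {x : M} (hX : ContMDiffAt I I.tangent ∞ (T% X) x) :
    ContMDiffAt I I.tangent ∞ (T% (fun z ↦ J z (X z))) x :=
  ContMDiffAt.clm_bundle_apply (hJ.smooth x) hX

omit [FiniteDimensional ℝ E] [I.Boundaryless] in
theorem IsAlmostHermitian.mdifferentiableAt_apply (hJ : IsAlmostHermitian I g J)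
    {X : ∀ x : M, TangentSpace I x} {x : M} (hX : MDifferentiableAt I I.tangent (T% X) x) :
    MDifferentiableAt I I.tangent (T% (fun z ↦ J z (X z))) x :=
  MDifferentiableAt.clm_bundle_apply ((hJ.smooth x).mdifferentiableAt (by simp)) hX

omit [I.Boundaryless] in
/-- To check that `J` is parallel it is enough to have, for each tangent vector, one extension. -/
theorem isParallelEnd_of_exists_field (hJ : IsAlmostHermitian I g J)
    (H : ∀ (x : M) (u v : TangentSpace I x), ∃ X : ∀ x : M, TangentSpace I x,
      X x = u ∧ MDifferentiableAt I I.tangent (T% X) x ∧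
      cov (fun z ↦ J z (X z)) x v = J x (cov X x v)) : IsParallelEnd I cov J := by
  intro x Y hY v
  -- The Leibniz terms of `∇(J Y)` and `J ∇Y` coincide, so the difference depends only on the value
  -- of `Y` at `x`.
  have hten : TensorialAt I E (fun Y : ∀ x : M, TangentSpace I x ↦
      cov (fun z ↦ J z (Y z)) x v - J x (cov Y x v)) x :=
    { smul := fun {k σ} hk hσ ↦ by
        have h1 : (fun z ↦ J z ((k • σ) z)) = fun z ↦ k z • J z (σ z) := by
          funext z
          rw [Pi.smul_apply', map_smul]
        have h2 : cov (k • σ) x v = _ := cov_smul hk hσ v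
        rw [h1, h2, cov_smul hk (hJ.mdifferentiableAt_apply hσ), map_add, map_smul, map_smul]
        module
      add := fun {σ σ'} hσ hσ' ↦ by
        have h1 : (fun z ↦ J z ((σ + σ') z)) = fun z ↦ J z (σ z) + J z (σ' z) := by
          funext z
          rw [Pi.add_apply, map_add]
        have h2 : cov (σ + σ') x v = _ := cov_add hσ hσ' v
        rw [h1, h2, cov_add (hJ.mdifferentiableAt_apply hσ) (hJ.mdifferentiableAt_apply hσ'),
          map_add]
        abel }
  obtain ⟨X, hXY, hX, hXJ⟩ := H x (Y x) v
  have := hten.pointwise hX hY hXY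
  simp only [hXJ, sub_self] at this
  exact (sub_eq_zero.1 this.symm)

theorem ContDiffAt.differentiableAt_deriv {k : ℝ → ℝ} {a : ℝ} (hk : ContDiffAt ℝ ∞ k a) :
    DifferentiableAt ℝ (deriv k) a := by
  have h1 : ContDiffAt ℝ 1 (fun y ↦ fderiv ℝ k y 1) a :=
    (hk.fderiv_right (m := 1) (by rw [one_add_one_eq_two]; exact ENat.LEInfty.out)).clm_apply contDiffAt_const
  exact h1.differentiableAt (by simp)

namespace IsCalabiType

variable (D : IsCalabiType I g J t Θ q h JN s f r)
include D

omit [I.Boundaryless] [FiniteDimensional ℝ E] in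
theorem mdifferentiableAt_comp_t {k : ℝ → ℝ} {x : M} (hk : DifferentiableAt ℝ k (t x)) :
    MDifferentiableAt I 𝓘(ℝ, ℝ) (fun z ↦ k (t z)) x :=
  hk.mdifferentiableAt.comp x ((D.contMDiff_t x).mdifferentiableAt (by simp))

variable {X : ∀ y : N, TangentSpace 𝓘(ℝ, F) y} {x : M}

/-- The field `d/dt`. -/
noncomputable def fieldT : ∀ x : M, TangentSpace I x := D.field 1 0 0

/-- The field dual to `Θ`. -/
noncomputable def fieldK : ∀ x : M, TangentSpace I x := D.field 0 1 0

omit [I.Boundaryless] in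
@[simp] theorem mvfderiv_fieldT : mvfderiv I t x (D.fieldT x) = 1 := by simp [fieldT, field]
omit [I.Boundaryless] in
@[simp] theorem Θ_fieldT : Θ x (D.fieldT x) = 0 := by simp [fieldT, field]
omit [I.Boundaryless] in
@[simp] theorem mfderiv_fieldT : mfderiv I 𝓘(ℝ, F) q x (D.fieldT x) = 0 := by simp [fieldT, field]
omit [I.Boundaryless] in
@[simp] theorem mvfderiv_fieldK : mvfderiv I t x (D.fieldK x) = 0 := by simp [fieldK, field]
omit [I.Boundaryless] in
@[simp] theorem Θ_fieldK : Θ x (D.fieldK x) = 1 := by simp [fieldK, field]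
omit [I.Boundaryless] in
@[simp] theorem mfderiv_fieldK : mfderiv I 𝓘(ℝ, F) q x (D.fieldK x) = 0 := by simp [fieldK, field]

omit [I.Boundaryless] in
theorem contMDiffAt_fieldT (x : M) : ContMDiffAt I I.tangent ∞ (T% D.fieldT) x :=
  D.contMDiffAt_field 1 0 (contMDiffAt_zero_tangent _)

omit [I.Boundaryless] in
theorem contMDiffAt_fieldK (x : M) : ContMDiffAt I I.tangent ∞ (T% D.fieldK) x :=
  D.contMDiffAt_field 0 1 (contMDiffAt_zero_tangent _)

omit [I.Boundaryless] in
theorem mdifferentiableAt_fieldT (x : M) : MDifferentiableAt I I.tangent (T% D.fieldT) x :=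
  (D.contMDiffAt_fieldT x).mdifferentiableAt (by simp)

omit [I.Boundaryless] in
theorem mdifferentiableAt_fieldK (x : M) : MDifferentiableAt I I.tangent (T% D.fieldK) x :=
  (D.contMDiffAt_fieldK x).mdifferentiableAt (by simp)

/-! ### Derivatives of the two vertical fields. -/

section Components

variable (hc : IsLeviCivita I g cov) (v : TangentSpace I x)
include hc

theorem mvfderiv_cov_fieldT : mvfderiv I t x (cov D.fieldT x v) = 0 := by
  obtain ⟨covN, hcN, -⟩ := D.kahler.parallel
  rw [fieldT, D.mvfderiv_cov_field hc hcN _ _ _ (contMDiffAt_zero_tangent _)]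
  simp

theorem Θ_cov_fieldT : Θ x (cov D.fieldT x v) = deriv f (t x) / f (t x) * Θ x v := by
  obtain ⟨covN, hcN, -⟩ := D.kahler.parallel
  rw [fieldT, D.Θ_cov_field hc hcN _ _ _ (contMDiffAt_zero_tangent _)]
  simp

theorem mfderiv_cov_fieldT : mfderiv I 𝓘(ℝ, F) q x (cov D.fieldT x v) =
    (deriv r (t x) / r (t x)) • mfderiv I 𝓘(ℝ, F) q x v := by
  obtain ⟨covN, hcN, -⟩ := D.kahler.parallel
  rw [fieldT, D.mfderiv_cov_field hc hcN _ _ _ (contMDiffAt_zero_tangent _)]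
  simp [CovariantDerivative.zero]

theorem mvfderiv_cov_fieldK :
    mvfderiv I t x (cov D.fieldK x v) = -(f (t x) * deriv f (t x) * Θ x v) := by
  obtain ⟨covN, hcN, -⟩ := D.kahler.parallel
  rw [fieldK, D.mvfderiv_cov_field hc hcN _ _ _ (contMDiffAt_zero_tangent _)]
  simp

theorem Θ_cov_fieldK :
    Θ x (cov D.fieldK x v) = deriv f (t x) / f (t x) * mvfderiv I t x v := by
  obtain ⟨covN, hcN, -⟩ := D.kahler.parallel
  rw [fieldK, D.Θ_cov_field hc hcN _ _ _ (contMDiffAt_zero_tangent _)]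
  simp

theorem mfderiv_cov_fieldK : mfderiv I 𝓘(ℝ, F) q x (cov D.fieldK x v) =
    (s * f (t x) ^ 2 / (2 * r (t x) ^ 2)) • JN (q x) (mfderiv I 𝓘(ℝ, F) q x v) := by
  obtain ⟨covN, hcN, -⟩ := D.kahler.parallel
  rw [fieldK, D.mfderiv_cov_field hc hcN _ _ _ (contMDiffAt_zero_tangent _)]
  simp [CovariantDerivative.zero]

end Components

omit [I.Boundaryless] in
-- The image of an adapted field under `J` is not adapted, because `f` enters its components: it is
-- `-b f T + (a / f) K` plus the lift of `JN X`. The Leibniz rule reduces its derivative to those of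
-- adapted fields.
theorem cov_J_field (a b : ℝ)
    (hX : ContMDiffAt 𝓘(ℝ, F) 𝓘(ℝ, F).tangent ∞ (T% X) (q x)) (v : TangentSpace I x) :
    cov (fun z ↦ J z (D.field a b X z)) x v =
      (-b * f (t x)) • cov D.fieldT x v + (mvfderiv I t x v * (-b * deriv f (t x))) • D.fieldT x
      + ((a / f (t x)) • cov D.fieldK x v
        + (mvfderiv I t x v * (-a * deriv f (t x) / f (t x) ^ 2)) • D.fieldK x)
      + cov (D.field 0 0 (fun y ↦ JN y (X y))) x v := by
  have hdf := (D.contDiffAt_f x).differentiableAt (by simp)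
  have h1 : (fun z ↦ J z (D.field a b X z)) = fun z ↦
      ((-b * f (t z)) • D.fieldT z + (a / f (t z)) • D.fieldK z)
        + D.field 0 0 (fun y ↦ JN y (X y)) z := by
    funext z
    refine D.injective z _ _ ?_ ?_ ?_
    · simp only [map_add, map_smul, D.mvfderiv_J, mvfderiv_fieldT, mvfderiv_fieldK]
      simp only [field, D.Θ_vec, D.mvfderiv_vec, smul_eq_mul]
      ring
    · simp only [map_add, map_smul, D.Θ_J, Θ_fieldT, Θ_fieldK]
      simp only [field, D.Θ_vec, D.mvfderiv_vec, smul_eq_mul]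
      ring
    · simp only [map_add, map_smul, D.mfderiv_J, mfderiv_fieldT, mfderiv_fieldK]
      simp only [field, D.mfderiv_vec]
      simp
  have hd1 : DifferentiableAt ℝ (fun t ↦ -b * f t) (t x) := hdf.const_mul _
  have hd2 : DifferentiableAt ℝ (fun t ↦ a / f t) (t x) :=
    (differentiableAt_const a).fun_div hdf (D.f_ne_zero x)
  have hT := D.mdifferentiableAt_fieldT x
  have hK := D.mdifferentiableAt_fieldK x
  have hT' : MDifferentiableAt I I.tangent (T% (fun z ↦ (-b * f (t z)) • D.fieldT z)) x :=
    (D.mdifferentiableAt_comp_t hd1).smul_section hT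
  have hK' : MDifferentiableAt I I.tangent (T% (fun z ↦ (a / f (t z)) • D.fieldK z)) x :=
    (D.mdifferentiableAt_comp_t hd2).smul_section hK
  have hTK' : MDifferentiableAt I I.tangent
      (T% (fun z ↦ (-b * f (t z)) • D.fieldT z + (a / f (t z)) • D.fieldK z)) x :=
    mdifferentiableAt_add_section hT' hK'
  rw [h1, cov_add hTK'
      (D.mdifferentiableAt_field 0 0 (D.kahler.contMDiffAt_apply hX)),
    cov_add hT' hK', cov_smul (D.mdifferentiableAt_comp_t hd1) hT,
    cov_smul (D.mdifferentiableAt_comp_t hd2) hK, D.mvfderiv_comp_t hd1, D.mvfderiv_comp_t hd2,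
    deriv_const_mul _ hdf, deriv_fun_div (differentiableAt_const a) hdf (D.f_ne_zero x), deriv_const]
  simp only [zero_mul, zero_sub, neg_mul]

/-- The coefficients coupling base and fibre are `r r'` in the `dt` component, `s / 2` in the `Θ`
component, and `s f² / (2 r²)` next to `r' / r` in the `dq` component. In each component `hsr` is
exactly what matches the two sides; the derivatives on `N` agree because `JN` is parallel. -/
theorem cov_J_field_eq (hc : IsLeviCivita I g cov) (a b : ℝ)
    (hX : ContMDiffAt 𝓘(ℝ, F) 𝓘(ℝ, F).tangent ∞ (T% X) (q x)) (v : TangentSpace I x)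
    (hsr : f (t x) * s = 2 * r (t x) * deriv r (t x)) :
    cov (fun z ↦ J z (D.field a b X z)) x v = J x (cov (D.field a b X) x v) := by
  obtain ⟨covN, hcN, hpN⟩ := D.kahler.parallel
  have hf := D.f_ne_zero x
  have hr := (D.r_pos x).ne'
  have hJX := D.kahler.contMDiffAt_apply hX
  rw [D.cov_J_field a b hX]
  refine D.injective x _ _ ?_ ?_ ?_
  · simp only [map_add, map_smul, D.mvfderiv_J, mvfderiv_fieldT, mvfderiv_fieldK,
      D.mvfderiv_cov_fieldT hc, D.mvfderiv_cov_fieldK hc, D.mvfderiv_cov_field hc hcN _ _ _ hJX,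
      D.Θ_cov_field hc hcN _ _ _ hX, D.kahler.apply_left, smul_eq_mul]
    field_simp
    linear_combination (f (t x) ^ 2 * h (q x) (mfderiv I 𝓘(ℝ, F) q x v) (JN (q x) (X (q x)))) * hsr
  · simp only [map_add, map_smul, D.Θ_J, Θ_fieldT, Θ_fieldK,
      D.Θ_cov_fieldT hc, D.Θ_cov_fieldK hc, D.mvfderiv_cov_field hc hcN _ _ _ hX,
      D.Θ_cov_field hc hcN _ _ _ hJX, D.kahler.compat, smul_eq_mul]
    field_simp
    linear_combination (-f (t x) * h (q x) (mfderiv I 𝓘(ℝ, F) q x v) (X (q x))) * hsr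
  · have hcoef : s * f (t x) ^ 2 / (2 * r (t x) ^ 2) = f (t x) * (deriv r (t x) / r (t x)) := by
      field_simp
      linear_combination hsr
    simp only [map_add, map_smul, D.mfderiv_J, mfderiv_fieldT, mfderiv_fieldK,
      D.mfderiv_cov_fieldT hc, D.mfderiv_cov_fieldK hc, D.mfderiv_cov_field hc hcN _ _ _ hX,
      D.mfderiv_cov_field hc hcN _ _ _ hJX, hpN _ X (hX.mdifferentiableAt (by simp)),
      D.kahler.sq, hcoef]
    match_scalars <;> field_simp <;> ring

theorem isParallelEnd (hc : IsLeviCivita I g cov)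
    (hsr : ∀ x, f (t x) * s = 2 * r (t x) * deriv r (t x)) : IsParallelEnd I cov J := by
  refine isParallelEnd_of_exists_field D.isAlmostHermitian fun x u v ↦
    ⟨D.field (mvfderiv I t x u) (Θ x u)
      (FiberBundle.extend F (mfderiv I 𝓘(ℝ, F) q x u)), ?_,
      D.mdifferentiableAt_field _ _ (IsLeviCivita.contMDiffAt_extend _),
      D.cov_J_field_eq hc _ _ (IsLeviCivita.contMDiffAt_extend _) v (hsr x)⟩
  simp only [field, FiberBundle.extend_apply_self, D.vec_eq]

theorem mul_eq_of_isParallelEnd (hc : IsLeviCivita I g cov) (hJ : IsParallelEnd I cov J)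
    {u : TangentSpace 𝓘(ℝ, F) (q x)} (hu : u ≠ 0) :
    f (t x) * s = 2 * r (t x) * deriv r (t x) := by
  obtain ⟨covN, hcN, -⟩ := D.kahler.parallel
  have he : ContMDiffAt 𝓘(ℝ, F) 𝓘(ℝ, F).tangent ∞ (T% (FiberBundle.extend F u)) (q x) :=
    IsLeviCivita.contMDiffAt_extend u
  -- The lift of `u` is differentiated along the lift of `JN u`. The `dt` component of `∇(J X)` is
  -- `-r r' h(u, u)` and that of `J ∇X` is `-(f s / 2) h(u, u)`.
  have h1 := hJ x _ (D.mdifferentiableAt_field 0 0 he) (D.vec x 0 0 (JN (q x) u))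
  rw [D.cov_J_field 0 0 he] at h1
  have h2 := congrArg (mvfderiv I t x) h1
  simp only [map_add, map_smul, D.mvfderiv_J, D.mvfderiv_cov_fieldT hc, mvfderiv_fieldT,
    D.mvfderiv_cov_field hc hcN _ _ _ (D.kahler.contMDiffAt_apply he),
    D.Θ_cov_field hc hcN _ _ _ he, D.mvfderiv_vec, D.Θ_vec, D.mfderiv_vec, mvfderiv_fieldK,
    FiberBundle.extend_apply_self, D.kahler.sq, D.kahler.compat, map_neg, neg_apply, zero_div] at h2
  have := (D.kahler.metric.pos _ u hu).ne'
  simp at h2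
  apply mul_right_cancel₀ this
  linarith

theorem isKahler_iff (hF : ∀ x, ∃ u : TangentSpace 𝓘(ℝ, F) (q x), u ≠ 0) :
    IsKahler I g J ↔ ∀ x, f (t x) * s = 2 * r (t x) * deriv r (t x) := by
  refine ⟨fun hK x ↦ ?_, fun hsr ↦ ?_⟩
  · obtain ⟨cov, hc, hJ⟩ := hK.parallel
    obtain ⟨u, hu⟩ := hF x
    exact D.mul_eq_of_isParallelEnd hc hJ hu
  -- The Kähler property asserts that a Levi-Civita connection exists, which is why one was
  -- constructed from the Koszul formula.
  · exact { D.isAlmostHermitian with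
      parallel := ⟨leviCivita D.isRiemannianMetric, isLeviCivita_leviCivita _,
        D.isParallelEnd (isLeviCivita_leviCivita _) hsr⟩ }

end IsCalabiType

end CalabiKahler

/-! ### Geometry of Kähler metrics of Calabi type -/

section Trace

theorem LinearMap.trace_smulRight_apply {V : Type*} [AddCommGroup V] [Module ℝ V]
    [FiniteDimensional ℝ V] (α : V →ₗ[ℝ] ℝ) (v : V) :
    LinearMap.trace ℝ V (α.smulRight v) = α v := by
  have := LinearMap.trace_eq_contract_apply ℝ V (TensorProduct.tmul ℝ α v)
  rw [contractLeft_apply] at this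
  rw [← this]
  congr 1

end Trace

/-! ### The Ricci tensor as a basis-free trace. -/

section RicciTrace

variable {E : Type*} [NormedAddCommGroup E] [NormedSpace ℝ E] [FiniteDimensional ℝ E]
  {H : Type*} [TopologicalSpace H] {I : ModelWithCorners ℝ E H} [I.Boundaryless]
  {M : Type*} [TopologicalSpace M] [ChartedSpace H M] [IsManifold I ∞ M]
  {g : TwoTensor I M} {x : M}
  {cov : CovariantDerivative I E (TangentSpace I : M → Type _)}

namespace IsLeviCivita

variable (hg : IsRiemannianMetric I g) (h : IsLeviCivita I g cov)
include hg h

theorem curvatureAt_pair_symm (u v w z : TangentSpace I x) :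
    g x (curvatureAt I cov x u v w) z = g x (curvatureAt I cov x w z u) v := by
  have := h.curvatureField_pair_symm hg (contMDiffAt_extend u) (contMDiffAt_extend v)
    (contMDiffAt_extend w) (contMDiffAt_extend z)
  rwa [FiberBundle.extend_apply_self, FiberBundle.extend_apply_self] at this

theorem curvatureAt_add_right (v w u u' : TangentSpace I x) : curvatureAt I cov x v w (u + u') =
    curvatureAt I cov x v w u + curvatureAt I cov x v w u' :=
  (h.curvatureLinear hg v w).map_add u u'

theorem curvatureAt_smul_right (v w : TangentSpace I x) (c : ℝ) (u : TangentSpace I x) :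
    curvatureAt I cov x v w (c • u) = c • curvatureAt I cov x v w u :=
  (h.curvatureLinear hg v w).map_smul c u

/-- The linear map `u ↦ R(u, v) w`, whose trace is the Ricci tensor. -/
noncomputable def ricciLinear (v w : TangentSpace I x) :
    TangentSpace I x →ₗ[ℝ] TangentSpace I x where
  toFun u := curvatureAt I cov x u v w
  map_add' u u' := hg.eq_of_forall fun z ↦ by
    -- Pair symmetry moves `u` to the last slot, where linearity is already known.
    rw [h.curvatureAt_pair_symm hg, h.curvatureAt_add_right hg, map_add, map_add, add_apply,
      add_apply, h.curvatureAt_pair_symm hg u, h.curvatureAt_pair_symm hg u']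
  map_smul' c u := hg.eq_of_forall fun z ↦ by
    rw [h.curvatureAt_pair_symm hg, RingHom.id_apply, h.curvatureAt_smul_right hg, map_smul,
      map_smul, smul_apply, smul_apply, h.curvatureAt_pair_symm hg u]

theorem ricci_eq_trace (v w : TangentSpace I x) :
    ricci I cov x v w = LinearMap.trace ℝ (TangentSpace I x) (h.ricciLinear hg v w) := by
  classical
  let b : Module.Basis (Fin (Module.finrank ℝ E)) ℝ (TangentSpace I x) := Module.finBasis ℝ E
  rw [LinearMap.trace_eq_matrix_trace ℝ b, Matrix.trace, ricci]
  exact Finset.sum_congr rfl fun i _ ↦ by rw [Matrix.diag_apply, LinearMap.toMatrix_apply]; rfl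

theorem ricci_add_right (v w w' : TangentSpace I x) :
    ricci I cov x v (w + w') = ricci I cov x v w + ricci I cov x v w' := by
  simp only [ricci, h.curvatureAt_add_right hg, map_add, Finsupp.add_apply, Finset.sum_add_distrib]

theorem ricci_smul_right (v : TangentSpace I x) (c : ℝ) (w : TangentSpace I x) :
    ricci I cov x v (c • w) = c * ricci I cov x v w := by
  simp only [ricci, h.curvatureAt_smul_right hg, map_smul, Finsupp.smul_apply, smul_eq_mul,
    Finset.mul_sum]

end IsLeviCivita

end RicciTrace

section CalabiGeometry

variable {E : Type*} [NormedAddCommGroup E] [NormedSpace ℝ E] [FiniteDimensional ℝ E]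
  {H : Type*} [TopologicalSpace H] {I : ModelWithCorners ℝ E H} [I.Boundaryless]
  {M : Type*} [TopologicalSpace M] [ChartedSpace H M] [IsManifold I ∞ M]
  {F : Type*} [NormedAddCommGroup F] [NormedSpace ℝ F] [FiniteDimensional ℝ F]
  {N : Type*} [TopologicalSpace N] [ChartedSpace F N] [IsManifold 𝓘(ℝ, F) ∞ N]
  {g : TwoTensor I M} {J : EndField I M} {t : M → ℝ} {Θ : OneForm I M}
  {q : M → N} {h : TwoTensor 𝓘(ℝ, F) N} {JN : EndField 𝓘(ℝ, F) N} {s : ℝ} {f r : ℝ → ℝ}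
  {cov : CovariantDerivative I E (TangentSpace I : M → Type _)}
  {covN : CovariantDerivative 𝓘(ℝ, F) F (TangentSpace 𝓘(ℝ, F) : N → Type _)}

open Bundle VectorField CovariantDerivative

namespace IsCalabiType

variable (D : IsCalabiType I g J t Θ q h JN s f r) {x : M}
include D

omit [I.Boundaryless] in
theorem eq_of_mfderiv_eq_zero {v : TangentSpace I x} (hv : mfderiv I 𝓘(ℝ, F) q x v = 0) :
    v = mvfderiv I t x v • D.fieldT x + Θ x v • D.fieldK x :=
  D.injective x _ _ (by simp) (by simp) (by simp [hv])

/-- The fibres of `q` are totally geodesic. -/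
theorem mfderiv_cov_eq_zero (hc : IsLeviCivita I g cov) {Z : ∀ x : M, TangentSpace I x}
    (hZ : MDifferentiableAt I I.tangent (T% Z) x)
    (hZq : ∀ᶠ z in 𝓝 x, mfderiv I 𝓘(ℝ, F) q z (Z z) = 0) {v : TangentSpace I x}
    (hv : mfderiv I 𝓘(ℝ, F) q x v = 0) : mfderiv I 𝓘(ℝ, F) q x (cov Z x v) = 0 := by
  have h1 : MDifferentiableAt I 𝓘(ℝ, ℝ) (fun z ↦ mvfderiv I t z (Z z)) x :=
    MDifferentiableAt.mvfderiv_vectorField ((D.contMDiff_t x).of_le ENat.LEInfty.out) hZ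
  have h2 : MDifferentiableAt I 𝓘(ℝ, ℝ) (fun z ↦ Θ z (Z z)) x := by
    have := MDifferentiableAt.clm_bundle_apply
      (E₂ := Bundle.Trivial M ℝ) ((D.contMDiff_Θ x).mdifferentiableAt (by simp)) hZ
    rw [mdifferentiableAt_totalSpace] at this
    exact this.2
  have hT := D.mdifferentiableAt_fieldT x
  have hK := D.mdifferentiableAt_fieldK x
  have hT' : MDifferentiableAt I I.tangent (T% (fun z ↦ mvfderiv I t z (Z z) • D.fieldT z)) x :=
    h1.smul_section hT
  have hK' : MDifferentiableAt I I.tangent (T% (fun z ↦ Θ z (Z z) • D.fieldK z)) x :=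
    h2.smul_section hK
  have hTK' : MDifferentiableAt I I.tangent
      (T% (fun z ↦ mvfderiv I t z (Z z) • D.fieldT z + Θ z (Z z) • D.fieldK z)) x :=
    mdifferentiableAt_add_section hT' hK'
  -- Near `x` the field is `dt(Z) T + Θ(Z) K`. The Leibniz terms are vertical, and the `dq`
  -- components of `∇_v T` and `∇_v K` depend linearly on `dq(v) = 0`.
  rw [cov_congr hZ hTK' (hZq.mono fun z hz ↦ D.eq_of_mfderiv_eq_zero hz), cov_add hT' hK',
    cov_smul h1 hT, cov_smul h2 hK]
  simp [D.mfderiv_cov_fieldT hc, D.mfderiv_cov_fieldK hc, hv]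

/-- The field dual to `Θ` preserves the metric. -/
theorem isKilling_fieldK : IsKilling I g D.fieldK where
  smooth := D.contMDiffAt_fieldK
  lie x Y Z hY hZ := by
    -- The Levi-Civita connection turns the Killing equation into skew-symmetry of `∇K`. It holds
    -- for all `f` and `r`, the horizontal part being a multiple of `JN`.
    have hc := isLeviCivita_leviCivita D.isRiemannianMetric
    have hK := D.mdifferentiableAt_fieldK x
    rw [hc.metric x Y Z hY hZ, hc.mlieBracket_eq hK hY, hc.mlieBracket_eq hK hZ, map_sub, map_sub,
      sub_apply]
    suffices H : g x (leviCivita D.isRiemannianMetric D.fieldK x (Y x)) (Z x) +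
        g x (Y x) (leviCivita D.isRiemannianMetric D.fieldK x (Z x)) = 0 by linarith
    rw [D.metric_apply, D.metric_apply, D.mvfderiv_cov_fieldK hc, D.mvfderiv_cov_fieldK hc,
      D.Θ_cov_fieldK hc, D.Θ_cov_fieldK hc, D.mfderiv_cov_fieldK hc, D.mfderiv_cov_fieldK hc,
      map_smul, map_smul, smul_apply, D.kahler.apply_left]
    have hf := D.f_ne_zero x
    simp only [smul_eq_mul]
    field_simp
    ring

omit [I.Boundaryless] in
theorem J_fieldT : J x (D.fieldT x) = (1 / f (t x)) • D.fieldK x :=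
  D.injective x _ _ (by simp [D.mvfderiv_J]) (by simp [D.Θ_J]) (by simp [D.mfderiv_J])

/-! ### The special Kähler potential `r² / s`. -/

section Potential

variable (hs : s ≠ 0) (hsr : ∀ x, f (t x) * s = 2 * r (t x) * deriv r (t x))
include hs hsr

omit [I.Boundaryless] in
theorem mvfderiv_potential (v : TangentSpace I x) :
    mvfderiv I (fun z ↦ r (t z) ^ 2 / s) x v = f (t x) * mvfderiv I t x v := by
  have hdr := (D.contDiffAt_r x).differentiableAt (by simp)
  rw [D.mvfderiv_comp_t (k := fun t ↦ r t ^ 2 / s) ((hdr.fun_pow 2).div_const s), deriv_div_const,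
    deriv_fun_pow hdr]
  have := hsr x
  field_simp
  norm_num
  linear_combination (-mvfderiv I t x v) * this

omit [I.Boundaryless] in
theorem gradField_potential :
    gradField I g (fun z ↦ r (t z) ^ 2 / s) x = f (t x) • D.fieldT x := by
  refine D.isRiemannianMetric.eq_of_forall fun u ↦ ?_
  rw [D.isRiemannianMetric.apply_gradField, D.mvfderiv_potential hs hsr, map_smul, smul_apply,
    D.metric_apply]
  simp

omit [I.Boundaryless] in
theorem J_gradField_potential :
    J x (gradField I g (fun z ↦ r (t z) ^ 2 / s) x) = D.fieldK x := by
  have := D.f_ne_zero x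
  rw [D.gradField_potential hs hsr, map_smul, J_fieldT, smul_smul, mul_one_div_cancel this,
    one_smul]

theorem isSpecialKahlerPotential [Nonempty M] (hc : IsLeviCivita I g cov) :
    IsSpecialKahlerPotential I g J cov (fun z ↦ r (t z) ^ 2 / s) where
  smooth x := ((D.contMDiffAt_r_comp x).pow 2).div₀ contMDiffAt_const hs
  nonconstant := by
    rintro ⟨c, hcst⟩
    obtain ⟨x⟩ := ‹Nonempty M›
    -- The derivative along `T` is `f`, which vanishes nowhere.
    have h1 := D.mvfderiv_potential hs hsr (D.fieldT x)
    have h2 : (fun z ↦ r (t z) ^ 2 / s) = fun _ ↦ c := funext hcst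
    rw [h2, mvfderiv_const, mvfderiv_fieldT, mul_one] at h1
    exact D.f_ne_zero x h1.symm
  killing := by
    simp only [D.J_gradField_potential hs hsr]
    exact D.isKilling_fieldK
  hessian x _ v hv1 hv2 := by
    have hf := D.f_ne_zero x
    have hgr : gradField I g (fun z ↦ r (t z) ^ 2 / s) = fun z ↦ f (t z) • D.fieldT z :=
      funext fun z ↦ D.gradField_potential hs hsr
    have hdf := (D.contDiffAt_f x).differentiableAt (by simp)
    -- Orthogonality to `K` and `J K` says that `Θ(v) = 0` and `dt(v) = 0`, i.e. that `v` is
    -- horizontal.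
    rw [D.J_gradField_potential hs hsr] at hv1 hv2
    rw [D.metric_apply] at hv1 hv2
    simp [D.mvfderiv_J, D.Θ_J, D.mfderiv_J, hf] at hv1 hv2
    -- For horizontal `v` the derivative of `f` along `v` is zero, and `∇_v (f T) = f ∇_v T = f (r'
    -- / r) v`.
    refine ⟨f (t x) * (deriv r (t x) / r (t x)), fun w ↦ ?_⟩
    rw [hgr, cov_smul (D.mdifferentiableAt_comp_t hdf) (D.mdifferentiableAt_fieldT x),
      D.mvfderiv_comp_t hdf, D.metric_apply, D.metric_apply]
    simp [D.mvfderiv_cov_fieldT hc, D.Θ_cov_fieldT hc, D.mfderiv_cov_fieldT hc, hv1, hv2]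
    ring

end Potential

/-! ### The Ricci tensor on vertical vectors. -/

section Ricci

theorem cov_fieldT_field (hc : IsLeviCivita I g cov) (a b : ℝ)
    (X : ∀ y : N, TangentSpace 𝓘(ℝ, F) y) (z : M) :
    cov D.fieldT z (D.field a b X z) =
      (b * logDeriv f (t z)) • D.fieldK z + logDeriv r (t z) • D.field 0 0 X z := by
  refine D.injective z _ _ ?_ ?_ ?_
  · simp only [D.mvfderiv_cov_fieldT hc, map_add, map_smul, mvfderiv_fieldK]
    simp [field]
  · simp only [D.Θ_cov_fieldT hc, map_add, map_smul, Θ_fieldK]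
    simp [field, logDeriv_apply, mul_comm]
  · simp only [D.mfderiv_cov_fieldT hc, map_add, map_smul, mfderiv_fieldK]
    simp [field, logDeriv_apply]

omit [I.Boundaryless] [FiniteDimensional ℝ E] in
theorem differentiableAt_logDeriv_f (x : M) : DifferentiableAt ℝ (logDeriv f) (t x) :=
  (D.contDiffAt_f x).differentiableAt_deriv.div
    ((D.contDiffAt_f x).differentiableAt (by simp)) (D.f_ne_zero x)

omit [I.Boundaryless] [FiniteDimensional ℝ E] in
theorem differentiableAt_logDeriv_r (x : M) : DifferentiableAt ℝ (logDeriv r) (t x) :=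
  (D.contDiffAt_r x).differentiableAt_deriv.div
    ((D.contDiffAt_r x).differentiableAt (by simp)) (D.r_pos x).ne'

theorem cov_cov_fieldT_field (hc : IsLeviCivita I g cov) (a b : ℝ)
    {X : ∀ y : N, TangentSpace 𝓘(ℝ, F) y}
    (hX : ContMDiffAt 𝓘(ℝ, F) 𝓘(ℝ, F).tangent ∞ (T% X) (q x)) (v : TangentSpace I x) :
    cov (fun z ↦ cov D.fieldT z (D.field a b X z)) x v =
      ((b * logDeriv f (t x)) • cov D.fieldK x v
        + (mvfderiv I t x v * (b * deriv (logDeriv f) (t x))) • D.fieldK x)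
      + (logDeriv r (t x) • cov (D.field 0 0 X) x v
        + (mvfderiv I t x v * deriv (logDeriv r) (t x)) • D.field 0 0 X x) := by
  have hd1 : DifferentiableAt ℝ (fun t ↦ b * logDeriv f t) (t x) :=
    (D.differentiableAt_logDeriv_f x).const_mul b
  have hd2 := D.differentiableAt_logDeriv_r x
  have hK := D.mdifferentiableAt_fieldK x
  have hX' := D.mdifferentiableAt_field 0 0 hX
  have h1 : MDifferentiableAt I I.tangent (T% (fun z ↦ (b * logDeriv f (t z)) • D.fieldK z)) x :=
    (D.mdifferentiableAt_comp_t hd1).smul_section hK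
  have h2 : MDifferentiableAt I I.tangent (T% (fun z ↦ logDeriv r (t z) • D.field 0 0 X z)) x :=
    (D.mdifferentiableAt_comp_t hd2).smul_section hX'
  rw [funext (D.cov_fieldT_field hc a b X), cov_add h1 h2,
    cov_smul (D.mdifferentiableAt_comp_t hd1) hK, cov_smul (D.mdifferentiableAt_comp_t hd2) hX',
    D.mvfderiv_comp_t hd1, D.mvfderiv_comp_t hd2, deriv_const_mul _ (D.differentiableAt_logDeriv_f x)]

/-- As `∇T` is built from adapted fields with coefficients depending on `t`, only first derivatives
of adapted fields are needed. The derivatives on `N` cancel against the bracket by torsion freeness,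
so the curvature of `N` does not enter. -/
theorem curvatureAt_fieldT (hc : IsLeviCivita I g cov) (u w : TangentSpace I x) :
    mvfderiv I t x (curvatureAt I cov x u w (D.fieldT x)) = 0 ∧
    Θ x (curvatureAt I cov x u w (D.fieldT x)) =
      (deriv (logDeriv f) (t x) + logDeriv f (t x) ^ 2) *
        (mvfderiv I t x u * Θ x w - mvfderiv I t x w * Θ x u)
      + (logDeriv f (t x) - logDeriv r (t x)) * s *
        h (q x) (JN (q x) (mfderiv I 𝓘(ℝ, F) q x u)) (mfderiv I 𝓘(ℝ, F) q x w) ∧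
    mfderiv I 𝓘(ℝ, F) q x (curvatureAt I cov x u w (D.fieldT x)) =
      ((logDeriv f (t x) - logDeriv r (t x)) * (s * f (t x) ^ 2 / (2 * r (t x) ^ 2))) •
        (Θ x w • JN (q x) (mfderiv I 𝓘(ℝ, F) q x u) - Θ x u • JN (q x) (mfderiv I 𝓘(ℝ, F) q x w))
      + (deriv (logDeriv r) (t x) + logDeriv r (t x) ^ 2) •
        (mvfderiv I t x u • mfderiv I 𝓘(ℝ, F) q x w
          - mvfderiv I t x w • mfderiv I 𝓘(ℝ, F) q x u) := by
  obtain ⟨covN, hcN, -⟩ := D.kahler.parallel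
  have hf := D.f_ne_zero x
  have hr := (D.r_pos x).ne'
  set X : ∀ y : N, TangentSpace 𝓘(ℝ, F) y := FiberBundle.extend F (mfderiv I 𝓘(ℝ, F) q x u)
    with hXdef
  set Y : ∀ y : N, TangentSpace 𝓘(ℝ, F) y := FiberBundle.extend F (mfderiv I 𝓘(ℝ, F) q x w)
    with hYdef
  have hX : ContMDiffAt 𝓘(ℝ, F) 𝓘(ℝ, F).tangent ∞ (T% X) (q x) := IsLeviCivita.contMDiffAt_extend _
  have hY : ContMDiffAt 𝓘(ℝ, F) 𝓘(ℝ, F).tangent ∞ (T% Y) (q x) := IsLeviCivita.contMDiffAt_extend _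
  have hXx : X (q x) = mfderiv I 𝓘(ℝ, F) q x u := FiberBundle.extend_apply_self _ _
  have hYx : Y (q x) = mfderiv I 𝓘(ℝ, F) q x w := FiberBundle.extend_apply_self _ _
  have hu : D.field (mvfderiv I t x u) (Θ x u) X x = u := by
    rw [field, hXx, D.vec_eq]
  have hw : D.field (mvfderiv I t x w) (Θ x w) Y x = w := by
    rw [field, hYx, D.vec_eq]
  have h0 := hc.curvatureAt_eq D.isRiemannianMetric
    (D.contMDiffAt_field (mvfderiv I t x u) (Θ x u) hX)
    (D.contMDiffAt_field (mvfderiv I t x w) (Θ x w) hY) (D.contMDiffAt_fieldT x)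
  rw [hu, hw, curvatureField, hu, hw, D.cov_cov_fieldT_field hc _ _ hX,
    D.cov_cov_fieldT_field hc _ _ hY] at h0
  obtain ⟨e1, e2, e3⟩ := D.mlieBracket_field (mvfderiv I t x u) (Θ x u) (mvfderiv I t x w) (Θ x w)
    hX hY
  have e4 := hcN.mlieBracket_eq (hX.mdifferentiableAt (by simp)) (hY.mdifferentiableAt (by simp))
  have hv (v : TangentSpace 𝓘(ℝ, F) (q x)) : mvfderiv I t x (D.vec x 0 0 v) = 0 := by simp
  rw [hXx, hYx] at e2 e4
  rw [e4] at e3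
  rw [h0]
  refine ⟨?_, ?_, ?_⟩
  · simp only [map_sub, map_add, map_smul, D.mvfderiv_cov_fieldT hc, D.mvfderiv_cov_fieldK hc,
      mvfderiv_fieldK, D.mvfderiv_cov_field hc hcN _ _ _ hX, D.mvfderiv_cov_field hc hcN _ _ _ hY,
      hXx, hYx]
    simp only [field, D.mvfderiv_vec, D.kahler.metric.symm (q x) (mfderiv I 𝓘(ℝ, F) q x u),
      smul_eq_mul]
    ring
  · simp only [map_sub, map_add, map_smul, D.Θ_cov_fieldT hc, D.Θ_cov_fieldK hc,
      Θ_fieldK, D.Θ_cov_field hc hcN _ _ _ hX, D.Θ_cov_field hc hcN _ _ _ hY,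
      hXx, hYx, e2]
    have hskew := D.kahler.apply_left (q x) (mfderiv I 𝓘(ℝ, F) q x w) (mfderiv I 𝓘(ℝ, F) q x u)
    rw [D.kahler.metric.symm] at hskew
    simp only [field, D.Θ_vec, smul_eq_mul, logDeriv_apply]
    rw [D.kahler.apply_left (q x) (mfderiv I 𝓘(ℝ, F) q x w) (mfderiv I 𝓘(ℝ, F) q x u),
      D.kahler.metric.symm (q x) (mfderiv I 𝓘(ℝ, F) q x w)]
    ring
  · simp only [map_sub, map_add, map_smul, D.mfderiv_cov_fieldT hc, D.mfderiv_cov_fieldK hc,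
      mfderiv_fieldK, D.mfderiv_cov_field hc hcN _ _ _ hX, D.mfderiv_cov_field hc hcN _ _ _ hY,
      hXx, hYx, e3]
    simp only [field, D.mfderiv_vec, hXx, hYx, logDeriv_apply]
    module

omit [I.Boundaryless] in
/-- The horizontal lift. -/
noncomputable def lift (x : M) : TangentSpace 𝓘(ℝ, F) (q x) →ₗ[ℝ] TangentSpace I x where
  toFun u := D.vec x 0 0 u
  map_add' u v := D.injective x _ _ (by simp) (by simp) (by simp)
  map_smul' c u := D.injective x _ _ (by simp) (by simp) (by simp)

omit [I.Boundaryless] in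
-- `φ` is the sum of its three components: the first two have rank at most one, and cyclicity of the
-- trace turns the third into a trace on `N`.
theorem trace_eq (φ : TangentSpace I x →ₗ[ℝ] TangentSpace I x) :
    LinearMap.trace ℝ _ φ = mvfderiv I t x (φ (D.fieldT x)) + Θ x (φ (D.fieldK x))
      + LinearMap.trace ℝ (TangentSpace 𝓘(ℝ, F) (q x))
        ((mfderiv I 𝓘(ℝ, F) q x).toLinearMap ∘ₗ φ ∘ₗ D.lift x) := by
  have : FiniteDimensional ℝ (TangentSpace I x) := inferInstanceAs (FiniteDimensional ℝ E)
  have : FiniteDimensional ℝ (TangentSpace 𝓘(ℝ, F) (q x)) :=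
    inferInstanceAs (FiniteDimensional ℝ F)
  have h1 : φ = ((mvfderiv I t x).toLinearMap ∘ₗ φ).smulRight (D.fieldT x)
      + ((Θ x : TangentSpace I x →L[ℝ] ℝ).toLinearMap ∘ₗ φ).smulRight (D.fieldK x)
      + D.lift x ∘ₗ ((mfderiv I 𝓘(ℝ, F) q x).toLinearMap ∘ₗ φ) := by
    refine LinearMap.ext fun u ↦ D.injective x _ _ ?_ ?_ ?_ <;> simp [lift]
  conv_lhs => rw [h1]
  rw [map_add, map_add, LinearMap.trace_smulRight_apply, LinearMap.trace_smulRight_apply,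
    LinearMap.trace_comp_comm', LinearMap.comp_assoc]
  rfl

omit [FiniteDimensional ℝ E] [I.Boundaryless] in
theorem trace_complexStructure (y : N) :
    LinearMap.trace ℝ (TangentSpace 𝓘(ℝ, F) y) (JN y).toLinearMap = 0 := by
  classical
  have : FiniteDimensional ℝ (TangentSpace 𝓘(ℝ, F) y) :=
    inferInstanceAs (FiniteDimensional ℝ F)
  let b : Module.Basis (Fin (Module.finrank ℝ F)) ℝ (TangentSpace 𝓘(ℝ, F) y) := Module.finBasis ℝ F
  rw [LinearMap.trace_eq_matrix_trace ℝ b, Matrix.trace]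
  rw [← IsLeviCivita.sum_repr_eq_zero_of_skew D.kahler.metric b (JN y).toLinearMap
    (D.kahler.apply_left y)]
  exact Finset.sum_congr rfl fun i _ ↦ by rw [Matrix.diag_apply, LinearMap.toMatrix_apply]

theorem trace_add_complexStructure (y : N) (a b : ℝ) :
    LinearMap.trace ℝ (TangentSpace 𝓘(ℝ, F) y) (a • LinearMap.id + b • (JN y).toLinearMap) =
      a * Module.finrank ℝ F := by
  have : FiniteDimensional ℝ (TangentSpace 𝓘(ℝ, F) y) :=
    inferInstanceAs (FiniteDimensional ℝ F)
  rw [map_add, map_smul, map_smul, D.trace_complexStructure, LinearMap.trace_id]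
  simp only [smul_eq_mul, mul_zero, add_zero]
  rfl

/-- The horizontal block is a multiple of the identity plus a multiple of `JN`. The coefficient of
`JN` carries `Θ(w)`, and `JN` has trace zero, so only `dt(w)` remains. -/
theorem ricci_fieldT (hc : IsLeviCivita I g cov) (w : TangentSpace I x) :
    ricci I cov x w (D.fieldT x) =
      -((deriv (logDeriv f) (t x) + logDeriv f (t x) ^ 2)
        + Module.finrank ℝ F * (deriv (logDeriv r) (t x) + logDeriv r (t x) ^ 2)) *
      mvfderiv I t x w := by
  rw [hc.ricci_eq_trace D.isRiemannianMetric, D.trace_eq]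
  have h1 : mvfderiv I t x (hc.ricciLinear D.isRiemannianMetric w (D.fieldT x) (D.fieldT x)) = _ :=
    (D.curvatureAt_fieldT hc (D.fieldT x) w).1
  have h2 : Θ x (hc.ricciLinear D.isRiemannianMetric w (D.fieldT x) (D.fieldK x)) = _ :=
    (D.curvatureAt_fieldT hc (D.fieldK x) w).2.1
  have h3 : (mfderiv I 𝓘(ℝ, F) q x).toLinearMap ∘ₗ
      hc.ricciLinear D.isRiemannianMetric w (D.fieldT x) ∘ₗ D.lift x =
      (-(deriv (logDeriv r) (t x) + logDeriv r (t x) ^ 2) * mvfderiv I t x w) • LinearMap.id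
      + (((logDeriv f (t x) - logDeriv r (t x)) * (s * f (t x) ^ 2 / (2 * r (t x) ^ 2))) * Θ x w) •
        (JN (q x)).toLinearMap := by
    refine LinearMap.ext fun u ↦ ?_
    refine (D.curvatureAt_fieldT hc (D.lift x u) w).2.2.trans ?_
    simp only [lift, LinearMap.coe_mk, AddHom.coe_mk, D.mvfderiv_vec, D.Θ_vec, D.mfderiv_vec,
      LinearMap.add_apply, LinearMap.smul_apply, LinearMap.id_apply, ContinuousLinearMap.coe_coe]
    module
  rw [h1, h2, h3, D.trace_add_complexStructure]
  simp
  ring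

/-- A parallel `J` commutes with the curvature and `K = f J T`. Applying `J` swaps the roles of the
identity and `JN` in the horizontal block, so now `Θ(w)` remains and `dt(w)` drops out. -/
theorem ricci_fieldK (hc : IsLeviCivita I g cov)
    (hsr : ∀ x, f (t x) * s = 2 * r (t x) * deriv r (t x)) (w : TangentSpace I x) :
    ricci I cov x w (D.fieldK x) =
      -((deriv (logDeriv f) (t x) + logDeriv f (t x) ^ 2)
        + Module.finrank ℝ F * (logDeriv r (t x) * (logDeriv f (t x) - logDeriv r (t x)))) *
      (f (t x) ^ 2 * Θ x w) := by
  have hJ := D.isParallelEnd hc hsr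
  have hf := D.f_ne_zero x
  have hr := (D.r_pos x).ne'
  have hg := D.isRiemannianMetric
  have hR (u : TangentSpace I x) : curvatureAt I cov x u w (D.fieldK x) =
      f (t x) • J x (curvatureAt I cov x u w (D.fieldT x)) := by
    have h1 : D.fieldK x = f (t x) • J x (D.fieldT x) := by
      rw [J_fieldT, smul_smul, mul_one_div_cancel hf, one_smul]
    rw [h1, hc.curvatureAt_smul_right hg]
    congr 1
    have he (u : TangentSpace I x) := IsLeviCivita.contMDiffAt_extend u
    have h2 := hc.curvatureAt_eq hg (he u) (he w)
      (D.isAlmostHermitian.contMDiffAt_apply (D.contMDiffAt_fieldT x))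
    have h3 := hc.curvatureAt_eq hg (he u) (he w) (D.contMDiffAt_fieldT x)
    rw [FiberBundle.extend_apply_self, FiberBundle.extend_apply_self] at h2 h3
    rw [h2, h3]
    have h4 (X : ∀ x : M, TangentSpace I x) :
        (fun z ↦ cov (fun z ↦ J z (D.fieldT z)) z (X z)) = fun z ↦ J z (cov D.fieldT z (X z)) :=
      funext fun z ↦ hJ z _ (D.mdifferentiableAt_fieldT z) (X z)
    have h5 {X : ∀ x : M, TangentSpace I x} (hX : ContMDiffAt I I.tangent ∞ (T% X) x)
        (v : TangentSpace I x) := hJ x _ (hc.mdifferentiableAt_cov hg hX (D.contMDiffAt_fieldT x)) v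
    simp only [curvatureField, h4, hJ x _ (D.mdifferentiableAt_fieldT x), map_sub]
    rw [h5 (he u), h5 (he w)]
  have hcoef : s * f (t x) ^ 2 / (2 * r (t x) ^ 2) = f (t x) * logDeriv r (t x) := by
    rw [logDeriv_apply]
    field_simp
    linear_combination hsr x
  rw [hc.ricci_eq_trace D.isRiemannianMetric, D.trace_eq]
  have h1 : hc.ricciLinear D.isRiemannianMetric w (D.fieldK x) (D.fieldT x) = _ := hR (D.fieldT x)
  have h2 : hc.ricciLinear D.isRiemannianMetric w (D.fieldK x) (D.fieldK x) = _ := hR (D.fieldK x)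
  have h3 : (mfderiv I 𝓘(ℝ, F) q x).toLinearMap ∘ₗ
      hc.ricciLinear D.isRiemannianMetric w (D.fieldK x) ∘ₗ D.lift x =
      (-(logDeriv f (t x) - logDeriv r (t x)) * logDeriv r (t x) * f (t x) ^ 2 * Θ x w) •
        LinearMap.id
      + (-(deriv (logDeriv r) (t x) + logDeriv r (t x) ^ 2) * mvfderiv I t x w * f (t x)) •
        (JN (q x)).toLinearMap := by
    refine LinearMap.ext fun u ↦ ?_
    refine (congrArg (mfderiv I 𝓘(ℝ, F) q x) (hR (D.lift x u))).trans ?_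
    rw [map_smul, D.mfderiv_J, (D.curvatureAt_fieldT hc (D.lift x u) w).2.2, hcoef]
    simp only [lift, LinearMap.coe_mk, AddHom.coe_mk, D.mvfderiv_vec, D.Θ_vec, D.mfderiv_vec,
      LinearMap.add_apply, LinearMap.smul_apply, LinearMap.id_apply, ContinuousLinearMap.coe_coe,
      map_add, map_sub, map_smul, D.kahler.sq]
    module
  rw [h1, h2, h3, D.trace_add_complexStructure, map_smul, map_smul, D.mvfderiv_J, D.Θ_J,
    (D.curvatureAt_fieldT hc (D.fieldT x) w).2.1, (D.curvatureAt_fieldT hc (D.fieldK x) w).1]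
  simp
  ring

omit [I.Boundaryless] in
-- The derivative of `f s = 2 r r'`, in the form that makes the Ricci eigenvalues of `T` and `K`
-- coincide.
theorem deriv_logDeriv_r (hsr : ∀ x, f (t x) * s = 2 * r (t x) * deriv r (t x)) (x : M) :
    deriv (logDeriv r) (t x) + logDeriv r (t x) ^ 2 =
      logDeriv r (t x) * (logDeriv f (t x) - logDeriv r (t x)) := by
  have hf := D.f_ne_zero x
  have hr := (D.r_pos x).ne'
  have hdf := (D.contDiffAt_f x).differentiableAt (by simp)
  have hdr := (D.contDiffAt_r x).differentiableAt (by simp)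
  have hddr := (D.contDiffAt_r x).differentiableAt_deriv
  have h1 : deriv f (t x) * s =
      2 * (deriv r (t x) * deriv r (t x) + r (t x) * deriv (deriv r) (t x)) := by
    -- The equation is known only at the values of `t`, so it is differentiated on `M` along `T`
    -- rather than on the line.
    have e1 := D.mvfderiv_comp_t (k := fun t ↦ f t * s) (hdf.mul_const s) (D.fieldT x)
    have e2 := D.mvfderiv_comp_t (k := fun t ↦ 2 * r t * deriv r t)
      ((hdr.const_mul 2).fun_mul hddr) (D.fieldT x)
    rw [funext hsr, e2, mvfderiv_fieldT, one_mul, one_mul, deriv_mul_const hdf,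
      deriv_fun_mul (hdr.const_mul 2) hddr, deriv_const_mul _ hdr] at e1
    linarith
  have h2 : deriv (logDeriv r) (t x) =
      (deriv (deriv r) (t x) * r (t x) - deriv r (t x) * deriv r (t x)) / r (t x) ^ 2 :=
    deriv_div hddr hdr hr
  rw [h2, logDeriv_apply, logDeriv_apply]
  have h3 := hsr x
  have h4 : f (t x) * deriv (deriv r) (t x) * r (t x) =
      deriv r (t x) * (deriv f (t x) * r (t x) - f (t x) * deriv r (t x)) := by
    -- If `s = 0`, then `r'` and `r''` vanish at `t x`, and so do both sides.
    by_cases hs : s = 0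
    · subst hs
      have : deriv r (t x) = 0 := by
        have : r (t x) * deriv r (t x) = 0 := by linarith
        exact (mul_eq_zero.1 this).resolve_left hr
      rw [this] at h1 ⊢
      have : r (t x) * deriv (deriv r) (t x) = 0 := by linarith
      linear_combination f (t x) * this
    · apply mul_right_cancel₀ hs
      linear_combination (deriv (deriv r) (t x) * r (t x) + deriv r (t x) * deriv r (t x)) * h3
        - r (t x) * deriv r (t x) * h1
  field_simp
  linear_combination h4

/-- The tangent vectors of the fibres of `q` are eigenvectors of the Ricci tensor. -/
theorem exists_ricci_eq (hc : IsLeviCivita I g cov)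
    (hsr : ∀ x, f (t x) * s = 2 * r (t x) * deriv r (t x)) (x : M) :
    ∃ l : ℝ, ∀ v w : TangentSpace I x, mfderiv I 𝓘(ℝ, F) q x v = 0 →
      ricci I cov x v w = l * g x v w := by
  refine ⟨-((deriv (logDeriv f) (t x) + logDeriv f (t x) ^ 2)
        + Module.finrank ℝ F * (logDeriv r (t x) * (logDeriv f (t x) - logDeriv r (t x)))),
    fun v w hv ↦ ?_⟩
  -- The formulas for `T` and `K` have the vertical vector as second argument.
  rw [hc.ricci_symm D.isRiemannianMetric]
  nth_rw 1 [D.eq_of_mfderiv_eq_zero hv]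
  rw [hc.ricci_add_right D.isRiemannianMetric, hc.ricci_smul_right D.isRiemannianMetric,
    hc.ricci_smul_right D.isRiemannianMetric, D.ricci_fieldT hc, D.ricci_fieldK hc hsr,
    D.deriv_logDeriv_r hsr, D.metric_apply, hv]
  simp
  ring

end Ricci

end IsCalabiType

end CalabiGeometry

/-! ### Pull back of exterior derivatives -/

section ExteriorDerivative

variable {E : Type*} [NormedAddCommGroup E] [NormedSpace ℝ E] [FiniteDimensional ℝ E]
  {H : Type*} [TopologicalSpace H] {I : ModelWithCorners ℝ E H}
  {M : Type*} [TopologicalSpace M] [ChartedSpace H M] [IsManifold I ∞ M]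
  {E' : Type*} [NormedAddCommGroup E'] [NormedSpace ℝ E'] [FiniteDimensional ℝ E']
  {H' : Type*} [TopologicalSpace H'] {I' : ModelWithCorners ℝ E' H'}
  {M' : Type*} [TopologicalSpace M'] [ChartedSpace H' M'] [IsManifold I' ∞ M']
  {θ : OneForm I M} {x : M} {X Y Z : ∀ x : M, TangentSpace I x} {f : M → ℝ}

open Bundle VectorField

omit [FiniteDimensional ℝ E] in
theorem mdifferentiableAt_oneForm_apply
    (hθ : ContMDiffAt I (I.prod 𝓘(ℝ, E →L[ℝ] ℝ)) ∞
      (fun y ↦ Bundle.TotalSpace.mk' (E →L[ℝ] ℝ)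
      (E := fun y : M ↦ TangentSpace I y →L[ℝ] Bundle.Trivial M ℝ y) y (θ y)) x)
    (hX : MDifferentiableAt I I.tangent (T% X) x) :
    MDifferentiableAt I 𝓘(ℝ, ℝ) (fun z ↦ θ z (X z)) x := by
  have := MDifferentiableAt.clm_bundle_apply (E₂ := Bundle.Trivial M ℝ)
    (hθ.mdifferentiableAt (by simp)) hX
  rw [mdifferentiableAt_totalSpace] at this
  exact this.2

/-- The right-hand side of the formula for the exterior derivative of a one-form. -/
noncomputable def extDerivExpr (θ : OneForm I M) (X Y : ∀ x : M, TangentSpace I x) (x : M) : ℝ :=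
  mvfderiv I (fun z ↦ θ z (Y z)) x (X x) - mvfderiv I (fun z ↦ θ z (X z)) x (Y x)
        - θ x (mlieBracket I X Y x)

omit [FiniteDimensional ℝ E] [IsManifold I ∞ M] in
theorem extDerivExpr_swap : extDerivExpr θ X Y x = -extDerivExpr θ Y X x := by
  simp only [extDerivExpr, mlieBracket_swap_apply (V := X) (W := Y), map_neg]
  ring

/-- The derivative of the factor in the second term cancels against the bracket term, so `dθ` may be
evaluated on conveniently chosen extensions. -/
theorem extDerivExpr_tensorial
    (hθ : ContMDiffAt I (I.prod 𝓘(ℝ, E →L[ℝ] ℝ)) ∞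
      (fun y ↦ Bundle.TotalSpace.mk' (E →L[ℝ] ℝ)
      (E := fun y : M ↦ TangentSpace I y →L[ℝ] Bundle.Trivial M ℝ y) y (θ y)) x) :
    TensorialAt I E (fun X ↦ extDerivExpr θ X Y x) x where
  smul {f X} hf hX := by
    have h1 : mvfderiv I (fun z ↦ θ z ((f • X) z)) x (Y x) =
        f x * mvfderiv I (fun z ↦ θ z (X z)) x (Y x) + θ x (X x) * mvfderiv I f x (Y x) := by
      have : (fun z ↦ θ z ((f • X) z)) = fun z ↦ f z * θ z (X z) := by
        funext z
        rw [Pi.smul_apply', map_smul, smul_eq_mul]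
      rw [this, mvfderiv_fun_mul hf (mdifferentiableAt_oneForm_apply hθ hX)]
      simp
    simp only [extDerivExpr, h1]
    simp only [mlieBracket_smul_left hf hX, Pi.smul_apply', map_smul, map_add, neg_smul, map_neg,
      smul_eq_mul]
    ring
  add {X X'} hX hX' := by
    have h1 : mvfderiv I (fun z ↦ θ z ((X + X') z)) x (Y x) =
        mvfderiv I (fun z ↦ θ z (X z)) x (Y x) + mvfderiv I (fun z ↦ θ z (X' z)) x (Y x) := by
      have : (fun z ↦ θ z ((X + X') z)) = fun z ↦ θ z (X z) + θ z (X' z) := by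
        funext z
        rw [Pi.add_apply, map_add]
      rw [this, mvfderiv_fun_add (mdifferentiableAt_oneForm_apply hθ hX)
        (mdifferentiableAt_oneForm_apply hθ hX')]
      rfl
    simp only [extDerivExpr, h1]
    simp only [mlieBracket_add_left hX hX', Pi.add_apply, map_add]
    ring

omit [FiniteDimensional ℝ E] in
theorem contMDiff_pullback_oneForm {q : M' → M} (hq : ContMDiff I' I ∞ q)
    (hθ : ContMDiff I (I.prod 𝓘(ℝ, E →L[ℝ] ℝ)) ∞
      (fun y ↦ Bundle.TotalSpace.mk' (E →L[ℝ] ℝ)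
      (E := fun y : M ↦ TangentSpace I y →L[ℝ] Bundle.Trivial M ℝ y) y (θ y))) :
    ContMDiff I' (I'.prod 𝓘(ℝ, E' →L[ℝ] ℝ)) ∞
      (fun y ↦ Bundle.TotalSpace.mk' (E' →L[ℝ] ℝ)
      (E := fun y : M' ↦ TangentSpace I' y →L[ℝ] Bundle.Trivial M' ℝ y) y
        (θ (q y) ∘L mfderiv I' I q y)) := by
  intro y
  refine contMDiffAt_hom_of_forall_apply (V := Bundle.Trivial M' ℝ) fun X hX ↦ ?_
  have := ContMDiffAt.clm_bundle_apply (E₂ := Bundle.Trivial M ℝ) (b := q)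
    ((hθ (q y)).comp y (hq y)) ((hq y).mfderiv_vectorField hX le_rfl)
  rw [contMDiffAt_totalSpace] at this ⊢
  exact ⟨contMDiffAt_id, this.2⟩

/-- Exterior derivatives commute with pull backs by submersions. -/
theorem IsExteriorDerivative.pullback [I.Boundaryless] [I'.Boundaryless] {q : M' → M}
    (hq : ContMDiff I' I ∞ q)
    (hθ : ContMDiff I (I.prod 𝓘(ℝ, E →L[ℝ] ℝ)) ∞
      (fun y ↦ Bundle.TotalSpace.mk' (E →L[ℝ] ℝ)
      (E := fun y : M ↦ TangentSpace I y →L[ℝ] Bundle.Trivial M ℝ y) y (θ y)))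
    {β : ∀ x : M, TangentSpace I x → TangentSpace I x → ℝ}
    (hβ : IsExteriorDerivative I θ β)
    (hlift : ∀ (y : M') (v : TangentSpace I' y), ∃ (Z : ∀ y : M', TangentSpace I' y)
      (W : ∀ x : M, TangentSpace I x), Z y = v ∧ MDifferentiableAt I' I'.tangent (T% Z) y ∧
      MDifferentiableAt I I.tangent (T% W) (q y) ∧ ∀ z, mfderiv I' I q z (Z z) = W (q z)) :
    IsExteriorDerivative I' (fun y ↦ θ (q y) ∘L mfderiv I' I q y)
      (fun y v w ↦ β (q y) (mfderiv I' I q y v) (mfderiv I' I q y w)) := by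
  intro y X Y hX hY
  have hΘ := contMDiff_pullback_oneForm hq hθ y
  obtain ⟨X', A, hXX', hX', hA, hXA⟩ := hlift y (X y)
  obtain ⟨Y', B, hYY', hY', hB, hYB⟩ := hlift y (Y y)
  -- Tensoriality permits replacing the given fields by projectable ones with the same values at
  -- `y`, for which each term descends to `M`.
  have h1 : extDerivExpr (fun y ↦ θ (q y) ∘L mfderiv I' I q y) X Y y =
      extDerivExpr (fun y ↦ θ (q y) ∘L mfderiv I' I q y) X' Y' y := by
    rw [(extDerivExpr_tensorial hΘ (Y := Y)).pointwise hX hX' hXX'.symm, extDerivExpr_swap,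
      (extDerivExpr_tensorial hΘ (Y := X')).pointwise hY hY' hYY'.symm, ← extDerivExpr_swap]
  refine h1.trans ?_
  rw [← hXX', ← hYY']
  beta_reduce
  rw [hXA, hYB, ← hβ (q y) A B hA hB]
  have hqd := (hq y).mdifferentiableAt (by simp : (∞ : ℕ∞ω) ≠ 0)
  have h2 {X' Y' : ∀ y : M', TangentSpace I' y} {A B : ∀ x : M, TangentSpace I x}
      (hA : MDifferentiableAt I I.tangent (T% A) (q y))
      (hXA : ∀ z, mfderiv I' I q z (X' z) = A (q z))
      (hYB : ∀ z, mfderiv I' I q z (Y' z) = B (q z)) :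
      mvfderiv I' (fun z ↦ (θ (q z) ∘L mfderiv I' I q z) (X' z)) y (Y' y) =
        mvfderiv I (fun z ↦ θ z (A z)) (q y) (B (q y)) := by
    have : (fun z ↦ (θ (q z) ∘L mfderiv I' I q z) (X' z)) = (fun z ↦ θ z (A z)) ∘ q := by
      funext z
      rw [ContinuousLinearMap.comp_apply, hXA, Function.comp_apply]
    rw [this, mvfderiv_comp_mfderiv (mdifferentiableAt_oneForm_apply (hθ _) hA) hqd, hYB]
  rw [extDerivExpr, h2 hB hYB hXA, h2 hA hXA hYB, ContinuousLinearMap.comp_apply,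
    mfderiv_mlieBracket_of_related ((hq y).of_le ENat.LEInfty.out) hX' hY' hA hB
      (Filter.Eventually.of_forall hXA) (Filter.Eventually.of_forall hYB)]

end ExteriorDerivative

/-! ### Circle bundles with connection -/

section CircleBundle

variable {F : Type*} [NormedAddCommGroup F] [NormedSpace ℝ F]
  {N : Type*} [TopologicalSpace N] [ChartedSpace F N]
  {G : Type*} [NormedAddCommGroup G] [NormedSpace ℝ G]
  {P : Type*} [TopologicalSpace P] [ChartedSpace G P] [MulAction Circle P]
  {p : P → N}

open Bundle VectorField

namespace IsPrincipalCircleBundle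

variable (hp : IsPrincipalCircleBundle (F := F) (G := G) p)
include hp

theorem surjective : Function.Surjective p := by
  intro x
  obtain ⟨U, e, -, hxU, hsource, htarget, -, -, hfst, -⟩ := hp.trivial_nhds x
  have ht : (x, (1 : Circle)) ∈ e.target := by
    rw [htarget]
    exact ⟨hxU, Set.mem_univ _⟩
  refine ⟨e.symm (x, 1), ?_⟩
  rw [← hfst _ (e.map_target ht), e.right_inv ht]

theorem contMDiff_orbit (y : P) :
    ContMDiff 𝓘(ℝ, ℝ) 𝓘(ℝ, G) ∞ (fun t : ℝ ↦ Circle.exp t • y) :=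
  hp.smooth_action.comp (contMDiff_circleExp.prodMk contMDiff_const)

theorem mfderiv_fundamentalField (y : P) :
    mfderiv 𝓘(ℝ, G) 𝓘(ℝ, F) p y (fundamentalField G y) = 0 := by
  have h0 : (fun t : ℝ ↦ Circle.exp t • y) 0 = y := by simp
  have h1 : MDifferentiableAt 𝓘(ℝ, ℝ) 𝓘(ℝ, G) (fun t : ℝ ↦ Circle.exp t • y) 0 :=
    (hp.contMDiff_orbit y 0).mdifferentiableAt (by simp)
  have h2 : MDifferentiableAt 𝓘(ℝ, G) 𝓘(ℝ, F) p y :=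
    (hp.smooth_proj y).mdifferentiableAt (by simp)
  have h3 := mfderiv_comp_of_eq (x := (0 : ℝ)) h2 h1 h0
  have h4 : p ∘ (fun t : ℝ ↦ Circle.exp t • y) = fun _ ↦ p y := by
    funext t
    exact hp.proj_smul _ _
  rw [h4, mfderiv_const] at h3
  have h5 := congrArg (fun A : ℝ →L[ℝ] F ↦ A 1) h3
  -- The orbit starts at `Circle.exp 0 • y`, whose tangent space is not literally that at `y`; the
  -- differentials are compared as maps of the model spaces.
  have h6 : (show G →L[ℝ] F from
      mfderiv 𝓘(ℝ, G) 𝓘(ℝ, F) p ((fun t : ℝ ↦ Circle.exp t • y) 0)) =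
      (show G →L[ℝ] F from mfderiv 𝓘(ℝ, G) 𝓘(ℝ, F) p y) :=
    congrArg (fun y' ↦ (show G →L[ℝ] F from mfderiv 𝓘(ℝ, G) 𝓘(ℝ, F) p y')) h0
  exact (congrArg (fun A : G →L[ℝ] F ↦ A (fundamentalField G y)) h6).symm.trans h5.symm

/-- The differential of the projection is onto, with a kernel of dimension one. -/
theorem mfderiv_proj (y : P) :
    Function.Surjective (mfderiv 𝓘(ℝ, G) 𝓘(ℝ, F) p y) ∧
    ∀ v w : TangentSpace 𝓘(ℝ, G) y, mfderiv 𝓘(ℝ, G) 𝓘(ℝ, F) p y v = 0 →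
      mfderiv 𝓘(ℝ, G) 𝓘(ℝ, F) p y w = 0 → w ≠ 0 → ∃ c : ℝ, v = c • w := by
  obtain ⟨U, e, hU, hxU, hsource, htarget, he, hes, hfst, -⟩ := hp.trivial_nhds (p y)
  have hy : y ∈ e.source := by
    rw [hsource]
    exact hxU
  have hd : e.MDifferentiable 𝓘(ℝ, G) (𝓘(ℝ, F).prod (𝓡 1)) :=
    ⟨he.mdifferentiableOn (by simp), hes.mdifferentiableOn (by simp)⟩
  have hbij := hd.mfderiv_bijective hy
  -- In a local trivialisation the projection is `Prod.fst`, so its kernel is identified with the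
  -- tangent line of the circle.
  have hcomp (v : TangentSpace 𝓘(ℝ, G) y) : mfderiv 𝓘(ℝ, G) 𝓘(ℝ, F) p y v =
      (show F × EuclideanSpace ℝ (Fin 1) from
        mfderiv 𝓘(ℝ, G) (𝓘(ℝ, F).prod (𝓡 1)) e y v).1 := by
    have h1 : p =ᶠ[𝓝 y] Prod.fst ∘ e := by
      filter_upwards [e.open_source.mem_nhds hy] with z hz
      exact (hfst z hz).symm
    rw [h1.mfderiv_eq, mfderiv_comp y mdifferentiableAt_fst (hd.mdifferentiableAt hy), mfderiv_fst]
    rfl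
  refine ⟨fun u ↦ ?_, fun v w hv hw hw0 ↦ ?_⟩
  · obtain ⟨v, hv⟩ := hbij.2 (show F × EuclideanSpace ℝ (Fin 1) from (u, 0))
    exact ⟨v, by rw [hcomp, hv]⟩
  · set A := mfderiv 𝓘(ℝ, G) (𝓘(ℝ, F).prod (𝓡 1)) e y with hA
    rw [hcomp] at hv hw
    have hfr : Module.finrank ℝ (EuclideanSpace ℝ (Fin 1)) = 1 := finrank_euclideanSpace_fin
    have hw2 : (show F × EuclideanSpace ℝ (Fin 1) from A w).2 ≠ 0 := fun h ↦
      hw0 (hbij.1 ((show A w = 0 from Prod.ext hw h).trans (map_zero A).symm))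
    obtain ⟨c, hc⟩ := exists_smul_eq_of_finrank_eq_one hfr hw2
      (show F × EuclideanSpace ℝ (Fin 1) from A v).2
    refine ⟨c, hbij.1 ?_⟩
    rw [map_smul]
    refine Prod.ext ?_ hc.symm
    refine hv.trans ?_
    change (0 : F) = c • (show F × EuclideanSpace ℝ (Fin 1) from A w).1
    have hw' : (show F × EuclideanSpace ℝ (Fin 1) from A w).1 = (0 : F) := hw
    rw [hw', smul_zero]

variable [IsManifold 𝓘(ℝ, G) ∞ P] {θ : OneForm 𝓘(ℝ, G) P} (hθ : IsConnectionForm θ)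
include hθ

/-- The kernel of the projection is the line spanned by `ξ`, on which `θ` does not vanish. -/
theorem eq_zero_of_mfderiv_eq_zero {y : P} {v : TangentSpace 𝓘(ℝ, G) y}
    (hv : mfderiv 𝓘(ℝ, G) 𝓘(ℝ, F) p y v = 0) (hv' : θ y v = 0) : v = 0 := by
  have hne : fundamentalField G y ≠ 0 := fun h ↦ by
    have := hθ.fundamental y
    rw [h, map_zero] at this
    exact zero_ne_one this
  obtain ⟨c, rfl⟩ := (hp.mfderiv_proj y).2 v _ hv (hp.mfderiv_fundamentalField y) hne
  rw [map_smul, hθ.fundamental, smul_eq_mul, mul_one] at hv'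
  rw [hv', zero_smul]

theorem exists_tangent (y : P) (u : TangentSpace 𝓘(ℝ, F) (p y)) (c : ℝ) :
    ∃ v : TangentSpace 𝓘(ℝ, G) y, mfderiv 𝓘(ℝ, G) 𝓘(ℝ, F) p y v = u ∧ θ y v = c := by
  obtain ⟨v, hv⟩ := (hp.mfderiv_proj y).1 u
  refine ⟨v + (c - θ y v) • fundamentalField G y, ?_, ?_⟩
  · rw [map_add, map_smul, hp.mfderiv_fundamentalField, smul_zero, add_zero, hv]
  · rw [map_add, map_smul, hθ.fundamental, smul_eq_mul]
    ring

/-- The `inverse` in `horizontalLift` is meaningful because `(dp, θ)` is bijective, hence invertible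
in finite dimension. -/
theorem prod_horizontalLift [FiniteDimensional ℝ F] [FiniteDimensional ℝ G] (y : P)
    (u : TangentSpace 𝓘(ℝ, F) (p y)) :
    mfderiv 𝓘(ℝ, G) 𝓘(ℝ, F) p y (horizontalLift p θ y u) = u ∧
      θ y (horizontalLift p θ y u) = 0 := by
  let A : G →L[ℝ] F × ℝ := (mfderiv 𝓘(ℝ, G) 𝓘(ℝ, F) p y).prod (θ y)
  have hA : Function.Bijective A := by
    refine ⟨(injective_iff_map_eq_zero A).2 fun v hv ↦ ?_, fun ⟨u, c⟩ ↦ ?_⟩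
    · exact hp.eq_zero_of_mfderiv_eq_zero hθ (congrArg Prod.fst hv) (congrArg Prod.snd hv)
    · obtain ⟨v, hv, hv'⟩ := hp.exists_tangent hθ y u c
      exact ⟨v, Prod.ext hv hv'⟩
  let A' : G ≃L[ℝ] F × ℝ :=
    (LinearEquiv.ofBijective (A : G →ₗ[ℝ] F × ℝ) hA).toContinuousLinearEquiv
  have hAA' : A = A' := rfl
  have h1 : A (A.inverse (u, 0)) = (u, 0) := by
    rw [hAA', ContinuousLinearMap.inverse_equiv]
    exact A'.apply_symm_apply _
  exact ⟨congrArg Prod.fst h1, congrArg Prod.snd h1⟩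

end IsPrincipalCircleBundle

end CircleBundle

/-! ### The manifold `(0, L) × P` as an instance of Calabi type. -/

section Total

variable {F : Type*} [NormedAddCommGroup F] [NormedSpace ℝ F] [FiniteDimensional ℝ F]
  {N : Type*} [TopologicalSpace N] [ChartedSpace F N]
  {G : Type*} [NormedAddCommGroup G] [NormedSpace ℝ G] [FiniteDimensional ℝ G]
  {P : Type*} [TopologicalSpace P] [ChartedSpace G P] {L : ℝ}

open Bundle VectorField

omit [FiniteDimensional ℝ G] in
theorem dSnd_apply (x : IntervalProd P L) (v : TangentSpace (totalModel G) x) :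
    dSnd L x v = (show ℝ × G from v).2 := by
  rw [dSnd, mfderiv_snd]
  rfl

omit [FiniteDimensional ℝ G] in
theorem inclP_apply (x : IntervalProd P L) (v : TangentSpace 𝓘(ℝ, G) x.2) :
    inclP L x v = ((0, v) : ℝ × G) := by
  rw [inclP, mfderiv_prod_right]
  rfl

/-- The charts of an open subset of `ℝ` are restrictions of the identity, so the inclusion reads as
the identity. -/
theorem mvfderiv_opens_val (U : TopologicalSpace.Opens ℝ) (a : U) (v : TangentSpace 𝓘(ℝ, ℝ) a) :
    mvfderiv 𝓘(ℝ, ℝ) (Subtype.val : U → ℝ) a v = v := by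
  have h1 : MDifferentiableAt 𝓘(ℝ, ℝ) 𝓘(ℝ, ℝ) (Subtype.val : U → ℝ) a :=
    (contMDiff_subtype_val a).mdifferentiableAt (by simp : (∞ : ℕ∞ω) ≠ 0)
  rw [mvfderiv_eq_fderiv_comp_extChartAt_symm a h1]
  have h2 : (Subtype.val : U → ℝ) ∘ (extChartAt 𝓘(ℝ, ℝ) a).symm
      =ᶠ[𝓝 (extChartAt 𝓘(ℝ, ℝ) a a)] id := by
    filter_upwards [extChartAt_target_mem_nhds (I := 𝓘(ℝ, ℝ)) a] with y hy
    exact (extChartAt 𝓘(ℝ, ℝ) a).right_inv hy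
  rw [h2.fderiv_eq, fderiv_id]
  rfl

omit [FiniteDimensional ℝ G] in
theorem contMDiff_intervalProd_fst :
    ContMDiff (totalModel G) 𝓘(ℝ, ℝ) ∞ (fun x : IntervalProd P L ↦ (x.1 : ℝ)) :=
  contMDiff_subtype_val.comp contMDiff_fst

omit [FiniteDimensional ℝ G] in
theorem dtForm_apply (x : IntervalProd P L) (v : TangentSpace (totalModel G) x) :
    dtForm G P L x v = (show ℝ × G from v).1 := by
  have h1 : MDifferentiableAt 𝓘(ℝ, ℝ) 𝓘(ℝ, ℝ) (Subtype.val : openInterval L → ℝ) x.1 :=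
    (contMDiff_subtype_val x.1).mdifferentiableAt (by simp : (∞ : ℕ∞ω) ≠ 0)
  have h2 := mvfderiv_comp_mfderiv (I := totalModel G) (q := (Prod.fst : IntervalProd P L → _))
    (x := x) h1 mdifferentiableAt_fst v
  refine h2.trans ?_
  rw [mvfderiv_opens_val, mfderiv_fst]
  rfl

theorem tangent_ext {x : IntervalProd P L} {v w : TangentSpace (totalModel G) x}
    (h1 : dtForm G P L x v = dtForm G P L x w) (h2 : dSnd L x v = dSnd L x w) : v = w := by
  rw [dtForm_apply, dtForm_apply] at h1
  rw [dSnd_apply, dSnd_apply] at h2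
  exact Prod.ext h1 h2

omit [FiniteDimensional ℝ G] in
theorem dSnd_inclP (x : IntervalProd P L) (u : TangentSpace 𝓘(ℝ, G) x.2) :
    dSnd L x (inclP L x u) = u := by
  rw [dSnd_apply, inclP_apply]

theorem dtForm_inclP (x : IntervalProd P L) (u : TangentSpace 𝓘(ℝ, G) x.2) :
    dtForm G P L x (inclP L x u) = 0 := by
  rw [dtForm_apply, inclP_apply]

theorem dtForm_fieldH (x : IntervalProd P L) : dtForm G P L x (fieldH L x) = 1 :=
  dtForm_apply x _

omit [FiniteDimensional ℝ G] in
theorem dSnd_fieldH (x : IntervalProd P L) :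
    dSnd L x (fieldH (G := G) L x) = 0 :=
  dSnd_apply x _

omit [FiniteDimensional ℝ G] in
theorem pullForm_inclP (θ : OneForm 𝓘(ℝ, G) P) (x : IntervalProd P L)
    (u : TangentSpace 𝓘(ℝ, G) x.2) : pullForm θ L x (inclP L x u) = θ x.2 u :=
  congrArg (θ x.2) (dSnd_inclP x u)

omit [FiniteDimensional ℝ G] in
theorem pullForm_fieldH (θ : OneForm 𝓘(ℝ, G) P) (x : IntervalProd P L) :
    pullForm θ L x (fieldH L x) = 0 :=
  (congrArg (θ x.2) (dSnd_fieldH x)).trans (map_zero _)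

omit [FiniteDimensional ℝ F] [FiniteDimensional ℝ G] in
theorem dProj_inclP (p : P → N) (x : IntervalProd P L) (u : TangentSpace 𝓘(ℝ, G) x.2) :
    dProj (F := F) p L x (inclP L x u) = mfderiv 𝓘(ℝ, G) 𝓘(ℝ, F) p x.2 u :=
  congrArg (mfderiv 𝓘(ℝ, G) 𝓘(ℝ, F) p x.2) (dSnd_inclP x u)

omit [FiniteDimensional ℝ F] [FiniteDimensional ℝ G] in
theorem dProj_fieldH (p : P → N) (x : IntervalProd P L) :
    dProj (F := F) p L x (fieldH (G := G) L x) = 0 :=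
  (congrArg (mfderiv 𝓘(ℝ, G) 𝓘(ℝ, F) p x.2) (dSnd_fieldH x)).trans (map_zero _)

variable [IsManifold 𝓘(ℝ, G) ∞ P]

omit [FiniteDimensional ℝ G] in
-- Extending the two components of `v` separately gives a projectable field, as the pull back of
-- `dθ` to the product requires.
theorem exists_field_related_snd (x : IntervalProd P L) (v : TangentSpace (totalModel G) x) :
    ∃ (Z : ∀ z : IntervalProd P L, TangentSpace (totalModel G) z)
      (W : ∀ y : P, TangentSpace 𝓘(ℝ, G) y), Z x = v ∧
      MDifferentiableAt (totalModel G) (totalModel G).tangent (T% Z) x ∧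
      MDifferentiableAt 𝓘(ℝ, G) 𝓘(ℝ, G).tangent (T% W) x.2 ∧
      ∀ z, mfderiv (totalModel G) 𝓘(ℝ, G) (Prod.snd : IntervalProd P L → P) z (Z z) = W z.2 := by
  let a : TangentSpace 𝓘(ℝ, ℝ) x.1 := (show ℝ × G from v).1
  let u : TangentSpace 𝓘(ℝ, G) x.2 := (show ℝ × G from v).2
  let A : ∀ z : openInterval L, TangentSpace 𝓘(ℝ, ℝ) z := FiberBundle.extend ℝ a
  let W : ∀ y : P, TangentSpace 𝓘(ℝ, G) y := FiberBundle.extend G u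
  have hA : ContMDiffAt 𝓘(ℝ, ℝ) 𝓘(ℝ, ℝ).tangent ∞ (T% A) x.1 := IsLeviCivita.contMDiffAt_extend a
  have hW : ContMDiffAt 𝓘(ℝ, G) 𝓘(ℝ, G).tangent ∞ (T% W) x.2 := IsLeviCivita.contMDiffAt_extend u
  refine ⟨fun z ↦ ((A z.1, W z.2) : ℝ × G), W, ?_, ?_, hW.mdifferentiableAt (by simp), fun z ↦ ?_⟩
  · exact Prod.ext (FiberBundle.extend_apply_self ℝ a) (FiberBundle.extend_apply_self G u)
  · have h1 : ContMDiffAt (totalModel G) (𝓘(ℝ, ℝ).tangent.prod 𝓘(ℝ, G).tangent) ∞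
        (fun z : IntervalProd P L ↦
          ((⟨z.1, A z.1⟩, ⟨z.2, W z.2⟩) :
            TangentBundle 𝓘(ℝ, ℝ) (openInterval L) × TangentBundle 𝓘(ℝ, G) P)) x :=
      (hA.comp x contMDiff_fst.contMDiffAt).prodMk (hW.comp x contMDiff_snd.contMDiffAt)
    have h2 := (contMDiff_equivTangentBundleProd_symm (n := ∞) (I := 𝓘(ℝ, ℝ))
      (M := openInterval L) (I' := 𝓘(ℝ, G)) (M' := P)).contMDiffAt.comp x h1
    exact h2.mdifferentiableAt (by simp)
  · rw [mfderiv_snd]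
    rfl

variable [MulAction Circle P] [IsManifold 𝓘(ℝ, F) ∞ N]
  {p : P → N} (hp : IsPrincipalCircleBundle (F := F) (G := G) p)
  {θ : OneForm 𝓘(ℝ, G) P} (hθ : IsConnectionForm θ)
omit [IsManifold 𝓘(ℝ, G) ∞ P] in
theorem dtForm_fieldXi (x : IntervalProd P L) : dtForm G P L x (fieldXi L x) = 0 :=
  dtForm_inclP x _

omit [FiniteDimensional ℝ F] [FiniteDimensional ℝ G] [IsManifold 𝓘(ℝ, G) ∞ P]
  [IsManifold 𝓘(ℝ, F) ∞ N] in
theorem bundleJ_apply (p : P → N) (θ : OneForm 𝓘(ℝ, G) P) (JN : EndField 𝓘(ℝ, F) N) (f : ℝ → ℝ)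
    (x : IntervalProd P L) (v : TangentSpace (totalModel G) x) :
    bundleJ p θ JN L f x v = dtForm G P L x v • ((1 / f x.1) • fieldXi L x)
      - pullForm θ L x v • (f x.1 • fieldH L x)
      + inclP L x (horizontalLift p θ x.2 (JN (p x.2) (dProj p L x v))) := rfl

include hp

omit [FiniteDimensional ℝ F] [FiniteDimensional ℝ G] [IsManifold 𝓘(ℝ, G) ∞ P] [IsManifold 𝓘(ℝ, F) ∞ N] in
theorem mfderiv_comp_snd (x : IntervalProd P L) :
    mfderiv (totalModel G) 𝓘(ℝ, F) (fun z : IntervalProd P L ↦ p z.2) x = dProj p L x :=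
  mfderiv_comp x ((hp.smooth_proj x.2).mdifferentiableAt (by simp)) mdifferentiableAt_snd

omit [FiniteDimensional ℝ F] [FiniteDimensional ℝ G] [IsManifold 𝓘(ℝ, G) ∞ P] [IsManifold 𝓘(ℝ, F) ∞ N] in
theorem dProj_fieldXi (x : IntervalProd P L) :
    dProj (F := F) p L x (fieldXi (G := G) L x) = 0 :=
  (dProj_inclP p x _).trans (hp.mfderiv_fundamentalField x.2)

omit hp in
include hθ in
omit [FiniteDimensional ℝ G] in
theorem pullForm_fieldXi (x : IntervalProd P L) : pullForm θ L x (fieldXi L x) = 1 :=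
  (pullForm_inclP θ x _).trans (hθ.fundamental x.2)

include hθ

theorem isCalabiType_bundleMetric {h : TwoTensor 𝓘(ℝ, F) N} {JN : EndField 𝓘(ℝ, F) N}
    (hN : IsKahler 𝓘(ℝ, F) h JN) {s : ℝ}
    (hcurv : IsExteriorDerivative 𝓘(ℝ, G) θ (fun y v w ↦
      s * kahlerForm 𝓘(ℝ, F) h JN (p y) (mfderiv 𝓘(ℝ, G) 𝓘(ℝ, F) p y v)
        (mfderiv 𝓘(ℝ, G) 𝓘(ℝ, F) p y w))) {f r : ℝ → ℝ}
    (hf : ContDiffOn ℝ ∞ f (Set.Ioo 0 L)) (hf0 : ∀ t ∈ Set.Ioo 0 L, f t ≠ 0)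
    (hr : ContDiffOn ℝ ∞ r (Set.Ioo 0 L)) (hr0 : ∀ t ∈ Set.Ioo 0 L, 0 < r t) :
    IsCalabiType (totalModel G) (bundleMetric p θ h L f r) (bundleJ p θ JN L f)
      (fun x : IntervalProd P L ↦ (x.1 : ℝ)) (pullForm θ L) (fun x ↦ p x.2) h JN s f r where
  kahler := hN
  contMDiff_t := contMDiff_intervalProd_fst
  contMDiff_Θ := contMDiff_pullback_oneForm contMDiff_snd hθ.smooth
  contMDiff_q := hp.smooth_proj.comp contMDiff_snd
  injective x v w h1 h2 h3 := by
    rw [mfderiv_comp_snd hp] at h3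
    have h4 : dSnd L x (v - w) = 0 := by
      refine hp.eq_zero_of_mfderiv_eq_zero hθ ?_ ?_
      · rw [map_sub, map_sub, sub_eq_zero]
        exact h3
      · rw [map_sub, map_sub, sub_eq_zero]
        exact h2
    rw [map_sub, sub_eq_zero] at h4
    exact tangent_ext h1 h4
  surjective x a b u := by
    obtain ⟨v, hv, hv'⟩ := hp.exists_tangent hθ x.2 u b
    refine ⟨((a, v) : ℝ × G), dtForm_apply x _, ?_, ?_⟩
    · exact (congrArg (θ x.2) (dSnd_apply x _)).trans hv'
    · rw [mfderiv_comp_snd hp]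
      exact (congrArg (mfderiv 𝓘(ℝ, G) 𝓘(ℝ, F) p x.2) (dSnd_apply x _)).trans hv
  extDeriv := by
    have := IsExteriorDerivative.pullback (I' := totalModel G)
      (q := (Prod.snd : IntervalProd P L → P)) contMDiff_snd hθ.smooth hcurv
      exists_field_related_snd
    intro x X Y hX hY
    beta_reduce
    rw [mfderiv_comp_snd hp]
    exact this x X Y hX hY
  contDiffAt_f x := hf.contDiffAt (isOpen_Ioo.mem_nhds x.1.2)
  f_ne_zero x := hf0 _ x.1.2
  contDiffAt_r x := hr.contDiffAt (isOpen_Ioo.mem_nhds x.1.2)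
  r_pos x := hr0 _ x.1.2
  metric_apply x v w := by
    rw [mfderiv_comp_snd hp]
    rfl
  mvfderiv_J x v := by
    change dtForm G P L x _ = _
    rw [bundleJ_apply, map_add, map_sub, map_smul, map_smul, map_smul, map_smul, dtForm_fieldXi,
      dtForm_fieldH, dtForm_inclP]
    simp only [smul_eq_mul]
    ring
  Θ_J x v := by
    change _ = dtForm G P L x v / _
    rw [bundleJ_apply, map_add, map_sub, map_smul, map_smul, map_smul, map_smul,
      pullForm_fieldXi hθ, pullForm_fieldH, pullForm_inclP, (hp.prod_horizontalLift hθ _ _).2]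
    simp only [smul_eq_mul]
    ring
  mfderiv_J x v := by
    rw [mfderiv_comp_snd hp, bundleJ_apply, map_add, map_sub, map_smul, map_smul, map_smul,
      map_smul, dProj_fieldXi hp, dProj_fieldH, dProj_inclP, (hp.prod_horizontalLift hθ _ _).1]
    simp only [smul_zero, sub_zero, zero_add]

/-- Translates `Δ` into the kernel of `dq`, in whose terms the geometry of Calabi type is stated. -/
theorem mem_distributionDelta_iff {x : IntervalProd P L} {v : TangentSpace (totalModel G) x} :
    v ∈ distributionDelta G P L x ↔
      mfderiv (totalModel G) 𝓘(ℝ, F) (fun z : IntervalProd P L ↦ p z.2) x v = 0 := by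
  rw [mfderiv_comp_snd hp, distributionDelta, Submodule.mem_span_pair]
  constructor
  · rintro ⟨a, b, rfl⟩
    rw [map_add, map_smul, map_smul, dProj_fieldXi hp, dProj_fieldH, smul_zero, smul_zero, add_zero]
  · intro hv
    refine ⟨dtForm G P L x v, pullForm θ L x v, ?_⟩
    have h1 : dSnd L x (pullForm θ L x v • fieldXi L x - v) = 0 := by
      refine hp.eq_zero_of_mfderiv_eq_zero hθ ?_ ?_
      · change dProj p L x _ = 0
        rw [map_sub, map_smul, dProj_fieldXi hp, hv, smul_zero, sub_zero]
      · change pullForm θ L x _ = 0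
        rw [map_sub, map_smul, pullForm_fieldXi hθ, smul_eq_mul, mul_one, sub_self]
    have h2 : dSnd L x (dtForm G P L x v • fieldH L x + pullForm θ L x v • fieldXi L x)
        = dSnd L x v := by
      rw [map_add, map_smul, dSnd_fieldH, smul_zero, zero_add]
      rwa [map_sub, sub_eq_zero] at h1
    have h3 : dtForm G P L x (dtForm G P L x v • fieldH L x + pullForm θ L x v • fieldXi L x)
        = dtForm G P L x v := by
      rw [map_add, map_smul, map_smul, dtForm_fieldH, dtForm_fieldXi, smul_eq_mul, mul_one,
        smul_zero, add_zero]
    exact tangent_ext h3 h2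

end Total

theorem mainTheorem11
    {F : Type*} [NormedAddCommGroup F] [NormedSpace ℝ F] [FiniteDimensional ℝ F]
    {N : Type*} [TopologicalSpace N] [T2Space N] [SecondCountableTopology N] [ChartedSpace F N]
    [IsManifold 𝓘(ℝ, F) ∞ N] [Nonempty N]
    {G : Type*} [NormedAddCommGroup G] [NormedSpace ℝ G] [FiniteDimensional ℝ G]
    {P : Type*} [TopologicalSpace P] [T2Space P] [SecondCountableTopology P] [ChartedSpace G P]
    [IsManifold 𝓘(ℝ, G) ∞ P] [MulAction Circle P]
    (hdim : 0 < Module.finrank ℝ F)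
    (h : TwoTensor 𝓘(ℝ, F) N) (JN : EndField 𝓘(ℝ, F) N) (hN : IsKahler 𝓘(ℝ, F) h JN)
    (p : P → N) (hp : IsPrincipalCircleBundle (F := F) (G := G) p)
    (θ : OneForm 𝓘(ℝ, G) P) (hθ : IsConnectionForm θ)
    (s : ℝ) (hs : s ≠ 0)
    (hcurv : IsExteriorDerivative 𝓘(ℝ, G) θ (fun y v w ↦
      s * kahlerForm 𝓘(ℝ, F) h JN (p y) (mfderiv 𝓘(ℝ, G) 𝓘(ℝ, F) p y v)
        (mfderiv 𝓘(ℝ, G) 𝓘(ℝ, F) p y w)))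
    (L : ℝ) (hL : 0 < L) (f r : ℝ → ℝ)
    (hf : ContDiffOn ℝ ∞ f (Set.Ioo 0 L)) (hf0 : ∀ t ∈ Set.Ioo 0 L, f t ≠ 0)
    (hr : ContDiffOn ℝ ∞ r (Set.Ioo 0 L)) (hr0 : ∀ t ∈ Set.Ioo 0 L, 0 < r t)
    (g : TwoTensor (totalModel G) (IntervalProd P L)) (hg : g = bundleMetric p θ h L f r)
    (J : EndField (totalModel G) (IntervalProd P L)) (hJ : J = bundleJ p θ JN L f)
    (τ : IntervalProd P L → ℝ) (hτ : τ = fun x ↦ (r x.1) ^ 2 / s) :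
    (IsKahler (totalModel G) g J ↔ ∀ t ∈ Set.Ioo 0 L, f t = 2 * r t * deriv r t / s) ∧
    (IsKahler (totalModel G) g J →
      ∀ cov : CovariantDerivative (totalModel G) (ℝ × G)
          (TangentSpace (totalModel G) : IntervalProd P L → Type _),
        IsLeviCivita (totalModel G) g cov →
        IsTotallyGeodesic (totalModel G) cov (distributionDelta G P L) ∧
        (∀ x : IntervalProd P L, ∃ l : ℝ, ∀ v ∈ distributionDelta G P L x,
          ∀ w : TangentSpace (totalModel G) x, ricci (totalModel G) cov x v w = l * g x v w) ∧
        (∀ x : IntervalProd P L, ∀ v ∈ distributionDelta G P L x, ∀ w : TangentSpace (totalModel G) x,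
          (∀ u ∈ distributionDelta G P L x, g x u w = 0) → ricci (totalModel G) cov x v w = 0) ∧
        IsSpecialKahlerPotential (totalModel G) g J cov τ ∧
        ∀ x : IntervalProd P L, J x (gradField (totalModel G) g τ x) = fieldXi L x) := by
  subst hg hJ hτ
  have D := isCalabiType_bundleMetric hp hθ hN hcurv hf hf0 hr hr0
  have hK : IsKahler (totalModel G) (bundleMetric p θ h L f r) (bundleJ p θ JN L f) ↔
      ∀ x : IntervalProd P L, f x.1 * s = 2 * r x.1 * deriv r x.1 := by
    refine D.isKahler_iff fun x ↦ ?_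
    have : Nontrivial F := Module.nontrivial_of_finrank_pos hdim
    exact exists_ne (0 : F)
  -- A point of `P` turns the condition over `(0, L) × P` into one for every `t`; together with `L /
  -- 2` it also shows that the product is nonempty, which the nonconstancy of `τ` needs.
  obtain ⟨y, -⟩ := hp.surjective (Classical.arbitrary N)
  have hmid : L / 2 ∈ Set.Ioo 0 L := ⟨by linarith, by linarith⟩
  have hne : Nonempty (IntervalProd P L) := ⟨(⟨L / 2, hmid⟩, y)⟩
  have hΔ (x : IntervalProd P L) (v : TangentSpace (totalModel G) x) :=
    mem_distributionDelta_iff hp hθ (v := v)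
  refine ⟨hK.trans ⟨fun hsr t ht ↦ ?_, fun hfr x ↦ ?_⟩, fun hKahler cov hc ↦ ?_⟩
  · rw [eq_div_iff hs]
    exact hsr (⟨t, ht⟩, y)
  · rw [hfr x.1 x.1.2, div_mul_cancel₀ _ hs]
  · have hsr := hK.1 hKahler
    have hric := D.exists_ricci_eq hc hsr
    refine ⟨fun x Z hZ hZΔ v hv ↦ ?_, fun x ↦ ?_, fun x v hv w hw ↦ ?_,
      D.isSpecialKahlerPotential hs hsr hc, fun x ↦ ?_⟩
    · rw [hΔ] at hv ⊢
      exact D.mfderiv_cov_eq_zero hc hZ (hZΔ.mono fun z hz ↦ (hΔ z _).1 hz) hv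
    · obtain ⟨l, hl⟩ := hric x
      exact ⟨l, fun v hv w ↦ hl v w ((hΔ x v).1 hv)⟩
    · obtain ⟨l, hl⟩ := hric x
      rw [hl v w ((hΔ x v).1 hv), hw v hv, mul_zero]
    · rw [D.J_gradField_potential hs hsr]
      refine D.injective x _ _ ?_ ?_ ?_
      · rw [IsCalabiType.mvfderiv_fieldK]
        exact (dtForm_fieldXi x).symm
      · rw [IsCalabiType.Θ_fieldK, pullForm_fieldXi hθ]
      · rw [IsCalabiType.mfderiv_fieldK, mfderiv_comp_snd hp, dProj_fieldXi hp]
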